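/- **Setting.** Let $d,M$ be integers, $M\ge 1$. The source is $x_{t+1}=f(x_t,w_t)$, $t\ge 0$, with $f:\mathbb R^d\times\mathbb R^d\to\mathbb R^d$ Borel and $\{w_t\}$ i.i.d. and independent of $x_0\sim\pi_0$. For every $x$ the law of $f(x,w_t)$ has a density $\phi(\cdot|x)$ which is positive everywhere, and these densities are bounded and Lipschitz uniformly in $x$. The chain $\{x_t\}$ is positive Harris recurrent with unique invariant probability measure $\pi^*$, and $\lim_{t\to\infty}E_{\delta_x}\|x_t\|^2=\int\|y\|^2\pi^*(dy)<\infty$ for every $x\in\mathbb R^d$. The cost $c_0:\mathbb R^d\times\mathbb U\to[0,\infty)$ is bounded and continuous, and $\mathbb U$ is compact (and nonempty). $\mathcal P(X)$ denotes the set of Borel probability measures on $X$ with the weak topology. $\mathcal Q_c$ is the set of Borel maps $Q:\mathbb R^d\to\{1,\dots,M\}$ all of whose cells $Q^{-1}(i)$ are convex (possibly empty). Fix $P\in\mathcal P(\mathbb R^d)$ with a positive density, and write $\pi Q$ for the law of $(x,Q(x))$, $x\sim\pi$. The topology of $\mathcal Q_c$ is the one in which $Q_n\to Q$ if and only if $PQ_n\to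 PQ$ weakly (quantizers with the same $PQ$ are not separated by this topology). The measurable structure of $\mathcal P(\mathbb R^d)\times\mathcal Q_c$ is the one generated by $(\pi,Q)\mapsto\pi$, $PQ$, $\pi Q$; it contains the Borel sets of the product topology. Put $$c(\pi,Q)=\sum_{i=1}^M\inf_{u\in\mathbb U}\int_{Q^{-1}(i)}c_0(x,u)\,\pi(dx),$$ and let $P(d\pi'|\pi,Q)$ be the law on $\mathcal P(\mathbb R^d)$ giving mass $\pi(Q^{-1}(m))$ to $\hat\pi(m,\pi,Q)$, the law of $f(x,w)$ when $x$ has law $\pi(\cdot\,|\,Q^{-1}(m))$ and $w$ is an independent noise variable, $m=1,\dots,M$. The set of ergodic occupation measures is $$\mathcal G=\Big\{v\in\mathcal P(\mathcal P(\mathbb R^d)\times\mathcal Q_c):\ \int f(\pi)\,v(d\pi\,dQ)=\iint f(\pi')P(d\pi'|\pi,Q)\,v(d\pi\,dQ)\ \ \forall f\in C_b(\mathcal P(\mathbb R^d))\Big\}.$$ A randomized Markov policy $\Pi\in\bar\Pi_W^C$ is a sequence of measurable randomized encoders $\hat\eta_t:\mathcal P(\mathbb R^d)\times[0,1]\to\mathcal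 Q_c$ (that is, $(\pi,r,x)\mapsto\hat\eta_t(\pi,r)(x)$ is Borel). With $\{r_t\}$ i.i.d. uniform on $[0,1]$ and independent of the source, the quantizer used at time $t$ is $Q_t=\hat\eta_t(\pi_t,r_t)$, the symbol sent is $q_t=Q_t(x_t)$, and $\pi_t=P(x_t\in\cdot\,|\,q_{[0,t-1]},r_{[0,t-1]})$. The expected occupation measures are $$v_t(D)=E^\Pi_{\pi_0}\Big[\frac1t\sum_{i=0}^{t-1}1_{\{(\pi_i,Q_i)\in D\}}\Big],\qquad t\ge1.$$ **Proposition 1.** (a) For any initial distribution $\pi_0$ and any $\Pi\in\bar\Pi_W^C$, if a subsequence $v_{t_n}$ of the expected occupation measures converges weakly to some $\bar v$, then $\bar v\in\mathcal G$ and $$\lim_{n\to\infty}\int c(\pi,Q)\,v_{t_n}(d\pi\,dQ)=\int c(\pi,Q)\,\bar v(d\pi\,dQ),$$ all the integrals being well defined and finite. (b) For any $x_0\in\mathbb R^d$, initial distribution $\pi_0=\delta_{x_0}$ and policy $\Pi\in\bar\Pi_W^C$, the set $\{v_t:t\ge1\}$ is relatively compact in $\mathcal P(\mathcal P(\mathbb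 R^d)\times\mathcal Q_c)$. (c) $\mathcal G$ is compact. Moreover, for every $v\in\mathcal G$ and every Borel set $A\subset\mathbb R^d$, $\int\pi(A)\,v(d\pi\,dQ)=\pi^*(A)$. -/

import Mathlib

open MeasureTheory ProbabilityTheory Filter Topology Set TopologicalSpace
open scoped ENNReal NNReal BoundedContinuousFunction

noncomputable section

namespace ZeroDelay

/-! ### The weak topology on probability measures is compatible with the evaluation σ-algebra -/

/-- Evaluations at the sets of a countable `π`-system of open neighbourhoods. They are measurable,
and the second countable topology that they induce is finer than the weak topology. -/
theorem exists_finer_topology (X : Type*) [TopologicalSpace X] [SecondCountableTopology X]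
    [MeasurableSpace X] [OpensMeasurableSpace X] :
    ∃ S : Set (Set X), S.Countable ∧ (∀ s ∈ S, MeasurableSet s) ∧
      induced (fun (μ : ProbabilityMeasure X) (s : S) => μ (s : Set X)) inferInstance ≤
        (inferInstance : TopologicalSpace (ProbabilityMeasure X)) := by
  have hB := isBasis_countableBasis X
  refine ⟨(fun F => ⋂₀ F) '' {F | F.Finite ∧ F ⊆ countableBasis X},
    (countable_ofPred_finite_subset (countable_countableBasis X)).image _, ?_, ?_⟩
  · rintro _ ⟨F, ⟨hF, hFB⟩, rfl⟩
    exact (hF.isOpen_sInter fun t ht => hB.isOpen (hFB ht)).measurableSet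
  · set S := (fun F => ⋂₀ F) '' {F : Set (Set X) | F.Finite ∧ F ⊆ countableBasis X} with hS
    have hcount : S.Countable :=
      (countable_ofPred_finite_subset (countable_countableBasis X)).image _
    have : Countable S := hcount.to_subtype
    set e : ProbabilityMeasure X → (S → ℝ≥0) := fun μ s => μ (s : Set X)
    rw [← continuous_id_iff_le]
    refine @continuous_iff_continuousAt _ _ (induced e inferInstance) _ _ |>.2 fun ν => ?_
    have hfc : (@nhds _ (induced e inferInstance) ν).IsCountablyGenerated := by
      rw [nhds_induced]; infer_instance
    refine IsPiSystem.tendsto_probabilityMeasure_of_tendsto_of_mem (S := S) ?_ ?_ ?_ ?_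
    · rintro _ ⟨F, ⟨hF, hFB⟩, rfl⟩ _ ⟨G, ⟨hG, hGB⟩, rfl⟩ -
      exact ⟨F ∪ G, ⟨hF.union hG, union_subset hFB hGB⟩, sInter_union F G⟩
    · rintro _ ⟨F, ⟨hF, hFB⟩, rfl⟩
      exact (hF.isOpen_sInter fun t ht => hB.isOpen (hFB ht)).measurableSet
    · intro u hu x hx
      obtain ⟨v, hv, hxv, hvu⟩ := hB.exists_subset_of_mem_open hx hu
      exact ⟨v, ⟨{v}, ⟨finite_singleton v, by simpa using hv⟩, by simp⟩,
        (hB.isOpen hv).mem_nhds hxv, hvu⟩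
    · intro s hs
      have h1 : Tendsto e (@nhds _ (induced e inferInstance) ν) (𝓝 (e ν)) := by
        rw [nhds_induced]; exact tendsto_comap
      exact (tendsto_pi_nhds.1 h1) ⟨s, hs⟩

theorem measurable_probabilityMeasure_coe {X : Type*} [MeasurableSpace X] {s : Set X}
    (hs : MeasurableSet s) : Measurable fun μ : ProbabilityMeasure X => μ s :=
  ((Measure.measurable_coe hs).comp measurable_subtype_coe).ennreal_toNNReal

instance opensMeasurableSpace_probabilityMeasure (X : Type*) [TopologicalSpace X]
    [SecondCountableTopology X] [MeasurableSpace X] [OpensMeasurableSpace X] :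
    OpensMeasurableSpace (ProbabilityMeasure X) := by
  obtain ⟨S, hS, hmeas, hle⟩ := exists_finer_topology X
  have : Countable S := hS.to_subtype
  have he : Measurable fun (μ : ProbabilityMeasure X) (s : S) => μ (s : Set X) :=
    measurable_pi_lambda _ fun s => measurable_probabilityMeasure_coe (hmeas s s.2)
  refine ⟨MeasurableSpace.generateFrom_le fun U hU => ?_⟩
  obtain ⟨V, hV, rfl⟩ := isOpen_induced_iff.1 (hle U hU)
  exact he hV.measurableSet

theorem separableSpace_of_le {Y : Type*} {t t' : TopologicalSpace Y} (hle : t' ≤ t)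
    (h : @SecondCountableTopology Y t') : @SeparableSpace Y t := by
  obtain ⟨D, hD, hdense⟩ := @SeparableSpace.exists_countable_dense Y t'
    (@SecondCountableTopology.to_separableSpace Y t' h)
  exact @SeparableSpace.mk Y t ⟨D, hD, fun x => closure.mono hle (hdense x)⟩

instance secondCountableTopology_probabilityMeasure (X : Type*) [TopologicalSpace X]
    [PseudoMetrizableSpace X] [SecondCountableTopology X] [MeasurableSpace X]
    [OpensMeasurableSpace X] : SecondCountableTopology (ProbabilityMeasure X) := by
  obtain ⟨S, hS, hmeas, hle⟩ := exists_finer_topology X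
  have : Countable S := hS.to_subtype
  have : SeparableSpace (ProbabilityMeasure X) :=
    separableSpace_of_le hle (secondCountableTopology_induced _ _ _)
  let := pseudoMetrizableSpacePseudoMetric (ProbabilityMeasure X)
  exact UniformSpace.secondCountable_of_separable _

/-! ### The source -/

/-- The state space `ℝ^d` with its Euclidean norm. -/
abbrev E (d : ℕ) : Type := EuclideanSpace ℝ (Fin d)

/-- The data of a source `x_{t+1} = f (x_t, w_t)` driven by i.i.d. noise of law `noise`. -/
structure MarkovSource (d : ℕ) where
  f : E d → E d → E d
  measurable_f : Measurable (Function.uncurry f)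
  noise : ProbabilityMeasure (E d)

namespace MarkovSource

variable {d : ℕ} (S : MarkovSource d)

/-- For every `x` the law of `f (x, w)` has a positive density `φ (· | x)`, and these densities are
bounded and Lipschitz, uniformly in `x`. -/
def HasRegularDensity : Prop :=
  ∃ (φ : E d → E d → ℝ) (C : ℝ) (C₁ : ℝ≥0),
    (∀ x, (S.noise : Measure (E d)).map (S.f x) =
      volume.withDensity fun z => ENNReal.ofReal (φ x z)) ∧
    (∀ x z, 0 < φ x z ∧ φ x z ≤ C) ∧
    ∀ x, LipschitzWith C₁ (φ x)

/-- The law of `x_{t+1}` when `x_t` has law `ρ`. -/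
def nextLaw (ρ : ProbabilityMeasure (E d)) : ProbabilityMeasure (E d) :=
  (ρ.prod S.noise).map S.measurable_f.aemeasurable

/-- The trajectory started at `x` and driven by the noise sequence `w`. -/
def orbit (x : E d) (w : ℕ → E d) : ℕ → E d
  | 0 => x
  | t + 1 => S.f (orbit x w t) (w t)

/-- The law of the i.i.d. noise sequence. -/
def noiseSeq : Measure (ℕ → E d) := Measure.infinitePi fun _ : ℕ => (S.noise : Measure (E d))

/-- Harris recurrence: for some nontrivial σ-finite `ψ`, every set of positive `ψ`-measure is almost
surely visited infinitely often, from every starting point. -/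
def HarrisRecurrent : Prop :=
  ∃ ψ : Measure (E d), SigmaFinite ψ ∧ ψ ≠ 0 ∧
    ∀ A, MeasurableSet A → 0 < ψ A → ∀ x, ∀ᵐ w ∂S.noiseSeq, ∃ᶠ t in atTop, S.orbit x w t ∈ A

/-- The chain is positive Harris recurrent with unique invariant probability measure `πs`, and the
second moments `E_{δ_x}‖x_t‖²` converge, for every `x`, to the finite second moment of `πs`. -/
structure PositiveHarris (πs : ProbabilityMeasure (E d)) : Prop where
  harris : S.HarrisRecurrent
  invariant : S.nextLaw πs = πs
  unique : ∀ ρ, S.nextLaw ρ = ρ → ρ = πs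
  second_moment_lt_top : ∫⁻ y, ‖y‖ₑ ^ 2 ∂(πs : Measure (E d)) < ∞
  tendsto_second_moment : ∀ x, Tendsto (fun t => ∫⁻ w, ‖S.orbit x w t‖ₑ ^ 2 ∂S.noiseSeq) atTop
    (𝓝 (∫⁻ y, ‖y‖ₑ ^ 2 ∂(πs : Measure (E d))))

end MarkovSource

/-! ### Quantizers with convex cells -/

/-- `P` admits a positive density with respect to Lebesgue measure. -/
def HasPositiveDensity {d : ℕ} (P : ProbabilityMeasure (E d)) : Prop :=
  ∃ g : E d → ℝ, Measurable g ∧ (∀ x, 0 < g x) ∧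
    (P : Measure (E d)) = volume.withDensity fun x => ENNReal.ofReal (g x)

/-- The set `Q_c` of `M`-cell quantizers on `ℝ^d` with convex cells. The reference measure `P` only
serves to define the topology. -/
structure ConvexQuantizer {d : ℕ} (P : ProbabilityMeasure (E d)) (M : ℕ) where
  toFun : E d → Fin M
  measurable_toFun : Measurable toFun
  convex_cell : ∀ i, Convex ℝ (toFun ⁻¹' {i})

section Quantizer

variable {d : ℕ} {P : ProbabilityMeasure (E d)} {M : ℕ}

namespace ConvexQuantizer

/-- The `i`-th cell of a quantizer. -/
def cell (Q : ConvexQuantizer P M) (i : Fin M) : Set (E d) := Q.toFun ⁻¹' {i}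

/-- The joint law `πQ` on `ℝ^d × {1, …, M}` of `(x, Q x)` when `x` has law `π`. -/
def joint (Q : ConvexQuantizer P M) (π : ProbabilityMeasure (E d)) :
    ProbabilityMeasure (E d × Fin M) :=
  π.map (f := fun x => (x, Q.toFun x)) (measurable_id.prodMk Q.measurable_toFun).aemeasurable

/-- The topology of `Q_c`: `Q_n → Q` if and only if `PQ_n → PQ` weakly. Quantizers with the same
`PQ` are topologically indistinguishable; they are identified as soon as only continuous functions
matter, but are kept apart as maps, since a law without density can charge the cell boundaries. -/
instance : TopologicalSpace (ConvexQuantizer P M) :=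
  induced (fun Q => Q.joint P) inferInstance

end ConvexQuantizer

variable (P M) in
/-- The space `P(ℝ^d) × Q_c` of pairs (belief, quantizer), with the product topology. -/
abbrev BeliefAction : Type := ProbabilityMeasure (E d) × ConvexQuantizer P M

/-- The measurable sets of `P(ℝ^d) × Q_c`: those generated by `(π, Q) ↦ π`, `(π, Q) ↦ PQ` (which
generate the Borel sets of the product topology) and `(π, Q) ↦ πQ` (which is a Borel function
wherever `π` has a density, and makes the cost and the transition law measurable elsewhere). -/
instance : MeasurableSpace (BeliefAction P M) :=
  MeasurableSpace.comap (fun z => (z.1, z.2.joint P, z.2.joint z.1)) inferInstance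

instance : OpensMeasurableSpace (BeliefAction P M) := by
  refine ⟨MeasurableSpace.generateFrom_le fun U hU => ?_⟩
  have hind : IsInducing fun z : BeliefAction P M => (z.1, z.2.joint P) :=
    IsInducing.prodMap (f := id) IsInducing.id (g := fun Q : ConvexQuantizer P M => Q.joint P) ⟨rfl⟩
  obtain ⟨V, hV, rfl⟩ := hind.isOpen_iff.1 hU
  have hm : Measurable fun z : BeliefAction P M => (z.1, z.2.joint P, z.2.joint z.1) :=
    comap_measurable _
  exact (hm.fst.prodMk hm.snd.fst) hV.measurableSet

theorem measurable_beliefAction {Ω : Type*} [MeasurableSpace Ω] {b : Ω → ProbabilityMeasure (E d)}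
    (hb : Measurable b) {Q : Ω → ConvexQuantizer P M}
    (hQ : Measurable fun p : Ω × E d => (Q p.1).toFun p.2) :
    Measurable fun ω => ((b ω, Q ω) : BeliefAction P M) := by
  have key : ∀ c : Ω → ProbabilityMeasure (E d), Measurable c →
      Measurable fun ω => (Q ω).joint (c ω) := by
    intro c hc
    refine Measurable.subtype_mk (Measure.measurable_of_measurable_coe _ fun A hA => ?_)
    let κ : Kernel Ω (E d) := ⟨fun ω => (c ω : Measure (E d)), measurable_subtype_coe.comp hc⟩
    have : IsMarkovKernel κ := ⟨fun ω => (c ω).2⟩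
    have hpre : MeasurableSet {p : Ω × E d | (p.2, (Q p.1).toFun p.2) ∈ A} :=
      (measurable_snd.prodMk hQ) hA
    have := Kernel.measurable_kernel_prodMk_left (κ := κ) hpre
    convert! this using 2 with ω
    exact Measure.map_apply (measurable_id.prodMk (Q ω).measurable_toFun) hA
  rw [measurable_comap_iff]
  exact hb.prodMk ((key _ measurable_const).prodMk (key b hb))

/-! ### Cost and transition law of the controlled belief process -/

/-- The cost `c (π, Q) = ∑_i inf_u ∫_{Q⁻¹(i)} c₀ (x, u) π(dx)` under optimal decoding. -/
def stageCost {U : Type*} (c₀ : E d × U → ℝ) (z : BeliefAction P M) : ℝ :=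
  ∑ i, ⨅ u : U, ∫ x in z.2.cell i, c₀ (x, u) ∂(z.1 : Measure (E d))

namespace MarkovSource

variable (S : MarkovSource d)

open Classical in
/-- The filtering update: the law of `x_{t+1}` when `x_t` has law `π` and `Q x_t = m` is observed,
i.e. `π(Q⁻¹(m))⁻¹ ∫_{Q⁻¹(m)} P(dx_{t+1} | x_t) π(dx_t)`. It is irrelevant when `π(Q⁻¹(m)) = 0`. -/
def posterior (z : BeliefAction P M) (m : Fin M) : ProbabilityMeasure (E d) :=
  if h : (z.1 : Measure (E d)) (z.2.cell m) = 0 then S.nextLaw z.1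
  else S.nextLaw ⟨(z.1 : Measure (E d))[|z.2.cell m], cond_isProbabilityMeasure h⟩

/-- The transition law `P(dπ' | π, Q)` of the belief process. -/
def transition (z : BeliefAction P M) : Measure (ProbabilityMeasure (E d)) :=
  ∑ m, (z.1 : Measure (E d)) (z.2.cell m) • Measure.dirac (S.posterior z m)

variable (P M) in
/-- The set `G` of ergodic occupation measures. -/
def ergodicOccupationMeasures : Set (ProbabilityMeasure (BeliefAction P M)) :=
  {v | ∀ f : ProbabilityMeasure (E d) →ᵇ ℝ,
    ∫ z, f z.1 ∂(v : Measure (BeliefAction P M)) =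
      ∫ z, ∫ ρ, f ρ ∂(S.transition z) ∂(v : Measure (BeliefAction P M))}

end MarkovSource

/-! ### Randomized Markov policies and the processes that they generate -/

variable (P M) in
/-- A randomized Walrand–Varaiya-type (Markov) policy with convex codecells: at time `t` the
quantizer is `Q_t = enc t (π_t, r_t)`, where `r_t` is uniform on `[0, 1]`. -/
structure RandomizedPolicy where
  enc : ℕ → ProbabilityMeasure (E d) → unitInterval → ConvexQuantizer P M
  measurable_enc : ∀ t, Measurable fun p : (ProbabilityMeasure (E d) × unitInterval) × E d =>
    (enc t p.1.1 p.1.2).toFun p.2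

namespace RandomizedPolicy

variable (pol : RandomizedPolicy P M) {Ω : Type*}

/-- The channel symbol `q_t = Q_t (x_t)`. -/
def symbol (x : ℕ → Ω → E d) (r : ℕ → Ω → unitInterval) (b : ℕ → Ω → ProbabilityMeasure (E d))
    (t : ℕ) (ω : Ω) : Fin M :=
  (pol.enc t (b t ω) (r t ω)).toFun (x t ω)

/-- The information `σ(q_0, …, q_{t-1}, r_0, …, r_{t-1})` available to the decoder. -/
abbrev info (x : ℕ → Ω → E d) (r : ℕ → Ω → unitInterval) (b : ℕ → Ω → ProbabilityMeasure (E d))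
    (t : ℕ) : MeasurableSpace Ω :=
  MeasurableSpace.comap (fun ω (s : Fin t) => (pol.symbol x r b s ω, r s ω)) inferInstance

end RandomizedPolicy

/-- The coding system on a probability space `(Ω, μ)`: source `x` started from `π₀`, noise `w`,
randomization `r` and beliefs `b t = π_t = P(x_t ∈ · | q_{[0,t-1]}, r_{[0,t-1]})` under policy `pol`. -/
structure CodingProcess (S : MarkovSource d) (pol : RandomizedPolicy P M)
    (π₀ : ProbabilityMeasure (E d)) {Ω : Type*} [MeasurableSpace Ω] (μ : Measure Ω) where
  x : ℕ → Ω → E d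
  w : ℕ → Ω → E d
  r : ℕ → Ω → unitInterval
  b : ℕ → Ω → ProbabilityMeasure (E d)
  measurable_x_zero : Measurable (x 0)
  measurable_w : ∀ t, Measurable (w t)
  measurable_r : ∀ t, Measurable (r t)
  dynamics : ∀ t ω, x (t + 1) ω = S.f (x t ω) (w t ω)
  law_x_zero : μ.map (x 0) = π₀
  law_w : ∀ t, μ.map (w t) = S.noise
  law_r : ∀ t, μ.map (r t) = volume
  iIndepFun_w : iIndepFun w μ
  iIndepFun_r : iIndepFun r μ
  indepFun_x_zero_w : IndepFun (x 0) (fun ω t => w t ω) μ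
  indepFun_source_r : IndepFun (fun ω => (x 0 ω, fun t => w t ω)) (fun ω t => r t ω) μ
  measurable_b_info : ∀ t, Measurable[pol.info x r b t] (b t)
  b_eq_condExp : ∀ t A, MeasurableSet A →
    (fun ω => (b t ω : Measure (E d)).real A) =ᵐ[μ]
      μ[(x t ⁻¹' A).indicator (fun _ => (1 : ℝ)) | pol.info x r b t]

namespace CodingProcess

variable {S : MarkovSource d} {pol : RandomizedPolicy P M} {π₀ : ProbabilityMeasure (E d)}
  {Ω : Type*} [MeasurableSpace Ω] {μ : Measure Ω} (X : CodingProcess S pol π₀ μ)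

/-- The pair `(π_t, Q_t)`. -/
def pair (t : ℕ) (ω : Ω) : BeliefAction P M := (X.b t ω, pol.enc t (X.b t ω) (X.r t ω))

theorem measurable_x (t : ℕ) : Measurable (X.x t) := by
  induction t with
  | zero => exact X.measurable_x_zero
  | succ t ih =>
    have : X.x (t + 1) = fun ω => Function.uncurry S.f (X.x t ω, X.w t ω) :=
      funext fun ω => X.dynamics t ω
    rw [this]
    exact S.measurable_f.comp (ih.prodMk (X.measurable_w t))

theorem measurable_symbol_of_b {t : ℕ} (hb : Measurable (X.b t)) :
    Measurable (pol.symbol X.x X.r X.b t) :=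
  (pol.measurable_enc t).comp ((hb.prodMk (X.measurable_r t)).prodMk (X.measurable_x t))

theorem measurable_b (t : ℕ) : Measurable (X.b t) := by
  induction t using Nat.strong_induction_on with
  | _ t ih =>
    refine (X.measurable_b_info t).mono ?_ le_rfl
    exact Measurable.comap_le (measurable_pi_lambda _ fun s =>
      (X.measurable_symbol_of_b (ih s s.2)).prodMk (X.measurable_r s))

theorem measurable_pair (t : ℕ) : Measurable (X.pair t) :=
  measurable_beliefAction (X.measurable_b t) <|
    (pol.measurable_enc t).comp
      ((((X.measurable_b t).comp measurable_fst).prodMk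
        ((X.measurable_r t).comp measurable_fst)).prodMk measurable_snd)

/-- The expected occupation measure `v_t(D) = E[(1/t) ∑_{i < t} 1_{(π_i, Q_i) ∈ D}]`, `t ≥ 1`. -/
def occupation [IsProbabilityMeasure μ] (t : ℕ+) : ProbabilityMeasure (BeliefAction P M) :=
  ⟨((t : ℕ) : ℝ≥0∞)⁻¹ • ∑ i ∈ Finset.range t, μ.map (X.pair i), by
    constructor
    have h : ∀ i, μ.map (X.pair i) univ = 1 := fun i => by
      rw [Measure.map_apply (X.measurable_pair i) MeasurableSet.univ]; simp
    simp only [Measure.smul_apply, Measure.finsetSum_apply, h, Finset.sum_const,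
      Finset.card_range, smul_eq_mul, nsmul_eq_mul, mul_one]
    exact ENNReal.inv_mul_cancel (by simp) (by simp)⟩

end CodingProcess

end Quantizer

end ZeroDelay

end

open ZeroDelay

noncomputable section

namespace ZeroDelay

/-! ### The evaluation σ-algebra on probability measures is the Borel σ-algebra -/

/-! The cost and the transition law need not be continuous on all pairs (π, Q): a limit of
quantizers is determined only up to cell boundaries, which a law without density may charge. The
noise removes this obstacle. Whatever was observed, the next belief is a mixture of the densities
φ(·|x), hence lies in a class `regularLaws` of laws with equi-Lipschitz, uniformly bounded
densities. This class is weakly closed (`isClosed_regularLaws`), and on it weak convergence implies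
L¹ convergence of the densities (`tendsto_integral_abs_density_sub`). Boundaries of convex sets are
Lebesgue-null, so convergent quantizers agree off sets of small measure (`tendsto_measure_ne`).
Together these give total variation convergence of the beliefs restricted to cells
(`exists_cell_integral_bound`), hence continuity of the cost, of the transition law and of πQ at
regular beliefs. By Tietze extension, weak convergence applies to such functions once the nonregular
mass vanishes (`IsRegularTest.tendsto_integral`).

Only the initial belief can be nonregular, so the nonregular mass of `v_t` is at most 1/t. By the
filtering equation (`b_succ`) the beliefs form a controlled Markov chain (`integral_b_succ`), and
the defect of invariance of `v_t` telescopes to O(1/t). This proves (a).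

For compactness, the space of quantizers is itself compact (`ConvexQuantizer.compactSpace`), so
tightness concerns the beliefs only, and it follows from tightness of their barycentres
(`exists_compact_beliefs`). The barycentre of `v_t` is the average law of the first t states, tight
by the second moments. The barycentre of an element of G is invariant for the source, hence equal to
π*. Prokhorov's theorem is applied to the codes (π, PQ), and the limit is lifted back to pairs
(`exists_subseq_tendsto`). -/

theorem upperSemicontinuous_measure_closed {X : Type*} [TopologicalSpace X] [HasOuterApproxClosed X]
    [MeasurableSpace X] [OpensMeasurableSpace X] {F : Set X} (hF : IsClosed F) :
    UpperSemicontinuous fun μ : ProbabilityMeasure X => (μ : Measure X) F := by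
  rw [upperSemicontinuous_iff_limsup_le]
  exact fun μ => ProbabilityMeasure.limsup_measure_closed_le_of_tendsto tendsto_id hF

/-- Closed sets form a generating π-system whose evaluations are upper semicontinuous, hence Borel.
Continuous maps into a space of laws thereby become measurable, as `exists_measurable_decode`
requires. -/
instance borelSpace_probabilityMeasure (X : Type*) [TopologicalSpace X] [PseudoMetrizableSpace X]
    [SecondCountableTopology X] [MeasurableSpace X] [BorelSpace X] :
    BorelSpace (ProbabilityMeasure X) := by
  refine ⟨le_antisymm ?_ OpensMeasurableSpace.borel_le⟩
  have : @Measurable _ _ (borel _) _ fun μ : ProbabilityMeasure X => (μ : Measure X) := by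
    let _ : MeasurableSpace (ProbabilityMeasure X) := borel _
    have : BorelSpace (ProbabilityMeasure X) := ⟨rfl⟩
    refine Measurable.measure_of_isPiSystem_of_isProbabilityMeasure
      (S := {F : Set X | IsClosed F}) ?_ isPiSystem_isClosed ?_
    · rw [BorelSpace.measurable_eq (α := X), borel_eq_generateFrom_isClosed]
    · exact fun F hF => (upperSemicontinuous_measure_closed hF).measurable
  exact this.comap_le

/-! ### Laws with bounded Lipschitz densities -/

/-- `g` is a nonnegative `L`-Lipschitz density of `π`, bounded by `C`. -/
structure IsRegularDensity {d : ℕ} (C : ℝ) (L : ℝ≥0) (π : ProbabilityMeasure (E d))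
    (g : E d → ℝ) : Prop where
  nonneg : ∀ z, 0 ≤ g z
  le : ∀ z, g z ≤ C
  lipschitz : LipschitzWith L g
  eq : (π : Measure (E d)) = volume.withDensity fun z => ENNReal.ofReal (g z)

/-- The laws which have an `L`-Lipschitz density bounded by `C`. -/
def regularLaws (d : ℕ) (C : ℝ) (L : ℝ≥0) : Set (ProbabilityMeasure (E d)) :=
  {π | ∃ g, IsRegularDensity C L π g}

namespace IsRegularDensity

variable {d : ℕ} {C : ℝ} {L : ℝ≥0} {π : ProbabilityMeasure (E d)} {g : E d → ℝ}

theorem measurable (h : IsRegularDensity C L π g) : Measurable g :=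
  h.lipschitz.continuous.measurable

theorem integral_eq (h : IsRegularDensity C L π g) (f : E d → ℝ) :
    ∫ z, f z ∂(π : Measure (E d)) = ∫ z, g z * f z := by
  rw [h.eq, integral_withDensity_eq_integral_toReal_smul h.measurable.ennreal_ofReal
    (ae_of_all _ fun _ => ENNReal.ofReal_lt_top)]
  simp [ENNReal.toReal_ofReal (h.nonneg _)]

theorem setIntegral_eq (h : IsRegularDensity C L π g) {A : Set (E d)} (hA : MeasurableSet A)
    (f : E d → ℝ) : ∫ z in A, f z ∂(π : Measure (E d)) = ∫ z in A, g z * f z := by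
  rw [← integral_indicator hA, h.integral_eq, ← integral_indicator hA]
  congr with z
  by_cases hz : z ∈ A <;> simp [hz]

theorem lintegral_eq_one (h : IsRegularDensity C L π g) : ∫⁻ z, ENNReal.ofReal (g z) = 1 := by
  have := measure_univ (μ := (π : Measure (E d)))
  rwa [h.eq, withDensity_apply _ MeasurableSet.univ, Measure.restrict_univ] at this

theorem integrable (h : IsRegularDensity C L π g) : Integrable g := by
  refine ⟨h.measurable.aestronglyMeasurable, ?_⟩
  rw [hasFiniteIntegral_iff_ofReal (ae_of_all _ h.nonneg), h.lintegral_eq_one]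
  exact ENNReal.one_lt_top

theorem integral_eq_one (h : IsRegularDensity C L π g) : ∫ z, g z = 1 := by
  rw [integral_eq_lintegral_of_nonneg_ae (ae_of_all _ h.nonneg)
    h.measurable.aestronglyMeasurable, h.lintegral_eq_one, ENNReal.toReal_one]

theorem absolutelyContinuous (h : IsRegularDensity C L π g) : (π : Measure (E d)) ≪ volume := by
  rw [h.eq]; exact withDensity_absolutelyContinuous _ _

end IsRegularDensity

variable {d : ℕ} {C : ℝ} {L : ℝ≥0}

/-- The value of a Lipschitz density at a point is the integral of a continuous bump, up to an error
that is uniform over the densities with a given Lipschitz constant. -/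
theorem exists_bump (C : ℝ) (L : ℝ≥0) (x : E d) {ε : ℝ} (hε : 0 < ε) :
    ∃ ψ : E d →ᵇ ℝ, ∀ (π : ProbabilityMeasure (E d)) (g : E d → ℝ), IsRegularDensity C L π g →
      |∫ z, ψ z ∂(π : Measure (E d)) - g x| ≤ L * ε := by
  -- The normalized bump has integral one and lives in the ball of radius ε, where an L-Lipschitz
  -- density stays within L ε of its value at the centre.
  let b : ContDiffBump x := ⟨ε / 2, ε, by positivity, by linarith⟩
  obtain ⟨B, hB⟩ := (b.continuous_normed (μ := volume)).bounded_above_of_compact_support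
    b.hasCompactSupport_normed
  refine ⟨BoundedContinuousFunction.ofNormedAddCommGroup (b.normed volume) b.continuous_normed B hB,
    fun π g h => ?_⟩
  have hint : Integrable fun z => b.normed volume z * g z := by
    have := b.integrable_normed (μ := volume)
    refine this.mul_bdd (c := C) h.measurable.aestronglyMeasurable (ae_of_all _ fun z => ?_)
    rw [Real.norm_eq_abs, abs_of_nonneg (h.nonneg z)]
    exact h.le z
  have h1 : ∫ z, BoundedContinuousFunction.ofNormedAddCommGroup (b.normed volume)
      b.continuous_normed B hB z ∂(π : Measure (E d)) - g x =
      ∫ z, b.normed volume z * (g z - g x) := by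
    rw [h.integral_eq]
    simp only [BoundedContinuousFunction.coe_ofNormedAddCommGroup, mul_sub]
    rw [integral_sub hint (b.integrable_normed.mul_const _), integral_mul_const, b.integral_normed,
      one_mul]
    simp only [mul_comm]
  rw [h1, ← Real.norm_eq_abs]
  calc ‖∫ z, b.normed volume z * (g z - g x)‖
      ≤ ∫ z, b.normed volume z * (L * ε) := by
        refine norm_integral_le_of_norm_le (b.integrable_normed.mul_const _)
          (ae_of_all _ fun z => ?_)
        rw [norm_mul, Real.norm_of_nonneg (b.nonneg_normed z)]
        by_cases hz : z ∈ Metric.ball x ε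
        · refine mul_le_mul_of_nonneg_left ?_ (b.nonneg_normed z)
          rw [← dist_eq_norm]
          refine (h.lipschitz.dist_le_mul z x).trans ?_
          exact mul_le_mul_of_nonneg_left (Metric.mem_ball.1 hz).le L.2
        · have : b.normed volume z = 0 := by
            rw [← Function.notMem_support, b.support_normed_eq]; exact hz
          simp [this]
    _ = L * ε := by rw [integral_mul_const, b.integral_normed, one_mul]

/-- Weak convergence of laws with equi-Lipschitz densities implies that the densities are pointwise
Cauchy. -/
theorem cauchy_map_density {ι : Type*} {l : Filter ι} [l.NeBot] {π : ι → ProbabilityMeasure (E d)}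
    {π' : ProbabilityMeasure (E d)} (hπ : Tendsto π l (𝓝 π')) {g : ι → E d → ℝ}
    (hg : ∀ i, IsRegularDensity C L (π i) (g i)) (x : E d) : Cauchy (l.map fun i => g i x) := by
  rw [Metric.cauchy_iff]
  refine ⟨inferInstance, fun ε hε => ?_⟩
  -- This radius makes each Lipschitz error at most ε/4, also when `L = 0`. With bump integrals
  -- within ε/8 of their limit, two densities differ at `x` by less than 3ε/4.
  have hδ : 0 < ε / (4 * (L + 1)) := by positivity
  have hL : L * (ε / (4 * (L + 1))) ≤ ε / 4 := by
    have : (0:ℝ) ≤ L := L.2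
    rw [mul_div_assoc', div_le_div_iff₀ (by positivity) (by positivity)]
    nlinarith
  obtain ⟨ψ, hψ⟩ := exists_bump C L x hδ
  have hlim := (ProbabilityMeasure.tendsto_iff_forall_integral_tendsto.1 hπ) ψ
  have hev := hlim (Metric.ball_mem_nhds _ (show 0 < ε / 8 by positivity))
  refine ⟨_, image_mem_map hev, ?_⟩
  rintro _ ⟨i, hi, rfl⟩ _ ⟨j, hj, rfl⟩
  have h1 := (hψ _ _ (hg i)).trans hL
  have h2 := (hψ _ _ (hg j)).trans hL
  simp only [mem_preimage, Metric.mem_ball, Real.dist_eq] at hi hj ⊢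
  rw [abs_lt] at *
  rw [abs_le] at *
  constructor <;> linarith

/-- The same bump now compares the densities with that of the limit law: equicontinuity upgrades
weak convergence to pointwise convergence. -/
theorem tendsto_density {ι : Type*} {l : Filter ι} {π : ι → ProbabilityMeasure (E d)}
    {π' : ProbabilityMeasure (E d)} (hπ : Tendsto π l (𝓝 π')) {g : ι → E d → ℝ} {g' : E d → ℝ}
    (hg : ∀ i, IsRegularDensity C L (π i) (g i)) (hg' : IsRegularDensity C L π' g') (x : E d) :
    Tendsto (fun i => g i x) l (𝓝 (g' x)) := by
  rw [Metric.tendsto_nhds]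
  intro ε hε
  have hδ : 0 < ε / (4 * (L + 1)) := by positivity
  have hL : L * (ε / (4 * (L + 1))) ≤ ε / 4 := by
    have : (0:ℝ) ≤ L := L.2
    rw [mul_div_assoc', div_le_div_iff₀ (by positivity) (by positivity)]
    nlinarith
  obtain ⟨ψ, hψ⟩ := exists_bump C L x hδ
  have hlim := (ProbabilityMeasure.tendsto_iff_forall_integral_tendsto.1 hπ) ψ
  filter_upwards [hlim (Metric.ball_mem_nhds _ (show 0 < ε / 8 by positivity))] with i hi
  have h1 := (hψ _ _ (hg i)).trans hL
  have h2 := (hψ _ _ hg').trans hL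
  simp only [mem_preimage, Metric.mem_ball, Real.dist_eq] at hi ⊢
  rw [abs_lt] at *
  rw [abs_le] at *
  constructor <;> linarith

/-- **Scheffé's lemma** for equi-Lipschitz densities. -/
theorem tendsto_integral_abs_density_sub {ι : Type*} {l : Filter ι} [l.IsCountablyGenerated]
    {π : ι → ProbabilityMeasure (E d)} {π' : ProbabilityMeasure (E d)} (hπ : Tendsto π l (𝓝 π'))
    {g : ι → E d → ℝ} {g' : E d → ℝ} (hg : ∀ i, IsRegularDensity C L (π i) (g i))
    (hg' : IsRegularDensity C L π' g') : Tendsto (fun i => ∫ z, |g i z - g' z|) l (𝓝 0) := by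
  -- With a = g i - g', |a| = a + 2 max(-a, 0), and a has integral zero because both densities have
  -- mass one. The negative part is dominated by `g'`, so pointwise convergence suffices.
  have h1 : ∀ i, ∫ z, |g i z - g' z| = 2 * ∫ z, max (g' z - g i z) 0 := by
    intro i
    have e : ∀ z, |g i z - g' z| = (g i z - g' z) + 2 * max (g' z - g i z) 0 := by
      intro z
      rcases le_total (g i z) (g' z) with h | h
      · rw [abs_of_nonpos (by linarith), max_eq_left (by linarith)]; ring
      · rw [abs_of_nonneg (by linarith), max_eq_right (by linarith)]; ring
    have hA : Integrable fun z => g i z - g' z := (hg i).integrable.sub hg'.integrable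
    have hB : Integrable fun z => 2 * max (g' z - g i z) 0 :=
      (hg'.integrable.sub (hg i).integrable).pos_part.const_mul 2
    simp only [e]
    rw [integral_add hA hB, integral_sub (hg i).integrable hg'.integrable, (hg i).integral_eq_one,
      hg'.integral_eq_one,
      sub_self, zero_add, integral_const_mul]
  have h2 : Tendsto (fun i => ∫ z, max (g' z - g i z) 0) l (𝓝 (∫ _ : E d, (0 : ℝ))) := by
    refine tendsto_integral_filter_of_dominated_convergence g' ?_ ?_ hg'.integrable ?_
    · exact Eventually.of_forall fun i =>
        ((hg'.measurable.sub (hg i).measurable).max measurable_const).aestronglyMeasurable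
    · refine Eventually.of_forall fun i => ae_of_all _ fun z => ?_
      rw [Real.norm_of_nonneg (le_max_right _ _)]
      exact max_le (by linarith [(hg i).nonneg z]) (hg'.nonneg z)
    · refine ae_of_all _ fun z => ?_
      have := ((tendsto_const_nhds (x := g' z)).sub (tendsto_density hπ hg hg' z)).max
        (tendsto_const_nhds (x := (0 : ℝ)))
      simpa using this
  simpa [h1] using h2.const_mul 2

/-- The densities are pointwise Cauchy; their limit inherits all the bounds and is a density of the
limit law. Closedness confines limits of regular beliefs to laws with densities. -/
theorem isClosed_regularLaws (d : ℕ) (C : ℝ) (L : ℝ≥0) : IsClosed (regularLaws d C L) := by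
  refine IsSeqClosed.isClosed fun π π' hmem hlim => ?_
  choose g hg using hmem
  have hex : ∀ x, ∃ y, Tendsto (fun n => g n x) atTop (𝓝 y) := fun x =>
    cauchySeq_tendsto_of_complete (cauchy_map_density hlim hg x)
  choose G hG using hex
  have hG0 : ∀ z, 0 ≤ G z := fun z => ge_of_tendsto' (hG z) fun n => (hg n).nonneg z
  have hGC : ∀ z, G z ≤ C := fun z => le_of_tendsto' (hG z) fun n => (hg n).le z
  have hGL : LipschitzWith L G := by
    refine LipschitzWith.of_dist_le_mul fun x y => ?_
    exact le_of_tendsto' ((hG x).dist (hG y)) fun n => (hg n).lipschitz.dist_le_mul x y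
  refine ⟨G, hG0, hGC, hGL, ?_⟩
  have := IsLocallyFiniteMeasure.withDensity_ofReal (μ := (volume : Measure (E d))) hGL.continuous
  -- Compactly supported tests provide the integrable majorant C‖f‖; the constant C alone need not
  -- be integrable.
  refine Measure.ext_of_integral_eq_on_compactlySupported fun f => ?_
  obtain ⟨B, hB⟩ := f.continuous.bounded_above_of_compact_support f.hasCompactSupport
  let F : E d →ᵇ ℝ := BoundedContinuousFunction.ofNormedAddCommGroup f f.continuous B hB
  have h1 := ProbabilityMeasure.tendsto_iff_forall_integral_tendsto.1 hlim F
  have h2 : Tendsto (fun n => ∫ z, F z ∂(π n : Measure (E d))) atTop (𝓝 (∫ z, G z * f z)) := by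
    simp only [fun n => (hg n).integral_eq]
    refine tendsto_integral_of_dominated_convergence (fun z => C * ‖f z‖) ?_ ?_ ?_ ?_
    · exact fun n => ((hg n).measurable.mul F.continuous.measurable).aestronglyMeasurable
    · exact (f.continuous.integrable_of_hasCompactSupport f.hasCompactSupport).norm.const_mul C
    · refine fun n => ae_of_all _ fun z => ?_
      rw [norm_mul, Real.norm_of_nonneg ((hg n).nonneg z)]
      exact mul_le_mul_of_nonneg_right ((hg n).le z) (norm_nonneg _)
    · exact ae_of_all _ fun z => (hG z).mul_const _
  rw [integral_withDensity_eq_integral_toReal_smul hGL.continuous.measurable.ennreal_ofReal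
    (ae_of_all _ fun _ => ENNReal.ofReal_lt_top)]
  simp only [ENNReal.toReal_ofReal (hG0 _), smul_eq_mul]
  exact tendsto_nhds_unique h1 h2

/-! ### The laws reached by the source in one step are regular -/

namespace MarkovSource

variable {d : ℕ} (S : MarkovSource d)

theorem measurable_f_right (x : E d) : Measurable (S.f x) :=
  S.measurable_f.comp measurable_prodMk_left

/-- The transition kernel of the source: the law of `f (x, w)`. -/
def kernel : Kernel (E d) (E d) where
  toFun x := (S.noise : Measure (E d)).map (S.f x)
  measurable' := by
    refine Measure.measurable_of_measurable_coe _ fun A hA => ?_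
    simp only [Measure.map_apply (S.measurable_f_right _) hA]
    exact measurable_measure_prodMk_left (S.measurable_f hA)

theorem kernel_apply (x : E d) : S.kernel x = (S.noise : Measure (E d)).map (S.f x) := rfl

instance : IsMarkovKernel S.kernel :=
  ⟨fun x => Measure.isProbabilityMeasure_map (S.measurable_f_right x).aemeasurable⟩

theorem nextLaw_toMeasure (ρ : ProbabilityMeasure (E d)) :
    (S.nextLaw ρ : Measure (E d)) = (ρ : Measure (E d)).bind S.kernel := by
  ext A hA
  rw [Measure.bind_apply hA S.kernel.aemeasurable]
  simp only [nextLaw, ProbabilityMeasure.toMeasure_map, ProbabilityMeasure.toMeasure_prod]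
  rw [Measure.map_apply S.measurable_f hA, Measure.prod_apply (S.measurable_f hA)]
  refine lintegral_congr fun x => ?_
  rw [kernel_apply, Measure.map_apply (S.measurable_f_right x) hA]
  rfl

/-- A regular version of the transition density is measurable in the starting point. -/
theorem measurable_density {φ : E d → E d → ℝ} {L : ℝ≥0}
    (hφ : ∀ x, S.kernel x = volume.withDensity fun z => ENNReal.ofReal (φ x z))
    (hpos : ∀ x z, 0 ≤ φ x z) (hL : ∀ x, LipschitzWith L (φ x)) (z : E d) :
    Measurable fun x => φ x z := by
  let r : ℕ → ℝ := fun n => 1 / (n + 1)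
  have hr : ∀ n, 0 < r n := fun n => by positivity
  let B : ℕ → Set (E d) := fun n => Metric.closedBall z (r n)
  have hB : ∀ n, MeasurableSet (B n) := fun n => measurableSet_closedBall
  have hB0 : ∀ n, volume.real (B n) ≠ 0 := fun n => by
    have := Metric.measure_closedBall_pos volume z (hr n)
    exact (ENNReal.toReal_pos this.ne' measure_closedBall_lt_top.ne).ne'
  -- The density at `z` is the limit of averages of the kernel over balls shrinking to `z`. These
  -- are measurable in `x`, and the Lipschitz constant bounds the error by `L * r n`.
  refine measurable_of_tendsto_metrizable
    (f := fun n x => (volume.real (B n))⁻¹ * (S.kernel x).real (B n)) (fun n => ?_) ?_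
  · exact (((S.kernel.measurable_coe (hB n)).ennreal_toReal)).const_mul _
  rw [tendsto_pi_nhds]
  intro x
  have key : ∀ n, |(volume.real (B n))⁻¹ * (S.kernel x).real (B n) - φ x z| ≤ L * r n := by
    intro n
    have hint : IntegrableOn (φ x) (B n) :=
      (hL x).continuous.continuousOn.integrableOn_compact (isCompact_closedBall _ _)
    have h1 : (S.kernel x).real (B n) = ∫ y in B n, φ x y := by
      rw [measureReal_def, hφ, withDensity_apply _ (hB n), integral_eq_lintegral_of_nonneg_ae
        (ae_of_all _ (hpos x)) (hL x).continuous.measurable.aestronglyMeasurable]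
    have h2 : (volume.real (B n))⁻¹ * (S.kernel x).real (B n) - φ x z =
        (volume.real (B n))⁻¹ * ∫ y in B n, (φ x y - φ x z) := by
      have hc : IntegrableOn (fun _ : E d => φ x z) (B n) :=
        integrableOn_const measure_closedBall_lt_top.ne
      rw [integral_sub hint hc, h1, setIntegral_const, smul_eq_mul]
      field_simp [hB0 n]
    have h3 : ‖∫ y in B n, (φ x y - φ x z)‖ ≤ L * r n * volume.real (B n) := by
      refine norm_setIntegral_le_of_norm_le_const measure_closedBall_lt_top fun y hy => ?_
      rw [← dist_eq_norm]
      exact ((hL x).dist_le_mul y z).trans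
        (mul_le_mul_of_nonneg_left (Metric.mem_closedBall.1 hy) L.2)
    rw [h2, abs_mul, abs_of_nonneg (by positivity), ← Real.norm_eq_abs]
    calc _ ≤ (volume.real (B n))⁻¹ * (L * r n * volume.real (B n)) := by gcongr
      _ = L * r n := by field_simp [hB0 n]
  rw [tendsto_iff_dist_tendsto_zero]
  refine squeeze_zero (fun _ => dist_nonneg) key ?_
  simpa [r] using tendsto_one_div_add_atTop_nhds_zero_nat.const_mul (L : ℝ)

/-- All the laws reached in one step lie in a common class of regular laws. -/
theorem exists_nextLaw_mem_regularLaws (hS : S.HasRegularDensity) :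
    ∃ (C : ℝ) (L : ℝ≥0), ∀ ρ, S.nextLaw ρ ∈ regularLaws d C L := by
  obtain ⟨φ, C, L, hφ, hb, hL⟩ := hS
  refine ⟨C, L, fun ρ => ?_⟩
  have hm := S.measurable_density hφ (fun x z => (hb x z).1.le) hL
  have hint : ∀ z, Integrable (fun x => φ x z) (ρ : Measure (E d)) := fun z =>
    Integrable.of_bound (hm z).aestronglyMeasurable C (ae_of_all _ fun x => by
      rw [Real.norm_of_nonneg (hb x z).1.le]; exact (hb x z).2)
  -- The density is the mixture of the φ x under ρ. Averaging preserves the sign, the bound and the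
  -- Lipschitz constant, whatever ρ.
  refine ⟨fun z => ∫ x, φ x z ∂(ρ : Measure (E d)), fun z => ?_, fun z => ?_, ?_, ?_⟩
  · exact integral_nonneg fun x => (hb x z).1.le
  · calc _ ≤ ∫ _, C ∂(ρ : Measure (E d)) :=
          integral_mono (hint z) (integrable_const _) fun x => (hb x z).2
      _ = C := by simp
  · refine LipschitzWith.of_dist_le_mul fun z z' => ?_
    rw [dist_eq_norm, ← integral_sub (hint z) (hint z')]
    calc _ ≤ ∫ _, L * dist z z' ∂(ρ : Measure (E d)) :=
          norm_integral_le_of_norm_le (integrable_const _) (ae_of_all _ fun x => by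
            rw [← dist_eq_norm]; exact (hL x).dist_le_mul z z')
      _ = L * dist z z' := by simp
  · ext A hA
    have hjoint : Measurable fun p : E d × E d => ENNReal.ofReal (φ p.1 p.2) := by
      have := measurable_uncurry_of_continuous_of_measurable (u := fun z x => φ x z)
        (fun x => (hL x).continuous) hm
      exact (this.comp measurable_swap).ennreal_ofReal
    rw [nextLaw_toMeasure, Measure.bind_apply hA S.kernel.aemeasurable, withDensity_apply _ hA]
    simp only [kernel_apply, hφ, withDensity_apply _ hA]
    rw [lintegral_lintegral_swap hjoint.aemeasurable]
    refine lintegral_congr fun z => ?_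
    rw [ofReal_integral_eq_lintegral_ofReal (hint z) (ae_of_all _ fun x => (hb x z).1.le)]

end MarkovSource

/-! ### Partitions into convex Borel cells -/

section Partition

variable {F : Type*} [NormedAddCommGroup F] [NormedSpace ℝ F]

/-- The half-space `f < s`, together with the part of its boundary from which the direction `v`
points into it: if `f v ≠ 0`, it is convex and so is its complement. -/
def lexHalfSpace (f : StrongDual ℝ F) (s : ℝ) (v : F) : Set F :=
  {x | f x < s ∨ (f x = s ∧ f v < 0)}

theorem convex_lexHalfSpace (f : StrongDual ℝ F) (s : ℝ) (v : F) :
    Convex ℝ (lexHalfSpace f s v) := by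
  have hf : IsLinearMap ℝ f := f.toLinearMap.isLinear
  by_cases hv : f v < 0
  · have : lexHalfSpace f s v = {x | f x ≤ s} := by
      ext x; simp [lexHalfSpace, hv, le_iff_lt_or_eq]
    rw [this]; exact convex_halfSpace_le hf s
  · have : lexHalfSpace f s v = {x | f x < s} := by
      ext x; simp [lexHalfSpace, hv]
    rw [this]; exact convex_halfSpace_lt hf s

theorem measurableSet_lexHalfSpace [MeasurableSpace F] [OpensMeasurableSpace F]
    (f : StrongDual ℝ F) (s : ℝ) (v : F) : MeasurableSet (lexHalfSpace f s v) := by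
  have hf : Measurable f := f.continuous.measurable
  exact (measurableSet_lt hf measurable_const).union
    ((measurableSet_eq_fun hf measurable_const).inter (MeasurableSet.const _))

/-- A point of the common boundary lies in the first set only if `f v < 0`, and in the second only
if `f v > 0`. -/
theorem disjoint_lexHalfSpace_neg (f : StrongDual ℝ F) (s : ℝ) (v : F) :
    Disjoint (lexHalfSpace f s v) (lexHalfSpace (-f) (-s) v) := by
  rw [Set.disjoint_left]
  rintro x (h | ⟨h, h'⟩) (k | ⟨k, k'⟩) <;>
    simp only [neg_apply] at * <;> linarith

/-- Giving a boundary point to the side towards which `v` points amounts to testing the point after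
a small shift along `v`. Since `f v ≠ 0`, the shifted point is off the hyperplane. -/
theorem eventually_lexHalfSpace (f : StrongDual ℝ F) (s : ℝ) {v : F} (hv : f v ≠ 0) (x : F) :
    ∀ᶠ ε : ℝ in 𝓝[>] 0, f (x + ε • v) ≠ s ∧
      (f (x + ε • v) < s → x ∈ lexHalfSpace f s v) := by
  have hc : Tendsto (fun ε : ℝ => f (x + ε • v)) (𝓝[>] 0) (𝓝 (f x)) := by
    have : Continuous fun ε : ℝ => f (x + ε • v) := by fun_prop
    simpa using (this.tendsto 0).mono_left nhdsWithin_le_nhds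
  rcases lt_trichotomy (f x) s with h | h | h
  · filter_upwards [hc.eventually (gt_mem_nhds h)] with ε hε
    exact ⟨hε.ne, fun _ => Or.inl h⟩
  · filter_upwards [self_mem_nhdsWithin] with ε hε
    have hε : 0 < ε := hε
    simp only [map_add, map_smul, smul_eq_mul, h]
    refine ⟨fun hh => ?_, fun hh => Or.inr ⟨h, ?_⟩⟩
    · have : ε * f v = 0 := by linarith
      rcases mul_eq_zero.1 this with h0 | h0
      · exact hε.ne' h0
      · exact hv h0
    · by_contra hneg
      push Not at hneg
      nlinarith
  · filter_upwards [hc.eventually (lt_mem_nhds h)] with ε hε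
    exact ⟨hε.ne', fun hh => absurd hh hε.le.not_gt⟩

/-- Finitely many disjoint open convex sets with dense union can be enlarged to a partition into
convex Borel sets. -/
theorem exists_convex_partition [MeasurableSpace F] [OpensMeasurableSpace F] {M : ℕ}
    {O : Fin M → Set F} (hopen : ∀ i, IsOpen (O i)) (hconv : ∀ i, Convex ℝ (O i))
    (hdisj : ∀ i j, i ≠ j → Disjoint (O i) (O j)) (hdense : Dense (⋃ i, O i)) :
    ∃ Q : F → Fin M, Measurable Q ∧ (∀ i, Convex ℝ (Q ⁻¹' {i})) ∧ ∀ i, ∀ x ∈ O i, Q x = i := by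
  have hsep : ∀ i j, ∃ (f : StrongDual ℝ F) (s : ℝ), i ≠ j →
      (∀ a ∈ O i, f a < s) ∧ ∀ b ∈ O j, s < f b := by
    intro i j
    by_cases hij : i = j
    · exact ⟨0, 0, fun h => absurd hij h⟩
    · obtain ⟨f, s, h⟩ := geometric_hahn_banach_open_open (hconv i) (hopen i) (hconv j) (hopen j)
        (hdisj i j hij)
      exact ⟨f, s, fun _ => h⟩
  choose f s hfs using hsep
  -- Pairs with an empty member are dropped, since their functional may vanish. The others are
  -- nonzero, and finitely many proper subspaces do not fill a real vector space, so one direction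
  -- `v` serves all pairs.
  let T : Type := {p : Fin M × Fin M // p.1 ≠ p.2 ∧ (O p.1).Nonempty ∧ (O p.2).Nonempty}
  obtain ⟨v, hv⟩ := Module.Dual.exists_forall_ne_zero_of_forall_exists (K := ℝ)
    (fun p : T => (f p.1.1 p.1.2).toLinearMap) (by
      rintro ⟨⟨i, j⟩, hij, ⟨a, ha⟩, ⟨b, hb⟩⟩
      by_contra! h
      have h1 := (hfs i j hij).1 a ha
      have h2 := (hfs i j hij).2 b hb
      have h3 := h a
      have h4 := h b
      simp only [ContinuousLinearMap.coe_coe] at h3 h4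
      linarith)
  have hv' : ∀ i j, i ≠ j → (O i).Nonempty → (O j).Nonempty → f i j v ≠ 0 :=
    fun i j h1 h2 h3 => hv ⟨(i, j), h1, h2, h3⟩
  -- The functionals of (i, j) and (j, i) are chosen separately, so each cell is cut by both. The
  -- half-space of `f i j` used in `A i` then faces its opposite in `A j`, which gives disjointness.
  let A : Fin M → Set F := fun i => {x | (O i).Nonempty ∧ ∀ j, j ≠ i → (O j).Nonempty →
    x ∈ lexHalfSpace (f i j) (s i j) v ∩ lexHalfSpace (-f j i) (-s j i) v}
  have hAeq : ∀ i, A i = {_x | (O i).Nonempty} ∩ ⋂ j, ⋂ (_ : j ≠ i), ⋂ (_ : (O j).Nonempty),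
      lexHalfSpace (f i j) (s i j) v ∩ lexHalfSpace (-f j i) (-s j i) v := by
    intro i; ext x; simp [A]
  have hAconv : ∀ i, Convex ℝ (A i) := by
    intro i
    rw [hAeq]
    refine Convex.inter ?_ (convex_iInter fun j => convex_iInter fun _ => convex_iInter fun _ =>
      (convex_lexHalfSpace _ _ _).inter (convex_lexHalfSpace _ _ _))
    intro x hx y hy a b _ _ _
    exact hx
  have hAmeas : ∀ i, MeasurableSet (A i) := by
    intro i
    rw [hAeq]
    exact (MeasurableSet.const _).inter (MeasurableSet.iInter fun j => MeasurableSet.iInter fun _ =>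
      MeasurableSet.iInter fun _ => (measurableSet_lexHalfSpace _ _ _).inter
        (measurableSet_lexHalfSpace _ _ _))
  have hAdisj : ∀ i j x, x ∈ A i → x ∈ A j → i = j := by
    intro i j x hi hj
    by_contra hij
    exact Set.disjoint_left.1 (disjoint_lexHalfSpace_neg (f i j) (s i j) v)
      (hi.2 j (Ne.symm hij) hj.1).1 (hj.2 i hij hi.1).2
  have hOA : ∀ i, O i ⊆ A i := by
    intro i x hx
    refine ⟨⟨x, hx⟩, fun j hj _ => ⟨Or.inl ((hfs i j hj.symm).1 x hx), Or.inl ?_⟩⟩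
    have := (hfs j i hj).2 x hx
    simp only [neg_apply]
    linarith
  have hcov : ∀ x, ∃ i, x ∈ A i := by
    intro x
    -- A small shift of `x` along `v` avoids all the separating hyperplanes. A nearby point of the
    -- dense union satisfies the same strict inequalities and lies in some `O i`; these inequalities
    -- then put `x` in `A i`.
    have hev : ∀ᶠ ε : ℝ in 𝓝[>] 0, ∀ i j, i ≠ j → (O i).Nonempty → (O j).Nonempty →
        (f i j (x + ε • v) ≠ s i j ∧
          (f i j (x + ε • v) < s i j → x ∈ lexHalfSpace (f i j) (s i j) v)) ∧
        ((-f i j) (x + ε • v) ≠ -s i j ∧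
          ((-f i j) (x + ε • v) < -s i j → x ∈ lexHalfSpace (-f i j) (-s i j) v)) := by
      simp only [eventually_all]
      intro i j h1 h2 h3
      exact (eventually_lexHalfSpace _ _ (hv' i j h1 h2 h3) x).and
        (eventually_lexHalfSpace _ _ (by simpa using hv' i j h1 h2 h3) x)
    obtain ⟨ε, hε⟩ := hev.exists
    set y := x + ε • v
    have hW : ∀ᶠ y' in 𝓝 y, ∀ i j, (f i j y < s i j → f i j y' < s i j) ∧
        (s i j < f i j y → s i j < f i j y') := by
      simp only [eventually_all, eventually_and]
      intro i j
      have hc : Tendsto (f i j) (𝓝 y) (𝓝 (f i j y)) := (f i j).continuous.tendsto y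
      exact ⟨fun h => hc.eventually (gt_mem_nhds h), fun h => hc.eventually (lt_mem_nhds h)⟩
    obtain ⟨y', hy', hmem⟩ := mem_closure_iff_frequently.1 (hdense y) |>.and_eventually hW |>.exists
    obtain ⟨i, hi⟩ := mem_iUnion.1 hy'
    refine ⟨i, ⟨y', hi⟩, fun j hj hjn => ⟨?_, ?_⟩⟩
    · have h1 := hε i j hj.symm ⟨y', hi⟩ hjn
      refine h1.1.2 (lt_of_le_of_ne (le_of_not_gt fun hgt => ?_) h1.1.1)
      have h2 := (hmem i j).2 hgt
      exact absurd ((hfs i j hj.symm).1 y' hi) h2.le.not_gt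
    · have h1 := hε j i hj hjn ⟨y', hi⟩
      refine h1.2.2 (lt_of_le_of_ne (le_of_not_gt fun hgt => ?_) h1.2.1)
      simp only [neg_apply, neg_lt_neg_iff] at hgt
      have h2 := (hmem j i).1 hgt
      exact absurd ((hfs j i hj).2 y' hi) h2.le.not_gt
  choose Q hQ using hcov
  have hpre : ∀ i, Q ⁻¹' {i} = A i := by
    intro i; ext x
    exact ⟨fun h => by have := hQ x; rwa [show Q x = i from h] at this,
      fun h => hAdisj _ _ x (hQ x) h⟩
  refine ⟨Q, measurable_to_countable' fun i => ?_, fun i => ?_, fun i x hx => ?_⟩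
  · rw [hpre]; exact hAmeas i
  · rw [hpre]; exact hAconv i
  · exact hAdisj _ _ x (hQ x) (hOA i hx)

end Partition

/-! ### Compactness of the space of quantizers with convex cells -/

namespace ConvexQuantizer

variable {d M : ℕ} {P : ProbabilityMeasure (E d)}

theorem measurableSet_cell (Q : ConvexQuantizer P M) (i : Fin M) : MeasurableSet (Q.cell i) :=
  Q.measurable_toFun (measurableSet_singleton i)

theorem isInducing_joint : IsInducing fun Q : ConvexQuantizer P M => Q.joint P := ⟨rfl⟩

instance : PseudoMetrizableSpace (ConvexQuantizer P M) :=
  isInducing_joint.pseudoMetrizableSpace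

instance : SecondCountableTopology (ConvexQuantizer P M) :=
  isInducing_joint.secondCountableTopology

theorem joint_toMeasure (Q : ConvexQuantizer P M) (π : ProbabilityMeasure (E d)) :
    (Q.joint π : Measure (E d × Fin M)) = (π : Measure (E d)).map fun x => (x, Q.toFun x) := rfl

theorem measurable_graph (Q : ConvexQuantizer P M) : Measurable fun x => (x, Q.toFun x) :=
  measurable_id.prodMk Q.measurable_toFun

theorem integral_joint (Q : ConvexQuantizer P M) (π : ProbabilityMeasure (E d))
    {F : E d × Fin M → ℝ} (hF : Measurable F) :
    ∫ p, F p ∂(Q.joint π : Measure (E d × Fin M)) =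
      ∫ x, F (x, Q.toFun x) ∂(π : Measure (E d)) := by
  rw [joint_toMeasure, integral_map Q.measurable_graph.aemeasurable hF.aestronglyMeasurable]

theorem tendsto_of_ae_eventually_eq (hP : (P : Measure (E d)) ≪ volume)
    {Q : ℕ → ConvexQuantizer P M} {Q' : ConvexQuantizer P M}
    (h : ∀ᵐ x, ∀ᶠ n in atTop, (Q n).toFun x = Q'.toFun x) : Tendsto Q atTop (𝓝 Q') := by
  rw [isInducing_joint.tendsto_nhds_iff, ProbabilityMeasure.tendsto_iff_forall_integral_tendsto]
  intro F
  have hF : Measurable F := F.continuous.measurable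
  simp only [Function.comp_apply, integral_joint _ _ hF]
  refine tendsto_integral_of_dominated_convergence (fun _ => ‖F‖) (fun n => ?_) (by fun_prop)
    (fun n => ae_of_all _ fun x => F.norm_coe_le_norm _) ?_
  · exact (hF.comp (Q n).measurable_graph).aestronglyMeasurable
  · filter_upwards [hP.ae_le h] with x hx
    exact tendsto_const_nhds.congr' (hx.mono fun n hn => by simp only [hn])

/-- Every sequence of quantizers with convex cells has a subsequence which converges almost
everywhere to such a quantizer. -/
theorem exists_subseq_ae_eventually_eq (Q : ℕ → ConvexQuantizer P M) :
    ∃ (Q' : ConvexQuantizer P M) (φ : ℕ → ℕ), StrictMono φ ∧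
      ∀ᵐ x, ∀ᶠ n in atTop, (Q (φ n)).toFun x = Q'.toFun x := by
  let D := denseSeq (E d)
  -- The labels of a dense sequence of points form an element of the compact space `ℕ → Fin M`, so
  -- along a subsequence each of them is eventually constant.
  obtain ⟨a, φ, hφ, hlim⟩ := CompactSpace.tendsto_subseq fun n k => (Q n).toFun (D k)
  have hD : ∀ k, ∀ᶠ n in atTop, (Q (φ n)).toFun (D k) = a k := by
    intro k
    have := (tendsto_pi_nhds.1 hlim) k
    rw [nhds_discrete, tendsto_pure] at this
    exact this
  -- Convexity of the cells spreads an eventual label from the dense points to their convex hull.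
  let H : Fin M → Set (E d) := fun i => convexHull ℝ (D '' (a ⁻¹' {i}))
  have hH : ∀ i, ∀ x ∈ H i, ∀ᶠ n in atTop, (Q (φ n)).toFun x = i := by
    intro i
    refine convexHull_min (t := {x | ∀ᶠ n in atTop, (Q (φ n)).toFun x = i}) ?_ ?_
    · rintro _ ⟨k, rfl, rfl⟩
      exact hD k
    · intro x hx y hy s t hs ht hst
      filter_upwards [hx, hy] with n h1 h2
      exact (Q (φ n)).convex_cell i h1 h2 hs ht hst
  -- The hulls contain the dense sequence, so their finitely many closures cover the space.
  -- Frontiers of convex sets are null, so almost every point is interior to a hull.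
  have hcov : ∀ᵐ x : E d, ∃ i, x ∈ interior (H i) := by
    have hfr : ∀ᵐ x : E d, ∀ i, x ∉ frontier (H i) := by
      rw [ae_all_iff]
      exact fun i => measure_eq_zero_iff_ae_notMem.1
        ((convex_convexHull ℝ _).addHaar_frontier volume)
    filter_upwards [hfr] with x hx
    have : x ∈ closure (⋃ i, H i) := by
      refine closure_mono ?_ (denseRange_denseSeq (E d) x)
      rintro _ ⟨k, rfl⟩
      exact mem_iUnion.2 ⟨a k, subset_convexHull ℝ _ ⟨k, rfl, rfl⟩⟩
    rw [closure_iUnion_of_finite] at this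
    obtain ⟨i, hi⟩ := mem_iUnion.1 this
    exact ⟨i, by_contra fun hn => hx i ⟨hi, hn⟩⟩
  obtain ⟨q, hq, hqc, hqO⟩ := exists_convex_partition (O := fun i => interior (H i))
    (fun i => isOpen_interior) (fun i => (convex_convexHull ℝ _).interior) (by
      intro i j hij
      rw [Set.disjoint_left]
      intro x hi hj
      obtain ⟨n, h1, h2⟩ :=
        ((hH i x (interior_subset hi)).and (hH j x (interior_subset hj))).exists
      exact hij (h1.symm.trans h2)) (by
      convert! Measure.dense_of_ae hcov using 1
      ext x; simp)
  refine ⟨⟨q, hq, hqc⟩, φ, hφ, ?_⟩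
  filter_upwards [hcov] with x ⟨i, hi⟩
  filter_upwards [hH i x (interior_subset hi)] with n hn
  rw [hn, hqO i x hi]

theorem _root_.ZeroDelay.HasPositiveDensity.absolutelyContinuous (hP : HasPositiveDensity P) :
    (P : Measure (E d)) ≪ volume := by
  obtain ⟨g, -, -, h⟩ := hP
  rw [h]; exact withDensity_absolutelyContinuous _ _

theorem _root_.ZeroDelay.HasPositiveDensity.volume_absolutelyContinuous
    (hP : HasPositiveDensity P) : volume ≪ (P : Measure (E d)) := by
  obtain ⟨g, hg, hpos, h⟩ := hP
  rw [h]
  exact withDensity_absolutelyContinuous' hg.ennreal_ofReal.aemeasurable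
    (ae_of_all _ fun x => by simpa using hpos x)

theorem compactSpace (hP : HasPositiveDensity P) : CompactSpace (ConvexQuantizer P M) := by
  rw [← isCompact_univ_iff]
  refine IsSeqCompact.isCompact fun Q _ => ?_
  obtain ⟨Q', φ, hφ, h⟩ := exists_subseq_ae_eventually_eq Q
  exact ⟨Q', mem_univ _, φ, hφ, tendsto_of_ae_eventually_eq hP.absolutelyContinuous h⟩

end ConvexQuantizer

/-! ### Convergence in total variation of the joint laws -/

section Convergence

variable {d M : ℕ} {P : ProbabilityMeasure (E d)}

namespace ConvexQuantizer

/-- Off the cell frontiers the label is locally constant, so the graph is locally open and closed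
there. As convex sets have null frontiers, the graph will be a continuity set for the portmanteau
theorem. -/
theorem frontier_graph_subset (Q : ConvexQuantizer P M) :
    frontier {p : E d × Fin M | Q.toFun p.1 = p.2} ⊆ Prod.fst ⁻¹' ⋃ i, frontier (Q.cell i) := by
  intro p hp
  by_contra hn
  simp only [mem_preimage, mem_iUnion, not_exists] at hn
  have hint : p.1 ∈ interior (Q.cell (Q.toFun p.1)) := by
    by_contra h
    exact hn _ ⟨subset_closure rfl, h⟩
  have hN : interior (Q.cell (Q.toFun p.1)) ×ˢ {p.2} ∈ 𝓝 p :=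
    (isOpen_interior.prod (isOpen_discrete _)).mem_nhds ⟨hint, rfl⟩
  have hcell : ∀ q ∈ interior (Q.cell (Q.toFun p.1)) ×ˢ {p.2},
      Q.toFun q.1 = Q.toFun p.1 ∧ q.2 = p.2 := fun q hq => by
    have : q.1 ∈ Q.cell (Q.toFun p.1) := interior_subset hq.1
    exact ⟨this, hq.2⟩
  by_cases h : Q.toFun p.1 = p.2
  · refine hp.2 (mem_interior_iff_mem_nhds.2 (mem_of_superset hN fun q hq => ?_))
    obtain ⟨h1, h2⟩ := hcell q hq
    change Q.toFun q.1 = q.2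
    rw [h1, h2, h]
  · obtain ⟨q, hq, hqD⟩ := mem_closure_iff_nhds.1 hp.1 _ hN
    obtain ⟨h1, h2⟩ := hcell q hq
    exact h (by rw [← h1, ← h2]; exact hqD)

/-- Convergent quantizers with convex cells agree up to sets of small measure. -/
theorem tendsto_measure_ne (hP : (P : Measure (E d)) ≪ volume) {ι : Type*} {l : Filter ι}
    {Q : ι → ConvexQuantizer P M} {Q' : ConvexQuantizer P M} (h : Tendsto Q l (𝓝 Q')) :
    Tendsto (fun i => (P : Measure (E d)) {x | (Q i).toFun x ≠ Q'.toFun x}) l (𝓝 0) := by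
  -- The mass that PR gives to the graph of `Q'` is the probability that `R` and `Q'` agree. For R =
  -- `Q i` it converges to the mass under PQ', which is one.
  set D : Set (E d × Fin M) := {p | Q'.toFun p.1 = p.2} with hD
  have hDm : MeasurableSet D :=
    measurableSet_eq_fun (Q'.measurable_toFun.comp measurable_fst) measurable_snd
  have hfr : (Q'.joint P : Measure (E d × Fin M)) (frontier D) = 0 := by
    refine measure_mono_null Q'.frontier_graph_subset ?_
    have hcl : MeasurableSet (⋃ i, frontier (Q'.cell i)) :=
      MeasurableSet.iUnion fun i => isClosed_frontier.measurableSet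
    rw [joint_toMeasure, Measure.map_apply Q'.measurable_graph (measurable_fst hcl)]
    refine hP (measure_iUnion_null fun i => ?_)
    exact (Q'.convex_cell i).addHaar_frontier volume
  have h1 := ProbabilityMeasure.tendsto_measure_of_null_frontier_of_tendsto'
    ((isInducing_joint.continuous.tendsto Q').comp h) hfr
  have h2 : ∀ R : ConvexQuantizer P M, (R.joint P : Measure (E d × Fin M)) D =
      (P : Measure (E d)) {x | Q'.toFun x = R.toFun x} := fun R => by
    rw [joint_toMeasure, Measure.map_apply R.measurable_graph hDm]; rfl
  have h3 : ∀ i, (P : Measure (E d)) {x | (Q i).toFun x ≠ Q'.toFun x} =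
      1 - (P : Measure (E d)) {x | Q'.toFun x = (Q i).toFun x} := fun i => by
    rw [← prob_compl_eq_one_sub (measurableSet_eq_fun Q'.measurable_toFun (Q i).measurable_toFun)]
    congr 1; ext x; simp [eq_comm]
  simp only [Function.comp_apply, h2] at h1
  simp only [h3]
  have h4 := ENNReal.Tendsto.sub (tendsto_const_nhds (x := (1 : ℝ≥0∞))) h1
    (Or.inl ENNReal.one_ne_top)
  simpa using h4

end ConvexQuantizer

/-- If `(π_i, Q_i) → (π, Q)` and all the laws are regular, then the restrictions of `π_i` to the
cells of `Q_i` converge in total variation. -/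
theorem exists_cell_integral_bound (hP : HasPositiveDensity P) {C : ℝ} {L : ℝ≥0} {ι : Type*}
    {l : Filter ι} [l.IsCountablyGenerated] {z : ι → BeliefAction P M} {z' : BeliefAction P M}
    (hz : Tendsto z l (𝓝 z')) (hreg : ∀ i, (z i).1 ∈ regularLaws d C L)
    (hreg' : z'.1 ∈ regularLaws d C L) :
    ∃ δ : ι → ℝ, Tendsto δ l (𝓝 0) ∧ ∀ (i : ι) (m : Fin M) (h : E d → ℝ) (K : ℝ), Measurable h →
      (∀ x, |h x| ≤ K) → |∫ x in (z i).2.cell m, h x ∂((z i).1 : Measure (E d)) -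
        ∫ x in z'.2.cell m, h x ∂(z'.1 : Measure (E d))| ≤ K * δ i := by
  choose g hg using hreg
  obtain ⟨g', hg'⟩ := hreg'
  have hz1 : Tendsto (fun i => (z i).1) l (𝓝 z'.1) := (continuous_fst.tendsto z').comp hz
  have hz2 : Tendsto (fun i => (z i).2) l (𝓝 z'.2) := (continuous_snd.tendsto z').comp hz
  let N : ι → Set (E d) := fun i => {x | (z i).2.toFun x ≠ z'.2.toFun x}
  have hN : ∀ i, MeasurableSet (N i) := fun i =>
    (measurableSet_eq_fun (z i).2.measurable_toFun z'.2.measurable_toFun).compl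
  have hac : (z'.1 : Measure (E d)) ≪ (P : Measure (E d)) :=
    hg'.absolutelyContinuous.trans hP.volume_absolutelyContinuous
  -- Small P-mass forces small mass under the limiting belief, by absolute continuity of the
  -- integral of its derivative with respect to `P`.
  have hNlim : Tendsto (fun i => (z'.1 : Measure (E d)).real (N i)) l (𝓝 0) := by
    have h1 := tendsto_setLIntegral_zero (μ := (P : Measure (E d)))
      (f := (z'.1 : Measure (E d)).rnDeriv P)
      (Measure.lintegral_rnDeriv_lt_top _ _).ne
      (ConvexQuantizer.tendsto_measure_ne hP.absolutelyContinuous hz2)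
    have := Measure.haveLebesgueDecomposition_of_sigmaFinite (z'.1 : Measure (E d))
      (P : Measure (E d))
    simp only [Measure.setLIntegral_rnDeriv hac] at h1
    have h2 := (ENNReal.tendsto_toReal ENNReal.zero_ne_top).comp h1
    rwa [ENNReal.toReal_zero] at h2
  -- The bound adds the L¹ distance of the densities and the mass of the disagreement set. It
  -- depends on neither the cell nor the test function; the infimum over decoder actions needs this
  -- uniformity.
  refine ⟨fun i => (∫ x, |g i x - g' x|) + (z'.1 : Measure (E d)).real (N i), ?_, ?_⟩
  · simpa using (tendsto_integral_abs_density_sub hz1 hg hg').add hNlim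
  intro i m h K hh hK
  have hA := (z i).2.measurableSet_cell m
  have hA' := z'.2.measurableSet_cell m
  have hK0 : 0 ≤ K := (abs_nonneg _).trans (hK 0)
  have hgh : ∀ {π : ProbabilityMeasure (E d)} {k : E d → ℝ}, IsRegularDensity C L π k →
      Integrable fun x => k x * h x := fun hk =>
    hk.integrable.mul_bdd (c := K) hh.aestronglyMeasurable (ae_of_all _ hK)
  have hdiff : Integrable fun x => |g i x - g' x| := ((hg i).integrable.sub hg'.integrable).abs
  have hNint : (z'.1 : Measure (E d)).real (N i) = ∫ x, (N i).indicator g' x := by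
    have := hg'.setIntegral_eq (hN i) fun _ => 1
    rw [integral_indicator (hN i)]
    simpa using this
  change _ ≤ K * ((∫ x, |g i x - g' x|) + (z'.1 : Measure (E d)).real (N i))
  rw [(hg i).setIntegral_eq hA, hg'.setIntegral_eq hA', ← integral_indicator hA,
    ← integral_indicator hA', ← integral_sub ((hgh (hg i)).indicator hA)
      ((hgh hg').indicator hA'), hNint, ← integral_add
      hdiff (hg'.integrable.indicator (hN i)),
    ← integral_const_mul, ← Real.norm_eq_abs]
  refine norm_integral_le_of_norm_le ((hdiff.add
    (hg'.integrable.indicator (hN i))).const_mul K) (ae_of_all _ fun x => ?_)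
  rw [Real.norm_eq_abs]
  have hx := hK x
  have h0 := hg'.nonneg x
  have h1 := (hg i).nonneg x
  have e1 : |g i x * h x - g' x * h x| ≤ K * |g i x - g' x| := by
    rw [← sub_mul, abs_mul, mul_comm]
    exact mul_le_mul_of_nonneg_right hx (abs_nonneg _)
  have e2 : |g i x * h x| ≤ K * (|g i x - g' x| + g' x) := by
    rw [abs_mul, mul_comm]
    refine mul_le_mul hx ?_ (abs_nonneg _) hK0
    rw [abs_of_nonneg h1]
    have := le_abs_self (g i x - g' x)
    linarith
  have e3 : |g' x * h x| ≤ K * (|g i x - g' x| + g' x) := by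
    rw [abs_mul, mul_comm]
    refine mul_le_mul hx ?_ (abs_nonneg _) hK0
    rw [abs_of_nonneg h0]
    have := abs_nonneg (g i x - g' x)
    linarith
  have e4 : 0 ≤ K * |g i x - g' x| := mul_nonneg hK0 (abs_nonneg _)
  -- Where the quantizers disagree, one of the two terms may survive alone, at the price of an extra
  -- `g'`. Elsewhere the indicators coincide and only the densities differ.
  by_cases hxN : x ∈ N i
  · rw [indicator_of_mem hxN]
    have hne : (z i).2.toFun x ≠ z'.2.toFun x := hxN
    by_cases ha : x ∈ (z i).2.cell m <;> by_cases hb : x ∈ z'.2.cell m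
    · exact absurd (Eq.trans (show (z i).2.toFun x = m from ha)
        (show z'.2.toFun x = m from hb).symm) hne
    · simpa [ha, hb] using e2
    · simpa [ha, hb] using e3
    · simp only [indicator_of_notMem ha, indicator_of_notMem hb, sub_zero, abs_zero]
      exact mul_nonneg hK0 (add_nonneg (abs_nonneg _) h0)
  · rw [indicator_of_notMem hxN, add_zero]
    have heq : (z i).2.toFun x = z'.2.toFun x := not_not.1 hxN
    have hiff : x ∈ (z i).2.cell m ↔ x ∈ z'.2.cell m := by
      simp only [ConvexQuantizer.cell, mem_preimage, heq]
    by_cases hb : x ∈ z'.2.cell m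
    · simpa [hiff.2 hb, hb] using e1
    · simpa [mt hiff.1 hb, hb] using e4

end Convergence

/-! ### The filtering update -/

section Filter

variable {d M : ℕ} {P : ProbabilityMeasure (E d)}

theorem integral_bind {X Y : Type*} [MeasurableSpace X] [MeasurableSpace Y] {μ : Measure X}
    [SFinite μ] {κ : Kernel X Y} [IsSFiniteKernel κ] {f : Y → ℝ} (hf : Integrable f (μ.bind κ)) :
    ∫ y, f y ∂(μ.bind κ) = ∫ x, ∫ y, f y ∂(κ x) ∂μ := by
  have h : (κ ∘ₖ Kernel.const Unit μ) () = μ.bind κ := by simp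
  rw [← h] at hf ⊢
  rw [Kernel.integral_comp hf, Kernel.const_apply]

theorem sum_restrict_cell (Q : ConvexQuantizer P M) (μ : Measure (E d)) :
    ∑ m, μ.restrict (Q.cell m) = μ := by
  rw [← Measure.sum_fintype, ← Measure.restrict_iUnion (fun i j hij => ?_) Q.measurableSet_cell]
  · rw [show ⋃ i, Q.cell i = univ from eq_univ_of_forall fun x => mem_iUnion.2 ⟨Q.toFun x, rfl⟩,
      Measure.restrict_univ]
  · exact Set.disjoint_left.2 fun x h1 h2 => hij (Eq.trans (Eq.symm h1) h2)

theorem integral_eq_sum_cell (Q : ConvexQuantizer P M) {μ : Measure (E d)} {f : E d → ℝ}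
    (hf : Integrable f μ) : ∫ x, f x ∂μ = ∑ m, ∫ x in Q.cell m, f x ∂μ := by
  conv_lhs => rw [← sum_restrict_cell Q μ]
  exact integral_finsetSum_measure fun m _ => hf.restrict

theorem lintegral_eq_sum_cell (Q : ConvexQuantizer P M) (μ : Measure (E d)) (f : E d → ℝ≥0∞) :
    ∫⁻ x, f x ∂μ = ∑ m, ∫⁻ x in Q.cell m, f x ∂μ := by
  conv_lhs => rw [← sum_restrict_cell Q μ]
  exact lintegral_finsetSum_measure _ _ _

namespace MarkovSource

variable (S : MarkovSource d)

/-- The defining property of the filtering update; it is trivial for cells of measure zero. -/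
theorem measure_cell_smul_posterior (z : BeliefAction P M) (m : Fin M) :
    (z.1 : Measure (E d)) (z.2.cell m) • (S.posterior z m : Measure (E d)) =
      ((z.1 : Measure (E d)).restrict (z.2.cell m)).bind S.kernel := by
  by_cases h : (z.1 : Measure (E d)) (z.2.cell m) = 0
  · rw [h, zero_smul, Measure.restrict_eq_zero.2 h, Measure.bind_zero_left]
  · have hpost : (S.posterior z m : Measure (E d)) =
        ((z.1 : Measure (E d))[|z.2.cell m]).bind S.kernel := by
      rw [posterior, dif_neg h]
      exact S.nextLaw_toMeasure _
    ext A hA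
    rw [hpost, Measure.smul_apply,
      Measure.bind_apply hA S.kernel.aemeasurable, Measure.bind_apply hA S.kernel.aemeasurable]
    simp only [ProbabilityTheory.cond]
    rw [lintegral_smul_measure, smul_eq_mul, smul_eq_mul, ← mul_assoc,
      ENNReal.mul_inv_cancel h (measure_ne_top _ _), one_mul]

theorem measure_cell_mul_integral_posterior (z : BeliefAction P M) (m : Fin M)
    (f : E d →ᵇ ℝ) :
    (z.1 : Measure (E d)).real (z.2.cell m) * ∫ y, f y ∂(S.posterior z m : Measure (E d)) =
      ∫ x in z.2.cell m, ∫ y, f y ∂(S.kernel x) ∂(z.1 : Measure (E d)) := by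
  have h := S.measure_cell_smul_posterior z m
  rw [← integral_bind, ← h, integral_smul_measure, smul_eq_mul, measureReal_def]
  rw [← h]
  exact (f.integrable _).smul_measure (measure_ne_top _ _)

theorem integral_transition (z : BeliefAction P M) (f : ProbabilityMeasure (E d) →ᵇ ℝ) :
    ∫ ρ, f ρ ∂(S.transition z) =
      ∑ m, (z.1 : Measure (E d)).real (z.2.cell m) * f (S.posterior z m) := by
  have hf : StronglyMeasurable f := f.continuous.measurable.stronglyMeasurable
  rw [transition, integral_finsetSum_measure fun m _ =>
    (f.integrable (Measure.dirac _)).smul_measure (measure_ne_top _ _)]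
  refine Finset.sum_congr rfl fun m _ => ?_
  rw [integral_smul_measure, integral_dirac' _ _ hf, smul_eq_mul, measureReal_def]

theorem sum_measureReal_cell (z : BeliefAction P M) :
    ∑ m, (z.1 : Measure (E d)).real (z.2.cell m) = 1 := by
  have := integral_eq_sum_cell z.2 (integrable_const (1 : ℝ) (μ := (z.1 : Measure (E d))))
  simpa using this.symm

theorem abs_integral_transition_le (z : BeliefAction P M) (f : ProbabilityMeasure (E d) →ᵇ ℝ) :
    |∫ ρ, f ρ ∂(S.transition z)| ≤ ‖f‖ := by
  rw [integral_transition]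
  calc _ ≤ ∑ m, |(z.1 : Measure (E d)).real (z.2.cell m) * f (S.posterior z m)| :=
        Finset.abs_sum_le_sum_abs _ _
    _ ≤ ∑ m, (z.1 : Measure (E d)).real (z.2.cell m) * ‖f‖ := by
        refine Finset.sum_le_sum fun m _ => ?_
        rw [abs_mul, abs_of_nonneg measureReal_nonneg]
        exact mul_le_mul_of_nonneg_left (f.norm_coe_le_norm _) measureReal_nonneg
    _ = ‖f‖ := by rw [← Finset.sum_mul, sum_measureReal_cell, one_mul]

theorem measurable_integral_kernel (f : E d →ᵇ ℝ) : Measurable fun x => ∫ y, f y ∂(S.kernel x) :=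
  (f.continuous.measurable.stronglyMeasurable.integral_kernel).measurable

theorem abs_integral_kernel_le (f : E d →ᵇ ℝ) (x : E d) : |∫ y, f y ∂(S.kernel x)| ≤ ‖f‖ :=
  f.norm_integral_le_norm _

/-- On regular laws, the transition law depends continuously on the belief and the quantizer. -/
theorem tendsto_integral_transition (hP : HasPositiveDensity P) {C : ℝ} {L : ℝ≥0} {ι : Type*}
    {l : Filter ι} [l.IsCountablyGenerated] {z : ι → BeliefAction P M} {z' : BeliefAction P M}
    (hz : Tendsto z l (𝓝 z')) (hreg : ∀ i, (z i).1 ∈ regularLaws d C L)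
    (hreg' : z'.1 ∈ regularLaws d C L) (f : ProbabilityMeasure (E d) →ᵇ ℝ) :
    Tendsto (fun i => ∫ ρ, f ρ ∂(S.transition (z i))) l (𝓝 (∫ ρ, f ρ ∂(S.transition z'))) := by
  obtain ⟨δ, hδ, hb⟩ := exists_cell_integral_bound hP hz hreg hreg'
  have hconv : ∀ (m : Fin M) (h : E d → ℝ) (K : ℝ), Measurable h → (∀ x, |h x| ≤ K) →
      Tendsto (fun i => ∫ x in (z i).2.cell m, h x ∂((z i).1 : Measure (E d))) l
        (𝓝 (∫ x in z'.2.cell m, h x ∂(z'.1 : Measure (E d)))) := by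
    intro m h K hh hK
    rw [tendsto_iff_dist_tendsto_zero]
    refine squeeze_zero (fun _ => dist_nonneg) (fun i => hb i m h K hh hK) ?_
    simpa using hδ.const_mul K
  have hmass : ∀ m, Tendsto (fun i => ((z i).1 : Measure (E d)).real ((z i).2.cell m)) l
      (𝓝 ((z'.1 : Measure (E d)).real (z'.2.cell m))) := by
    intro m
    simpa using hconv m (fun _ => 1) 1 measurable_const (by simp)
  simp only [integral_transition]
  refine tendsto_finsetSum _ fun m _ => ?_
  -- If the limiting cell is null, the posteriors may fail to converge, but their weight vanishes
  -- while `f` stays bounded.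
  by_cases h0 : (z'.1 : Measure (E d)).real (z'.2.cell m) = 0
  · rw [h0, zero_mul]
    have hm := hmass m
    rw [h0] at hm
    refine squeeze_zero_norm (a := fun i => ((z i).1 : Measure (E d)).real ((z i).2.cell m) * ‖f‖)
      (fun i => ?_) (by simpa using hm.mul_const ‖f‖)
    rw [norm_mul, Real.norm_of_nonneg measureReal_nonneg]
    exact mul_le_mul_of_nonneg_left (f.norm_coe_le_norm _) measureReal_nonneg
  · refine (hmass m).mul ((f.continuous.tendsto _).comp ?_)
    rw [ProbabilityMeasure.tendsto_iff_forall_integral_tendsto]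
    intro k
    -- The kernel average of `k` is only known to be measurable in the starting point. Total
    -- variation convergence accepts it, where weak convergence would ask for continuity.
    have h1 := hconv m _ ‖k‖ (S.measurable_integral_kernel k) (S.abs_integral_kernel_le k)
    simp only [← measure_cell_mul_integral_posterior] at h1
    have h2 := h1.div (hmass m) h0
    rw [mul_div_cancel_left₀ _ h0] at h2
    refine h2.congr' ?_
    filter_upwards [(hmass m).eventually_ne h0] with i hi
    rw [Pi.div_apply, mul_div_cancel_left₀ _ hi]

end MarkovSource

end Filter

/-! ### Measurability of the cost and of the transition law -/

section Measurability

variable {d M : ℕ} {P : ProbabilityMeasure (E d)}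

theorem measurable_probabilityMeasure {X Y : Type*} [MeasurableSpace X] [MeasurableSpace Y]
    {f : X → ProbabilityMeasure Y}
    (h : ∀ A, MeasurableSet A → Measurable fun x => (f x : Measure Y) A) : Measurable f :=
  Measurable.subtype_mk (Measure.measurable_of_measurable_coe _ h)

theorem measurable_belief : Measurable fun z : BeliefAction P M => z.1 :=
  (comap_measurable fun z : BeliefAction P M => (z.1, z.2.joint P, z.2.joint z.1)).fst

theorem measurable_belief_joint : Measurable fun z : BeliefAction P M => z.2.joint z.1 :=
  (comap_measurable fun z : BeliefAction P M => (z.1, z.2.joint P, z.2.joint z.1)).snd.snd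

theorem measurable_reference_joint : Measurable fun z : BeliefAction P M => z.2.joint P :=
  (comap_measurable fun z : BeliefAction P M => (z.1, z.2.joint P, z.2.joint z.1)).snd.fst

/-- An integral over a cell is the integral of a function of (x, label) against πQ. This is where
the third generator of the σ-algebra on pairs is used. -/
theorem measurable_lintegral_cell (m : Fin M) {h : E d → ℝ≥0∞} (hh : Measurable h) :
    Measurable fun z : BeliefAction P M =>
      ∫⁻ x in z.2.cell m, h x ∂(z.1 : Measure (E d)) := by
  let F : E d × Fin M → ℝ≥0∞ := (Prod.snd ⁻¹' {m}).indicator fun p => h p.1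
  have hF : Measurable F :=
    (hh.comp measurable_fst).indicator (measurable_snd (measurableSet_singleton m))
  have key : ∀ z : BeliefAction P M, ∫⁻ x in z.2.cell m, h x ∂(z.1 : Measure (E d)) =
      ∫⁻ p, F p ∂(z.2.joint z.1 : Measure (E d × Fin M)) := by
    intro z
    rw [ConvexQuantizer.joint_toMeasure, lintegral_map hF z.2.measurable_graph,
      ← lintegral_indicator (z.2.measurableSet_cell m)]
    rfl
  simp only [key]
  exact (Measure.measurable_lintegral hF).comp
    (measurable_subtype_coe.comp measurable_belief_joint)

theorem measurable_measure_cell (m : Fin M) : Measurable fun z : BeliefAction P M =>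
    (z.1 : Measure (E d)) (z.2.cell m) := by
  simpa using measurable_lintegral_cell (P := P) m (measurable_const (a := (1 : ℝ≥0∞)))

namespace MarkovSource

variable (S : MarkovSource d)

theorem measurable_nextLaw : Measurable S.nextLaw := by
  refine measurable_probabilityMeasure fun A hA => ?_
  simp only [nextLaw_toMeasure, Measure.bind_apply hA S.kernel.aemeasurable]
  exact (Measure.measurable_lintegral (S.kernel.measurable_coe hA)).comp measurable_subtype_coe

theorem posterior_apply {z : BeliefAction P M} {m : Fin M}
    (h : (z.1 : Measure (E d)) (z.2.cell m) ≠ 0) {A : Set (E d)} (hA : MeasurableSet A) :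
    (S.posterior z m : Measure (E d)) A = ((z.1 : Measure (E d)) (z.2.cell m))⁻¹ *
      ∫⁻ x in z.2.cell m, S.kernel x A ∂(z.1 : Measure (E d)) := by
  rw [← Measure.bind_apply hA S.kernel.aemeasurable, ← measure_cell_smul_posterior,
    Measure.smul_apply, smul_eq_mul, ← mul_assoc,
    ENNReal.inv_mul_cancel h (measure_ne_top _ _), one_mul]

theorem measurable_posterior (m : Fin M) :
    Measurable fun z : BeliefAction P M => S.posterior z m := by
  classical
  refine measurable_probabilityMeasure fun A hA => ?_
  have key : ∀ z : BeliefAction P M, (S.posterior z m : Measure (E d)) A =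
      if (z.1 : Measure (E d)) (z.2.cell m) = 0 then (S.nextLaw z.1 : Measure (E d)) A
      else ((z.1 : Measure (E d)) (z.2.cell m))⁻¹ *
        ∫⁻ x in z.2.cell m, S.kernel x A ∂(z.1 : Measure (E d)) := by
    intro z
    split_ifs with h
    · rw [posterior, dif_pos h]
    · exact S.posterior_apply h hA
  simp only [key]
  refine Measurable.ite (measurable_measure_cell m (measurableSet_singleton 0)) ?_ ?_
  · exact (Measure.measurable_coe hA).comp
      (measurable_subtype_coe.comp (S.measurable_nextLaw.comp measurable_belief))
  · exact (measurable_measure_cell m).inv.mul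
      (measurable_lintegral_cell m (S.kernel.measurable_coe hA))

theorem measurable_integral_transition (f : ProbabilityMeasure (E d) →ᵇ ℝ) :
    Measurable fun z : BeliefAction P M => ∫ ρ, f ρ ∂(S.transition z) := by
  simp only [integral_transition]
  exact Finset.measurable_fun_sum _ fun m _ => (measurable_measure_cell m).ennreal_toReal.mul
    (f.continuous.measurable.comp (S.measurable_posterior m))

end MarkovSource

section Cost

variable {U : Type*} {c₀ : E d × U → ℝ} {K : ℝ}

/-- The cost factors through πQ. For each cell it is an infimum of continuous functionals of the
joint law, hence upper semicontinuous and Borel, however large the family of actions. -/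
theorem measurable_stageCost [TopologicalSpace U] (hc₀ : Continuous c₀) (h0 : ∀ p, 0 ≤ c₀ p)
    (hK : ∀ p, c₀ p ≤ K) :
    Measurable (stageCost c₀ : BeliefAction P M → ℝ) := by
  let F : Fin M → U → E d × Fin M →ᵇ ℝ := fun i u =>
    BoundedContinuousFunction.ofNormedAddCommGroup
      (fun p => (if p.2 = i then 1 else 0) * c₀ (p.1, u))
      (((continuous_of_discreteTopology (f := fun j : Fin M => if j = i then (1 : ℝ) else 0)).comp
        continuous_snd).mul (by fun_prop)) K (fun p => by
          have h1 := h0 (p.1, u)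
          have h2 := hK (p.1, u)
          split_ifs
          · rwa [one_mul, Real.norm_of_nonneg h1]
          · simpa using h1.trans h2)
  have hF : ∀ i u p, F i u p = (if p.2 = i then 1 else 0) * c₀ (p.1, u) := fun _ _ _ => rfl
  have hF0 : ∀ i u p, 0 ≤ F i u p := fun i u p => by
    rw [hF]; have := h0 (p.1, u); split_ifs <;> simp [this]
  let G : ProbabilityMeasure (E d × Fin M) → ℝ := fun μ =>
    ∑ i, ⨅ u, ∫ p, F i u p ∂(μ : Measure (E d × Fin M))
  have hG : Measurable G := by
    refine Finset.measurable_fun_sum _ fun i _ => UpperSemicontinuous.measurable ?_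
    refine upperSemicontinuous_ciInf (fun μ => ⟨0, ?_⟩) fun u =>
      (ProbabilityMeasure.continuous_integral_boundedContinuousFunction (F i u)).upperSemicontinuous
    rintro _ ⟨u, rfl⟩
    exact integral_nonneg fun p => hF0 i u p
  have key : (stageCost c₀ : BeliefAction P M → ℝ) = fun z => G (z.2.joint z.1) := by
    ext z
    refine Finset.sum_congr rfl fun i _ => ?_
    congr 1 with u
    rw [ConvexQuantizer.integral_joint _ _ (F i u).continuous.measurable,
      ← integral_indicator (z.2.measurableSet_cell i)]
    congr with x
    by_cases hx : z.2.toFun x = i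
    · rw [indicator_of_mem (show x ∈ z.2.cell i from hx), hF, if_pos hx, one_mul]
    · rw [indicator_of_notMem (show x ∉ z.2.cell i from hx), hF, if_neg hx, zero_mul]
  rw [key]
  exact hG.comp measurable_belief_joint

theorem bddBelow_range_cell_cost (h0 : ∀ p, 0 ≤ c₀ p) (z : BeliefAction P M) (i : Fin M) :
    BddBelow (range fun u : U => ∫ x in z.2.cell i, c₀ (x, u) ∂(z.1 : Measure (E d))) :=
  ⟨0, by rintro _ ⟨u, rfl⟩; exact integral_nonneg fun x => h0 (x, u)⟩

theorem stageCost_nonneg (h0 : ∀ p, 0 ≤ c₀ p) (z : BeliefAction P M) : 0 ≤ stageCost c₀ z :=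
  Finset.sum_nonneg fun _ _ => Real.iInf_nonneg fun u => integral_nonneg fun x => h0 (x, u)

theorem stageCost_le [Nonempty U] (h0 : ∀ p, 0 ≤ c₀ p) (hK : ∀ p, c₀ p ≤ K)
    (z : BeliefAction P M) : stageCost c₀ z ≤ M * K := by
  have hu : ∀ i : Fin M, ⨅ u : U, ∫ x in z.2.cell i, c₀ (x, u) ∂(z.1 : Measure (E d)) ≤ K := by
    intro i
    refine (ciInf_le (bddBelow_range_cell_cost h0 z i) (Classical.arbitrary U)).trans ?_
    refine (le_abs_self _).trans ?_
    have hK0 : 0 ≤ K := (h0 (0, Classical.arbitrary U)).trans (hK _)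
    have := norm_setIntegral_le_of_norm_le_const (μ := (z.1 : Measure (E d))) (s := z.2.cell i)
      (f := fun x => c₀ (x, Classical.arbitrary U)) (C := K) (measure_lt_top _ _)
      (fun x _ => by rw [Real.norm_of_nonneg (h0 _)]; exact hK _)
    refine this.trans ?_
    exact mul_le_of_le_one_right hK0 measureReal_le_one
  calc _ ≤ ∑ _i : Fin M, K := Finset.sum_le_sum fun i _ => hu i
    _ = M * K := by simp

theorem abs_ciInf_sub_ciInf_le [Nonempty U] {a b : U → ℝ} {ε : ℝ} (ha : BddBelow (range a))
    (hb : BddBelow (range b)) (h : ∀ u, |a u - b u| ≤ ε) : |(⨅ u, a u) - ⨅ u, b u| ≤ ε := by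
  have h1 : (⨅ u, a u) - ε ≤ ⨅ u, b u := le_ciInf fun u => by
    have := ciInf_le ha u
    have := (abs_le.1 (h u)).2
    linarith
  have h2 : (⨅ u, b u) - ε ≤ ⨅ u, a u := le_ciInf fun u => by
    have := ciInf_le hb u
    have := (abs_le.1 (h u)).1
    linarith
  rw [abs_le]; constructor <;> linarith

/-- On regular laws, the cost depends continuously on the belief and the quantizer. -/
theorem tendsto_stageCost [TopologicalSpace U] [Nonempty U] (hP : HasPositiveDensity P)
    (hc₀ : Continuous c₀) (h0 : ∀ p, 0 ≤ c₀ p) (hK : ∀ p, c₀ p ≤ K) {C : ℝ} {L : ℝ≥0} {ι : Type*}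
    {l : Filter ι} [l.IsCountablyGenerated] {z : ι → BeliefAction P M} {z' : BeliefAction P M}
    (hz : Tendsto z l (𝓝 z')) (hreg : ∀ i, (z i).1 ∈ regularLaws d C L)
    (hreg' : z'.1 ∈ regularLaws d C L) :
    Tendsto (fun i => stageCost c₀ (z i)) l (𝓝 (stageCost c₀ z')) := by
  obtain ⟨δ, hδ, hb⟩ := exists_cell_integral_bound hP hz hreg hreg'
  refine tendsto_finsetSum _ fun m _ => ?_
  rw [tendsto_iff_dist_tendsto_zero]
  refine squeeze_zero (fun _ => dist_nonneg) (fun i => ?_)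
    (by simpa using hδ.const_mul K : Tendsto (fun i => K * δ i) l (𝓝 0))
  -- The bound does not depend on the action, so it passes to the infima.
  refine abs_ciInf_sub_ciInf_le (bddBelow_range_cell_cost h0 _ _)
    (bddBelow_range_cell_cost h0 _ _) fun u => ?_
  refine hb i m (fun x => c₀ (x, u)) K
    (hc₀.comp (by fun_prop : Continuous fun x : E d => (x, u))).measurable fun x => ?_
  rw [abs_of_nonneg (h0 _)]
  exact hK _

end Cost

/-- On regular laws, the joint law of the state and the symbol depends continuously on the belief
and the quantizer. -/
theorem tendsto_joint (hP : HasPositiveDensity P) {C : ℝ} {L : ℝ≥0} {ι : Type*}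
    {l : Filter ι} [l.IsCountablyGenerated] {z : ι → BeliefAction P M} {z' : BeliefAction P M}
    (hz : Tendsto z l (𝓝 z')) (hreg : ∀ i, (z i).1 ∈ regularLaws d C L)
    (hreg' : z'.1 ∈ regularLaws d C L) :
    Tendsto (fun i => (z i).2.joint (z i).1) l (𝓝 (z'.2.joint z'.1)) := by
  obtain ⟨δ, hδ, hb⟩ := exists_cell_integral_bound hP hz hreg hreg'
  rw [ProbabilityMeasure.tendsto_iff_forall_integral_tendsto]
  intro F
  have hF : Measurable F := F.continuous.measurable
  have key : ∀ z : BeliefAction P M, ∫ p, F p ∂(z.2.joint z.1 : Measure (E d × Fin M)) =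
      ∑ m, ∫ x in z.2.cell m, F (x, m) ∂(z.1 : Measure (E d)) := by
    intro z
    rw [ConvexQuantizer.integral_joint _ _ hF, integral_eq_sum_cell z.2]
    · refine Finset.sum_congr rfl fun m _ =>
        setIntegral_congr_fun (z.2.measurableSet_cell m) fun x hx => ?_
      have : z.2.toFun x = m := hx
      simp only [this]
    · exact Integrable.of_bound (hF.comp z.2.measurable_graph).aestronglyMeasurable ‖F‖
        (ae_of_all _ fun x => F.norm_coe_le_norm _)
  simp only [key]
  refine tendsto_finsetSum _ fun m _ => ?_
  rw [tendsto_iff_dist_tendsto_zero]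
  refine squeeze_zero (fun _ => dist_nonneg) (fun i => ?_)
    (by simpa using hδ.const_mul ‖F‖ : Tendsto (fun i => ‖F‖ * δ i) l (𝓝 0))
  exact hb i m (fun x => F (x, m)) ‖F‖ (by fun_prop) fun x => F.norm_coe_le_norm _

end Measurability

/-! ### Weak convergence of laws of pairs (belief, quantizer) -/

section Occupation

variable {d : ℕ} {P : ProbabilityMeasure (E d)} {M : ℕ} {C : ℝ} {L : ℝ≥0}

variable (P M C L) in
/-- The pairs whose belief is regular. -/
def regularPairs : Set (BeliefAction P M) := Prod.fst ⁻¹' regularLaws d C L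

theorem isClosed_regularPairs : IsClosed (regularPairs P M C L) :=
  (isClosed_regularLaws d C L).preimage continuous_fst

theorem measurableSet_regularPairs : MeasurableSet (regularPairs P M C L) :=
  isClosed_regularPairs.measurableSet

/-- A bounded function on the pairs to which weak convergence can be applied. -/
structure IsRegularTest (C : ℝ) (L : ℝ≥0) (F : BeliefAction P M → ℝ) : Prop where
  measurable : Measurable F
  bounded : ∃ K, ∀ z, |F z| ≤ K
  continuousOn : ContinuousOn F (regularPairs P M C L)

namespace IsRegularTest

variable {F : BeliefAction P M → ℝ}

theorem integrable (hF : IsRegularTest C L F) (v : ProbabilityMeasure (BeliefAction P M)) :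
    Integrable F (v : Measure (BeliefAction P M)) := by
  obtain ⟨K, hK⟩ := hF.bounded
  exact Integrable.of_bound hF.measurable.aestronglyMeasurable K (ae_of_all _ hK)

end IsRegularTest

theorem continuousOn_regularPairs {F : BeliefAction P M → ℝ}
    (h : ∀ z : regularPairs P M C L,
      Tendsto (fun w : regularPairs P M C L => F w) (𝓝 z) (𝓝 (F z))) :
    ContinuousOn F (regularPairs P M C L) :=
  continuousOn_iff_continuous_domRestrict.2 (continuous_iff_continuousAt.2 h)

theorem isRegularTest_belief (f : ProbabilityMeasure (E d) →ᵇ ℝ) :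
    IsRegularTest C L fun z : BeliefAction P M => f z.1 where
  measurable := f.continuous.measurable.comp measurable_belief
  bounded := ⟨‖f‖, fun _ => f.norm_coe_le_norm _⟩
  continuousOn := (f.continuous.comp continuous_fst).continuousOn

theorem isRegularTest_transition (hP : HasPositiveDensity P) (S : MarkovSource d)
    (f : ProbabilityMeasure (E d) →ᵇ ℝ) :
    IsRegularTest C L fun z : BeliefAction P M => ∫ ρ, f ρ ∂(S.transition z) where
  measurable := S.measurable_integral_transition f
  bounded := ⟨‖f‖, fun z => S.abs_integral_transition_le z f⟩
  continuousOn := continuousOn_regularPairs fun z =>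
    S.tendsto_integral_transition hP (continuous_subtype_val.tendsto z) (fun w => w.2) z.2 f

theorem isRegularTest_stageCost {U : Type*} [TopologicalSpace U] [Nonempty U]
    (hP : HasPositiveDensity P) {c₀ : E d × U → ℝ} {K : ℝ} (hc₀ : Continuous c₀)
    (h0 : ∀ p, 0 ≤ c₀ p) (hK : ∀ p, c₀ p ≤ K) :
    IsRegularTest C L (stageCost c₀ : BeliefAction P M → ℝ) where
  measurable := measurable_stageCost hc₀ h0 hK
  bounded := ⟨M * K, fun z => by
    rw [abs_of_nonneg (stageCost_nonneg h0 z)]; exact stageCost_le h0 hK z⟩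
  continuousOn := continuousOn_regularPairs fun z =>
    tendsto_stageCost hP hc₀ h0 hK (continuous_subtype_val.tendsto z) (fun w => w.2) z.2

/-- A limit of laws which are asymptotically concentrated on regular beliefs is concentrated on
regular beliefs. -/
theorem measure_compl_regularPairs_eq_zero {v : ℕ → ProbabilityMeasure (BeliefAction P M)}
    {v' : ProbabilityMeasure (BeliefAction P M)} (hv : Tendsto v atTop (𝓝 v'))
    (h : Tendsto (fun n => (v n : Measure (BeliefAction P M)) (regularPairs P M C L)ᶜ) atTop
      (𝓝 0)) : (v' : Measure (BeliefAction P M)) (regularPairs P M C L)ᶜ = 0 := by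
  have h1 := ProbabilityMeasure.le_liminf_measure_open_of_tendsto hv
    (isClosed_regularPairs (P := P) (M := M) (C := C) (L := L)).isOpen_compl
  rw [h.liminf_eq] at h1
  exact le_antisymm h1 zero_le

/-- Weak convergence applies to functions that are continuous at regular beliefs only. -/
theorem IsRegularTest.tendsto_integral {v : ℕ → ProbabilityMeasure (BeliefAction P M)}
    {v' : ProbabilityMeasure (BeliefAction P M)} (hv : Tendsto v atTop (𝓝 v'))
    (h : Tendsto (fun n => (v n : Measure (BeliefAction P M)) (regularPairs P M C L)ᶜ) atTop
      (𝓝 0)) {F : BeliefAction P M → ℝ} (hF : IsRegularTest C L F) :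
    Tendsto (fun n => ∫ z, F z ∂(v n : Measure (BeliefAction P M))) atTop
      (𝓝 (∫ z, F z ∂(v' : Measure (BeliefAction P M)))) := by
  have h' := measure_compl_regularPairs_eq_zero hv h
  obtain ⟨K, hK⟩ := hF.bounded
  let f : regularPairs P M C L →ᵇ ℝ := BoundedContinuousFunction.ofNormedAddCommGroup
    ((regularPairs P M C L).domRestrict F) hF.continuousOn.domRestrict K (fun z => hK z)
  -- Tietze extension from the closed set of regular pairs gives a truly continuous function.
  -- Replacing `F` by it costs at most `K + ‖G‖` times the nonregular mass.
  obtain ⟨G, -, hG⟩ := f.exists_norm_eq_domRestrict_eq_of_closed isClosed_regularPairs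
  have hGF : ∀ z ∈ regularPairs P M C L, G z = F z := fun z hz => DFunLike.congr_fun hG ⟨z, hz⟩
  have hGint : ∀ w : ProbabilityMeasure (BeliefAction P M),
      Integrable G (w : Measure (BeliefAction P M)) := fun w => G.integrable _
  have hbound : ∀ w : ProbabilityMeasure (BeliefAction P M),
      |∫ z, F z ∂(w : Measure (BeliefAction P M)) - ∫ z, G z ∂(w : Measure (BeliefAction P M))| ≤
        (K + ‖G‖) * (w : Measure (BeliefAction P M)).real (regularPairs P M C L)ᶜ := by
    intro w
    have e : (K + ‖G‖) * (w : Measure (BeliefAction P M)).real (regularPairs P M C L)ᶜ =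
        ∫ z, (regularPairs P M C L)ᶜ.indicator (fun _ => K + ‖G‖) z
          ∂(w : Measure (BeliefAction P M)) := by
      rw [integral_indicator measurableSet_regularPairs.compl, setIntegral_const, smul_eq_mul,
        mul_comm]
    rw [← integral_sub (hF.integrable w) (hGint w), ← Real.norm_eq_abs, e]
    refine norm_integral_le_of_norm_le ((integrable_const _).indicator
      measurableSet_regularPairs.compl) (ae_of_all _ fun z => ?_)
    by_cases hz : z ∈ regularPairs P M C L
    · simp [hz, hGF z hz]
    · rw [indicator_of_mem hz]
      exact (norm_sub_le _ _).trans (add_le_add (hK z) (G.norm_coe_le_norm z))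
  have hlim := ProbabilityMeasure.tendsto_iff_forall_integral_tendsto.1 hv G
  have hFG : ∫ z, F z ∂(v' : Measure (BeliefAction P M)) =
      ∫ z, G z ∂(v' : Measure (BeliefAction P M)) := by
    have := hbound v'
    rw [measureReal_def, h', ENNReal.toReal_zero, mul_zero] at this
    exact sub_eq_zero.1 (abs_nonpos_iff.1 this)
  rw [hFG]
  have hsmall : Tendsto (fun n => ∫ z, F z ∂(v n : Measure (BeliefAction P M)) -
      ∫ z, G z ∂(v n : Measure (BeliefAction P M))) atTop (𝓝 0) := by
    refine squeeze_zero_norm (fun n => hbound (v n)) ?_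
    simpa [measureReal_def] using
      ((ENNReal.tendsto_toReal ENNReal.zero_ne_top).comp h).const_mul (K + ‖G‖)
  simpa using hsmall.add hlim

/-! ### Relative compactness -/

/-- Forgetting the quantizer but for its effect on the reference measure. -/
def encode (z : BeliefAction P M) : ProbabilityMeasure (E d) × ProbabilityMeasure (E d × Fin M) :=
  (z.1, z.2.joint P)

theorem measurable_encode : Measurable (encode : BeliefAction P M → _) :=
  measurable_belief.prodMk measurable_reference_joint

theorem isInducing_encode : IsInducing (encode : BeliefAction P M → _) :=
  IsInducing.prodMap (f := id) IsInducing.id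
    (g := fun Q : ConvexQuantizer P M => Q.joint P) ⟨rfl⟩

/-- The image of a compact space in a Hausdorff one. It guarantees that a limit of codes is again
the code of a quantizer with convex cells. -/
theorem isClosed_range_joint (hP : HasPositiveDensity P) :
    IsClosed (range fun Q : ConvexQuantizer P M => Q.joint P) :=
  have := ConvexQuantizer.compactSpace (M := M) hP
  (isCompact_range ConvexQuantizer.isInducing_joint.continuous).isClosed

theorem range_encode : range (encode : BeliefAction P M → _) =
    univ ×ˢ range fun Q : ConvexQuantizer P M => Q.joint P := by
  ext ⟨π, y⟩
  constructor
  · rintro ⟨z, hz⟩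
    simp only [encode, Prod.mk.injEq] at hz
    exact ⟨mem_univ _, ⟨z.2, hz.2⟩⟩
  · rintro ⟨-, Q, hQ⟩
    exact ⟨(π, Q), Prod.ext rfl hQ⟩

theorem encode_image_regularPairs : encode '' regularPairs P M C L =
    regularLaws d C L ×ˢ range fun Q : ConvexQuantizer P M => Q.joint P := by
  ext ⟨π, y⟩
  constructor
  · rintro ⟨z, hz, he⟩
    simp only [encode, Prod.mk.injEq] at he
    exact ⟨he.1 ▸ hz, ⟨z.2, he.2⟩⟩
  · rintro ⟨h, Q, hQ⟩
    exact ⟨(π, Q), h, Prod.ext rfl hQ⟩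

theorem isClosed_encode_image (hP : HasPositiveDensity P) :
    IsClosed (encode '' regularPairs P M C L) := by
  rw [encode_image_regularPairs]
  exact (isClosed_regularLaws d C L).prod (isClosed_range_joint hP)

/-- A bounded continuous function of a pair is a bounded continuous function of its code. -/
theorem exists_extension_encode (hP : HasPositiveDensity P) (f : BeliefAction P M →ᵇ ℝ) :
    ∃ G : ProbabilityMeasure (E d) × ProbabilityMeasure (E d × Fin M) →ᵇ ℝ,
      ∀ z, G (encode z) = f z := by
  have hcl : IsClosed (range (encode : BeliefAction P M → _)) := by
    rw [range_encode]; exact isClosed_univ.prod (isClosed_range_joint hP)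
  -- Any section of `encode` is continuous, whatever the choices, because the topology of the pairs
  -- is induced by `encode`.
  choose σ hσ using fun y : range (encode : BeliefAction P M → _) => y.2
  have hσc : Continuous σ := by
    rw [isInducing_encode.continuous_iff]
    exact continuous_subtype_val.congr fun y => (hσ y).symm
  obtain ⟨G, -, hG⟩ := (f.compContinuous ⟨σ, hσc⟩).exists_norm_eq_domRestrict_eq_of_closed hcl
  refine ⟨G, fun z => ?_⟩
  have h1 : G (encode z) = f (σ ⟨encode z, mem_range_self z⟩) :=
    DFunLike.congr_fun hG ⟨encode z, mem_range_self z⟩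
  -- The section may select another quantizer with the same PQ. The two pairs are topologically
  -- indistinguishable, so continuous functions do not separate them.
  have h2 : Inseparable (σ ⟨encode z, mem_range_self z⟩) z := by
    rw [← isInducing_encode.inseparable_iff, hσ]
  rw [h1]
  exact (h2.map f.continuous).eq

/-- There is a measurable way to choose a quantizer, as long as the belief is regular. -/
theorem exists_measurable_decode (hP : HasPositiveDensity P) [Nonempty (BeliefAction P M)]
    (C : ℝ) (L : ℝ≥0) :
    ∃ s : ProbabilityMeasure (E d) × ProbabilityMeasure (E d × Fin M) → BeliefAction P M,
      Measurable s ∧ ∀ y ∈ encode '' regularPairs P M C L, encode (s y) = y := by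
  classical
  let T : Set (ProbabilityMeasure (E d) × ProbabilityMeasure (E d × Fin M)) :=
    encode '' regularPairs P M C L
  have hT : MeasurableSet T := (isClosed_encode_image hP).measurableSet
  choose! σ hσ hσe using fun y (hy : y ∈ T) => hy
  let s : ProbabilityMeasure (E d) × ProbabilityMeasure (E d × Fin M) → BeliefAction P M :=
    fun y => if y ∈ T then σ y else Classical.arbitrary _
  have hs : ∀ y ∈ T, encode (s y) = y := fun y hy => by simp only [s, if_pos hy, hσe y hy]
  refine ⟨s, ?_, hs⟩
  refine measurable_of_restrict_of_restrict_compl hT ?_ ?_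
  · have hr : T.domRestrict s = fun y : T => σ y := by
      ext1 y; simp [s]
    rw [hr]
    -- The quantizer is picked by arbitrary choice, yet at regular beliefs πQ depends continuously
    -- on the code (π, PQ). All three generators of the σ-algebra are thus under control.
    have hc : Continuous fun y : T => (σ y).2.joint (σ y).1 := by
      refine continuous_iff_continuousAt.2 fun y => ?_
      refine tendsto_joint hP (C := C) (L := L) ?_ (fun w => hσ w w.2) (hσ y y.2)
      rw [isInducing_encode.tendsto_nhds_iff, hσe y y.2]
      exact (continuous_subtype_val.tendsto y).congr fun w => (hσe w w.2).symm
    refine measurable_comap_iff.2 ?_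
    have h1 : ∀ y : T, encode (σ y.1) = y.1 := fun y => hσe y.1 y.2
    have h2 : (fun y : T => (σ y.1).1) = fun y : T => y.1.1 :=
      funext fun y => congrArg Prod.fst (h1 y)
    have h3 : (fun y : T => (σ y.1).2.joint P) = fun y : T => y.1.2 :=
      funext fun y => congrArg Prod.snd (h1 y)
    refine Measurable.prodMk ?_ (Measurable.prodMk ?_ hc.measurable)
    · change Measurable fun y : T => (σ y).1
      rw [h2]; exact measurable_subtype_coe.fst
    · change Measurable fun y : T => (σ y).2.joint P
      rw [h3]; exact measurable_subtype_coe.snd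
  · have hr : Tᶜ.domRestrict s = fun _ => Classical.arbitrary _ := by
      ext1 y
      have hy : (y : _ × _) ∉ T := y.2
      simp [s, hy]
    rw [hr]; exact measurable_const

/-- Means of size 4⁻ᵏ tested at level 2⁻ᵏ leave exceptional sets of mass 2⁻ᵏ, which is summable. -/
theorem markov_measure_le {Z : Type*} [MeasurableSpace Z] {μ : Measure Z} {g : Z → ℝ≥0∞}
    (hg : Measurable g) (k : ℕ) (h : ∫⁻ z, g z ∂μ ≤ ((1 / 4 : ℝ≥0) ^ k : ℝ≥0)) :
    μ {z | ((1 / 2 : ℝ≥0) ^ k : ℝ≥0) < g z} ≤ ((1 / 2 : ℝ≥0) ^ k : ℝ≥0) := by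
  have hpos : (((1 / 2 : ℝ≥0) ^ k : ℝ≥0) : ℝ≥0∞) ≠ 0 := by
    rw [ENNReal.coe_ne_zero]; positivity
  calc μ {z | ((1 / 2 : ℝ≥0) ^ k : ℝ≥0) < g z}
    _ ≤ μ {z | ((1 / 2 : ℝ≥0) ^ k : ℝ≥0) ≤ g z} :=
        measure_mono fun z (hz : _ < g z) => hz.le
    _ ≤ (∫⁻ z, g z ∂μ) / ((1 / 2 : ℝ≥0) ^ k : ℝ≥0) :=
        meas_ge_le_lintegral_div hg.aemeasurable hpos ENNReal.coe_ne_top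
    _ ≤ ((1 / 4 : ℝ≥0) ^ k : ℝ≥0) / ((1 / 2 : ℝ≥0) ^ k : ℝ≥0) := by gcongr
    _ = ((1 / 2 : ℝ≥0) ^ k : ℝ≥0) := by
        rw [← ENNReal.coe_div (by positivity), ← div_pow]
        norm_num

/-- Laws of beliefs with uniformly tight barycentres are uniformly tight. -/
theorem exists_compact_beliefs {ι : Type*} {v : ι → ProbabilityMeasure (BeliefAction P M)}
    (ht : ∀ ε : ℝ≥0∞, 0 < ε → ∃ K : Set (E d), IsCompact K ∧
      ∀ i, ∫⁻ z, (z.1 : Measure (E d)) Kᶜ ∂(v i : Measure (BeliefAction P M)) ≤ ε) (k : ℕ) :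
    ∃ K : Set (ProbabilityMeasure (E d)), IsCompact K ∧
      ∀ i, (v i : Measure (BeliefAction P M)) {z | z.1 ∉ K} ≤ (2 * (1 / 2) ^ k : ℝ≥0) := by
  choose K hK hKv using fun j : ℕ => ht ((1 / 4 : ℝ≥0) ^ j : ℝ≥0)
    (ENNReal.coe_pos.2 (by positivity))
  -- These simultaneous tail bounds define a compact set of laws. Bound number k + j fails with mass
  -- at most 2⁻⁽ᵏ⁺ʲ⁾, and the sum over j is 2 · 2⁻ᵏ.
  refine ⟨{π | ∀ j, π (K (k + j))ᶜ ≤ (1 / 2) ^ (k + j)}, ?_, fun i => ?_⟩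
  · refine isCompact_setOfPred_probabilityMeasure_mass_eq_compl_isCompact_le
      (u := fun j => (1 / 2) ^ (k + j)) ?_ (fun j => hK _) (Or.inl inferInstance)
    have := tendsto_pow_atTop_nhds_zero_of_lt_one (r := (1 / 2 : ℝ≥0)) (zero_le) (by norm_num)
    simpa [add_comm] using (tendsto_add_atTop_iff_nat k).2 this
  · have hsub : {z : BeliefAction P M | z.1 ∉ {π : ProbabilityMeasure (E d) |
        ∀ j, π (K (k + j))ᶜ ≤ (1 / 2) ^ (k + j)}} ⊆
        ⋃ j, {z | ((1 / 2 : ℝ≥0) ^ (k + j) : ℝ≥0) < (z.1 : Measure (E d)) (K (k + j))ᶜ} := by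
      intro z hz
      simp only [mem_ofPred_eq, not_forall, not_le] at hz
      obtain ⟨j, hj⟩ := hz
      refine mem_iUnion.2 ⟨j, ?_⟩
      rw [mem_ofPred_eq, ← ProbabilityMeasure.ennreal_coeFn_eq_coeFn_toMeasure]
      exact ENNReal.coe_lt_coe.2 hj
    refine (measure_mono hsub).trans ((measure_iUnion_le _).trans ?_)
    have hm : ∀ j, Measurable fun z : BeliefAction P M => (z.1 : Measure (E d)) (K j)ᶜ := fun j =>
      (Measure.measurable_coe (hK j).measurableSet.compl).comp
        (measurable_subtype_coe.comp measurable_belief)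
    refine (ENNReal.tsum_le_tsum fun j => markov_measure_le (hm _) (k + j) (hKv _ i)).trans ?_
    have hs : HasSum (fun j => (1 / 2 : ℝ≥0) ^ (k + j)) (2 * (1 / 2) ^ k) := by
      have := (NNReal.hasSum_coe.1 (by
        simpa using hasSum_geometric_two : HasSum (fun j : ℕ => (((1 / 2 : ℝ≥0) ^ j : ℝ≥0) : ℝ))
          ((2 : ℝ≥0) : ℝ))).mul_left ((1 / 2 : ℝ≥0) ^ k)
      simpa [pow_add, mul_comm] using this
    rw [(ENNReal.hasSum_coe.2 hs).tsum_eq]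

/-- **Extraction of weakly convergent subsequences.** -/
theorem exists_subseq_tendsto (hP : HasPositiveDensity P)
    {v : ℕ → ProbabilityMeasure (BeliefAction P M)}
    (hreg : Tendsto (fun n => (v n : Measure (BeliefAction P M)) (regularPairs P M C L)ᶜ) atTop
      (𝓝 0))
    (ht : ∀ ε : ℝ≥0∞, 0 < ε → ∃ K : Set (E d), IsCompact K ∧
      ∀ n, ∫⁻ z, (z.1 : Measure (E d)) Kᶜ ∂(v n : Measure (BeliefAction P M)) ≤ ε) :
    ∃ (v' : ProbabilityMeasure (BeliefAction P M)) (φ : ℕ → ℕ), StrictMono φ ∧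
      Tendsto (v ∘ φ) atTop (𝓝 v') := by
  have hne : Nonempty (BeliefAction P M) :=
    nonempty_of_isProbabilityMeasure (v 0 : Measure (BeliefAction P M))
  choose K hK hKv using exists_compact_beliefs ht
  let J := range fun Q : ConvexQuantizer P M => Q.joint P
  have hJ : IsCompact J :=
    have := ConvexQuantizer.compactSpace (M := M) hP
    isCompact_range ConvexQuantizer.isInducing_joint.continuous
  -- Prokhorov's theorem is applied to the laws of the codes. The quantizer coordinate stays in the
  -- compact set `J`, so only the beliefs have to be confined.
  let u : ℕ → ProbabilityMeasure (ProbabilityMeasure (E d) × ProbabilityMeasure (E d × Fin M)) :=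
    fun n => (v n).map measurable_encode.aemeasurable
  have hu : ∀ n A, MeasurableSet A → (u n : Measure _) A =
      (v n : Measure (BeliefAction P M)) (encode ⁻¹' A) := fun n A hA =>
    Measure.map_apply measurable_encode hA
  have hcomp : IsCompact {w : ProbabilityMeasure
      (ProbabilityMeasure (E d) × ProbabilityMeasure (E d × Fin M)) |
        ∀ k, w (K k ×ˢ J)ᶜ ≤ 2 * (1 / 2) ^ k} := by
    refine isCompact_setOfPred_probabilityMeasure_mass_eq_compl_isCompact_le
      (u := fun k => 2 * (1 / 2) ^ k) ?_ (fun k => (hK k).prod hJ) (Or.inl inferInstance)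
    have := (tendsto_pow_atTop_nhds_zero_of_lt_one (r := (1 / 2 : ℝ≥0)) (zero_le)
      (by norm_num)).const_mul 2
    simpa using this
  have hmem : ∀ n, u n ∈ {w : ProbabilityMeasure
      (ProbabilityMeasure (E d) × ProbabilityMeasure (E d × Fin M)) |
        ∀ k, w (K k ×ˢ J)ᶜ ≤ 2 * (1 / 2) ^ k} := by
    intro n k
    rw [← ENNReal.coe_le_coe, ProbabilityMeasure.ennreal_coeFn_eq_coeFn_toMeasure,
      hu n _ ((hK k).prod hJ).measurableSet.compl]
    refine (measure_mono fun z hz => ?_).trans (hKv k n)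
    intro hzK
    exact hz ⟨hzK, ⟨z.2, rfl⟩⟩
  obtain ⟨u', -, φ, hφ, hlim⟩ := hcomp.tendsto_subseq hmem
  obtain ⟨s, hs, hse⟩ := exists_measurable_decode (M := M) hP C L
  have hT := isClosed_encode_image (M := M) (C := C) (L := L) hP
  -- The limit charges only codes of regular pairs, where decoding followed by encoding is the
  -- identity. This allows it to be lifted to a law on pairs.
  have hu' : (u' : Measure _) (encode '' regularPairs P M C L)ᶜ = 0 := by
    have h1 := ProbabilityMeasure.le_liminf_measure_open_of_tendsto hlim hT.isOpen_compl
    have h2 : ∀ n, (u n : Measure _) (encode '' regularPairs P M C L)ᶜ =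
        (v n : Measure (BeliefAction P M)) (regularPairs P M C L)ᶜ := by
      intro n
      rw [hu n _ hT.measurableSet.compl, encode_image_regularPairs]
      congr 1
      ext z
      simp [encode, regularPairs]
    have h3 : Tendsto (fun n => ((u ∘ φ) n : Measure _) (encode '' regularPairs P M C L)ᶜ) atTop
        (𝓝 0) := by
      simp only [Function.comp_apply, h2]
      exact hreg.comp hφ.tendsto_atTop
    rw [h3.liminf_eq] at h1
    exact le_antisymm h1 zero_le
  refine ⟨u'.map hs.aemeasurable, φ, hφ, ?_⟩
  rw [ProbabilityMeasure.tendsto_iff_forall_integral_tendsto]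
  intro f
  obtain ⟨G, hG⟩ := exists_extension_encode hP f
  have h1 := ProbabilityMeasure.tendsto_iff_forall_integral_tendsto.1 hlim G
  have h2 : ∀ n, ∫ y, G y ∂(u n : Measure _) = ∫ z, f z ∂(v n : Measure (BeliefAction P M)) := by
    intro n
    have : (u n : Measure _) = (v n : Measure (BeliefAction P M)).map encode := rfl
    rw [this, integral_map measurable_encode.aemeasurable
      G.continuous.measurable.aestronglyMeasurable]
    simp only [hG]
  have h3 : ∫ y, G y ∂(u' : Measure _) =
      ∫ z, f z ∂(u'.map hs.aemeasurable : Measure (BeliefAction P M)) := by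
    rw [ProbabilityMeasure.toMeasure_map, integral_map hs.aemeasurable
      f.continuous.measurable.aestronglyMeasurable]
    refine integral_congr_ae ?_
    filter_upwards [measure_eq_zero_iff_ae_notMem.1 hu'] with y hy
    rw [← hG, hse y (not_not.1 hy)]
  rw [← h3]
  simpa only [Function.comp_apply, h2] using h1

/-- Points of the closure are replaced by points of `A` at distance less than 1/(n+1), which does
not affect limits. A pseudometric suffices, as indistinguishable quantizers require. -/
theorem isCompact_closure_of_forall_exists_subseq {Z : Type*} [TopologicalSpace Z]
    [PseudoMetrizableSpace Z] {A : Set Z} (h : ∀ u : ℕ → Z, (∀ n, u n ∈ A) →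
      ∃ (z : Z) (φ : ℕ → ℕ), StrictMono φ ∧ Tendsto (u ∘ φ) atTop (𝓝 z)) :
    IsCompact (closure A) := by
  let := pseudoMetrizableSpacePseudoMetric Z
  refine IsSeqCompact.isCompact fun x hx => ?_
  choose a ha hxa using fun n : ℕ => Metric.mem_closure_iff.1 (hx n) (1 / (n + 1)) (by positivity)
  obtain ⟨z, φ, hφ, hlim⟩ := h a ha
  refine ⟨z, mem_closure_of_tendsto hlim (Eventually.of_forall fun n => ha _), φ, hφ, ?_⟩
  refine (tendsto_iff_of_dist ?_).2 hlim
  refine squeeze_zero (fun _ => dist_nonneg) (fun n => (hxa (φ n)).le) ?_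
  exact tendsto_one_div_add_atTop_nhds_zero_nat.comp hφ.tendsto_atTop

end Occupation

/-! ### Ergodic occupation measures -/

section Ergodic

variable {d : ℕ} {P : ProbabilityMeasure (E d)} {M : ℕ} {C : ℝ} {L : ℝ≥0}

variable (P M) in
/-- The belief component of a pair, as a kernel. -/
def beliefKernel : Kernel (BeliefAction P M) (E d) where
  toFun z := z.1
  measurable' := measurable_subtype_coe.comp measurable_belief

instance : IsMarkovKernel (beliefKernel P M) := ⟨fun z => z.1.2⟩

theorem measurable_belief_apply {A : Set (E d)} (hA : MeasurableSet A) :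
    Measurable fun z : BeliefAction P M => (z.1 : Measure (E d)) A :=
  (beliefKernel P M).measurable_coe hA

/-- The barycentre of a law of pairs: the average of the beliefs. -/
def barycentre (v : ProbabilityMeasure (BeliefAction P M)) : ProbabilityMeasure (E d) :=
  ⟨(v : Measure (BeliefAction P M)).bind (beliefKernel P M), inferInstance⟩

theorem barycentre_apply (v : ProbabilityMeasure (BeliefAction P M)) {A : Set (E d)}
    (hA : MeasurableSet A) : (barycentre v : Measure (E d)) A =
      ∫⁻ z, (z.1 : Measure (E d)) A ∂(v : Measure (BeliefAction P M)) :=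
  Measure.bind_apply hA (beliefKernel P M).aemeasurable

theorem integral_barycentre (v : ProbabilityMeasure (BeliefAction P M)) {f : E d → ℝ} {K : ℝ}
    (hf : Measurable f) (hK : ∀ x, |f x| ≤ K) : ∫ x, f x ∂(barycentre v : Measure (E d)) =
      ∫ z, ∫ x, f x ∂(z.1 : Measure (E d)) ∂(v : Measure (BeliefAction P M)) :=
  integral_bind (κ := beliefKernel P M)
    (Integrable.of_bound hf.aestronglyMeasurable K (ae_of_all _ hK))

/-- Integration of a bounded continuous function, as a bounded continuous function of the law. -/
def integralBCF (f : E d →ᵇ ℝ) : ProbabilityMeasure (E d) →ᵇ ℝ :=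
  BoundedContinuousFunction.ofNormedAddCommGroup
    (fun π : ProbabilityMeasure (E d) => ∫ x, f x ∂(π : Measure (E d)))
    (ProbabilityMeasure.continuous_integral_boundedContinuousFunction f) ‖f‖
    fun π => f.norm_integral_le_norm (π : Measure (E d))

theorem integralBCF_apply (f : E d →ᵇ ℝ) (π : ProbabilityMeasure (E d)) :
    integralBCF f π = ∫ x, f x ∂(π : Measure (E d)) := rfl

namespace MarkovSource

variable (S : MarkovSource d)

theorem posterior_mem (hS : ∀ ρ, S.nextLaw ρ ∈ regularLaws d C L) (z : BeliefAction P M)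
    (m : Fin M) : S.posterior z m ∈ regularLaws d C L := by
  rw [posterior]
  split_ifs
  · exact hS _
  · exact hS _

/-- Averaging the posteriors over the symbols forgets the observation. For functions linear in the
belief, the controlled chain therefore moves like the source itself, whatever the quantizer. -/
theorem integral_transition_integralBCF (z : BeliefAction P M) (f : E d →ᵇ ℝ) :
    ∫ ρ, integralBCF f ρ ∂(S.transition z) =
      ∫ x, ∫ y, f y ∂(S.kernel x) ∂(z.1 : Measure (E d)) := by
  rw [integral_transition, integral_eq_sum_cell z.2]
  · exact Finset.sum_congr rfl fun m _ => S.measure_cell_mul_integral_posterior z m f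
  · exact Integrable.of_bound (S.measurable_integral_kernel f).aestronglyMeasurable ‖f‖
      (ae_of_all _ (S.abs_integral_kernel_le f))

variable {S} {v : ProbabilityMeasure (BeliefAction P M)}

/-- Ergodic occupation measures are concentrated on regular beliefs. -/
theorem measure_compl_regularPairs_of_mem (hS : ∀ ρ, S.nextLaw ρ ∈ regularLaws d C L)
    (hv : v ∈ S.ergodicOccupationMeasures P M) :
    (v : Measure (BeliefAction P M)) (regularPairs P M C L)ᶜ = 0 := by
  let := pseudoMetrizableSpacePseudoMetric (ProbabilityMeasure (E d))
  -- The truncated distance to the regular laws vanishes at every posterior. Invariance forces it to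
  -- vanish v-almost everywhere, and the class is closed.
  let f : ProbabilityMeasure (E d) →ᵇ ℝ := BoundedContinuousFunction.ofNormedAddCommGroup
    (fun π => min 1 (Metric.infDist π (regularLaws d C L)))
    (continuous_const.min (Metric.continuous_infDist_pt _)) 1 fun π => by
      rw [Real.norm_of_nonneg (le_min zero_le_one Metric.infDist_nonneg)]
      exact min_le_left _ _
  have hf : ∀ π, f π = min 1 (Metric.infDist π (regularLaws d C L)) := fun _ => rfl
  have hf0 : ∀ π ∈ regularLaws d C L, f π = 0 := fun π hπ => by
    rw [hf, Metric.infDist_zero_of_mem hπ, min_eq_right zero_le_one]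
  have h1 := hv f
  have h2 : ∀ z : BeliefAction P M, ∫ ρ, f ρ ∂(S.transition z) = 0 := fun z => by
    rw [integral_transition]
    exact Finset.sum_eq_zero fun m _ => by rw [hf0 _ (S.posterior_mem hS z m), mul_zero]
  simp only [h2, integral_zero] at h1
  rw [integral_eq_zero_iff_of_nonneg (f := fun z : BeliefAction P M => f z.1)
    (fun z => le_min zero_le_one Metric.infDist_nonneg)
    ((isRegularTest_belief (C := C) (L := L) f).integrable v)] at h1
  rw [measure_eq_zero_iff_ae_notMem]
  filter_upwards [h1] with z hz
  rw [notMem_compl_iff]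
  have hz0 : min 1 (Metric.infDist z.1 (regularLaws d C L)) = 0 := hz
  have hz1 : Metric.infDist z.1 (regularLaws d C L) = 0 := by
    rcases min_choice 1 (Metric.infDist z.1 (regularLaws d C L)) with h | h
    · rw [h] at hz0; exact absurd hz0 one_ne_zero
    · rwa [h] at hz0
  exact ((isClosed_regularLaws d C L).mem_iff_infDist_zero ⟨_, hS z.1⟩).2 hz1

/-- The barycentre of an ergodic occupation measure is invariant. -/
theorem nextLaw_barycentre (hv : v ∈ S.ergodicOccupationMeasures P M) :
    S.nextLaw (barycentre v) = barycentre v := by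
  suffices h : (S.nextLaw (barycentre v) : Measure (E d)) = (barycentre v : Measure (E d)) from
    Subtype.ext h
  refine ext_of_forall_integral_eq_of_IsFiniteMeasure fun f => ?_
  have h1 := hv (integralBCF f)
  simp only [integral_transition_integralBCF] at h1
  simp only [integralBCF_apply] at h1
  have h2 : ∫ x, f x ∂(S.nextLaw (barycentre v) : Measure (E d)) =
      ∫ x, ∫ y, f y ∂(S.kernel x) ∂(barycentre v : Measure (E d)) := by
    rw [nextLaw_toMeasure]
    exact integral_bind (f.integrable _)
  refine h2.trans ?_
  rw [integral_barycentre v (S.measurable_integral_kernel f) (S.abs_integral_kernel_le f), ← h1]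
  exact (integral_barycentre v f.continuous.measurable f.norm_coe_le_norm).symm

/-- The barycentre is an invariant law of the source, and there is only one. -/
theorem lintegral_belief_of_mem {πs : ProbabilityMeasure (E d)}
    (huniq : ∀ ρ, S.nextLaw ρ = ρ → ρ = πs) (hv : v ∈ S.ergodicOccupationMeasures P M)
    {A : Set (E d)} (hA : MeasurableSet A) :
    ∫⁻ z, (z.1 : Measure (E d)) A ∂(v : Measure (BeliefAction P M)) =
      (πs : Measure (E d)) A := by
  rw [← barycentre_apply v hA, huniq _ (nextLaw_barycentre hv)]

/-- Limits of asymptotically invariant laws are ergodic occupation measures. -/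
theorem mem_ergodicOccupationMeasures_of_tendsto (hP : HasPositiveDensity P)
    {v : ℕ → ProbabilityMeasure (BeliefAction P M)}
    {v' : ProbabilityMeasure (BeliefAction P M)} (hv : Tendsto v atTop (𝓝 v'))
    (hreg : Tendsto (fun n => (v n : Measure (BeliefAction P M)) (regularPairs P M C L)ᶜ) atTop
      (𝓝 0))
    (hinv : ∀ f : ProbabilityMeasure (E d) →ᵇ ℝ,
      Tendsto (fun n => ∫ z, f z.1 ∂(v n : Measure (BeliefAction P M)) -
        ∫ z, ∫ ρ, f ρ ∂(S.transition z) ∂(v n : Measure (BeliefAction P M))) atTop (𝓝 0)) :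
    v' ∈ S.ergodicOccupationMeasures P M := by
  intro f
  have h1 := (isRegularTest_belief (C := C) (L := L) f).tendsto_integral hv hreg
  have h2 := (isRegularTest_transition (C := C) (L := L) hP S f).tendsto_integral hv hreg
  exact sub_eq_zero.1 (tendsto_nhds_unique (h1.sub h2) (hinv f))

/-- All the barycentres equal π*, so one compact set controls the beliefs of all the elements at
once. Nonregular mass is zero throughout, and limits of invariant laws are invariant. -/
theorem isCompact_ergodicOccupationMeasures (hP : HasPositiveDensity P)
    (hS : S.HasRegularDensity) {πs : ProbabilityMeasure (E d)}
    (huniq : ∀ ρ, S.nextLaw ρ = ρ → ρ = πs) :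
    IsCompact (S.ergodicOccupationMeasures P M) := by
  obtain ⟨C, L, hCL⟩ := S.exists_nextLaw_mem_regularLaws hS
  refine IsSeqCompact.isCompact fun v hv => ?_
  have hreg : ∀ φ : ℕ → ℕ, Tendsto (fun n => ((v ∘ φ) n : Measure (BeliefAction P M))
      (regularPairs P M C L)ᶜ) atTop (𝓝 0) := fun φ => by
    simp only [Function.comp_apply, measure_compl_regularPairs_of_mem hCL (hv _)]
    exact tendsto_const_nhds
  obtain ⟨v', φ, hφ, hlim⟩ := exists_subseq_tendsto hP (hreg id) (fun ε hε => by
    obtain ⟨K, hK, hKε⟩ := isTightMeasureSet_iff_exists_isCompact_measure_compl_le.1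
      (isTightMeasureSet_singleton (μ := (πs : Measure (E d)))) ε hε
    refine ⟨K, hK, fun n => ?_⟩
    rw [Function.comp_apply, lintegral_belief_of_mem huniq (hv _) hK.measurableSet.compl]
    exact hKε _ rfl)
  refine ⟨v', ?_, φ, hφ, hlim⟩
  refine mem_ergodicOccupationMeasures_of_tendsto hP hlim (hreg φ) fun f => ?_
  have : ∀ n, ∫ z, f z.1 ∂((v (φ n)) : Measure (BeliefAction P M)) -
      ∫ z, ∫ ρ, f ρ ∂(S.transition z) ∂((v (φ n)) : Measure (BeliefAction P M)) = 0 := fun n =>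
    sub_eq_zero.2 (hv (φ n) f)
  exact tendsto_const_nhds.congr fun n => (this n).symm

end MarkovSource

end Ergodic

/-! ### The belief process is a controlled Markov chain -/

/-- Probabilities of rectangles factor by splitting off `f`, then separating `g` from `h`. This
regroups independent blocks of variables. -/
theorem indepFun_prodMk_of_indepFun {Ω α β γ : Type*} [MeasurableSpace Ω] [MeasurableSpace α]
    [MeasurableSpace β] [MeasurableSpace γ] {μ : Measure Ω} [IsFiniteMeasure μ] {f : Ω → α}
    {g : Ω → β} {h : Ω → γ} (hf : Measurable f) (hg : Measurable g) (hh : Measurable h)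
    (h1 : IndepFun f (fun ω => (g ω, h ω)) μ) (h2 : IndepFun g h μ) :
    IndepFun (fun ω => (f ω, g ω)) h μ := by
  rw [indepFun_iff_map_prod_eq_prod_map_map (hf.prodMk hg).aemeasurable hh.aemeasurable,
    Measure.ext_prod₃_iff']
  intro s t u hs ht hu
  have h3 : IndepFun f g μ := h1.comp (φ := id) (ψ := Prod.fst) measurable_id measurable_fst
  rw [Measure.map_apply ((hf.prodMk hg).prodMk hh) ((hs.prod ht).prod hu), Measure.prod_prod,
    Measure.map_apply (hf.prodMk hg) (hs.prod ht), Measure.map_apply hh hu]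
  have e1 : (fun ω => ((f ω, g ω), h ω)) ⁻¹' ((s ×ˢ t) ×ˢ u) =
      f ⁻¹' s ∩ (fun ω => (g ω, h ω)) ⁻¹' (t ×ˢ u) := by
    ext ω; simp [and_assoc]
  have e2 : (fun ω => (g ω, h ω)) ⁻¹' (t ×ˢ u) = g ⁻¹' t ∩ h ⁻¹' u := rfl
  have e3 : (fun ω => (f ω, g ω)) ⁻¹' (s ×ˢ t) = f ⁻¹' s ∩ g ⁻¹' t := rfl
  rw [e1, h1.measure_inter_preimage_eq_mul s _ hs (ht.prod hu), e2,
    h2.measure_inter_preimage_eq_mul t u ht hu, e3, h3.measure_inter_preimage_eq_mul s t hs ht,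
    mul_assoc]

theorem iIndepFun.indepFun_range_self {Ω β : Type*} [MeasurableSpace Ω] [MeasurableSpace β]
    {μ : Measure Ω} {f : ℕ → Ω → β} (h : iIndepFun f μ) (hf : ∀ i, Measurable (f i)) (t : ℕ) :
    IndepFun (fun ω (i : Finset.range t) => f i ω) (f t) μ := by
  have := h.indepFun_finset (Finset.range t) {t} (by simp) hf
  exact this.comp (φ := id)
    (ψ := fun v : ({t} : Finset ℕ) → β => v ⟨t, Finset.mem_singleton_self t⟩) measurable_id
    (by fun_prop)

namespace CodingProcess

variable {d : ℕ} {P : ProbabilityMeasure (E d)} {M : ℕ} {S : MarkovSource d}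
  {pol : RandomizedPolicy P M} {π₀ : ProbabilityMeasure (E d)} {Ω : Type*}
  {m : MeasurableSpace Ω} [MeasurableSpace Ω] {μ : Measure Ω} (X : CodingProcess S pol π₀ μ)

theorem measurable_symbol (t : ℕ) : Measurable (pol.symbol X.x X.r X.b t) :=
  X.measurable_symbol_of_b (X.measurable_b t)

/-- The randomness used before time `t`. -/
def past (t : ℕ) (ω : Ω) : E d × (Finset.range t → E d) × (Finset.range t → unitInterval) :=
  (X.x 0 ω, fun i => X.w i ω, fun i => X.r i ω)

/-- The σ-algebra `m` is left free so that the measurability arguments can be run inside the one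
generated by a chosen block of independent variables. -/
theorem measurable_past_of {t : ℕ} (hx : Measurable[m] (X.x 0))
    (hw : ∀ i < t, Measurable[m] (X.w i)) (hr : ∀ i < t, Measurable[m] (X.r i)) :
    Measurable[m] (X.past t) :=
  hx.prodMk
    ((@measurable_pi_lambda Ω _ _ m _ _ fun i : Finset.range t =>
      hw i (Finset.mem_range.1 i.2)).prodMk
      (@measurable_pi_lambda Ω _ _ m _ _ fun i : Finset.range t =>
        hr i (Finset.mem_range.1 i.2)))

theorem measurable_of_past {t : ℕ} (h : Measurable[m] (X.past t)) :
    Measurable[m] (X.x 0) ∧ (∀ i < t, Measurable[m] (X.w i)) ∧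
      ∀ i < t, Measurable[m] (X.r i) :=
  ⟨h.fst, fun i hi => (measurable_pi_apply (⟨i, Finset.mem_range.2 hi⟩ : Finset.range t)).comp
      h.snd.fst,
    fun i hi => (measurable_pi_apply (⟨i, Finset.mem_range.2 hi⟩ : Finset.range t)).comp
      h.snd.snd⟩

theorem measurable_x_of_past {t : ℕ} (h : Measurable[m] (X.past t)) :
    Measurable[m] (X.x t) := by
  obtain ⟨h0, hw, -⟩ := X.measurable_of_past h
  have : ∀ s ≤ t, Measurable[m] (X.x s) := by
    intro s
    induction s with
    | zero => exact fun _ => h0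
    | succ s ih =>
      intro hs
      have e : X.x (s + 1) = fun ω => Function.uncurry S.f (X.x s ω, X.w s ω) :=
        funext fun ω => X.dynamics s ω
      rw [e]
      exact S.measurable_f.comp ((ih (by omega)).prodMk (hw s (by omega)))
  exact this t le_rfl

/-- Everything that is known at time `t` is a function of the randomness used before. -/
theorem measurable_b_of_past {t : ℕ} (h : Measurable[m] (X.past t)) :
    pol.info X.x X.r X.b t ≤ m ∧ Measurable[m] (X.b t) := by
  induction t using Nat.strong_induction_on with
  | _ t ih =>
    obtain ⟨h0, hw, hr⟩ := X.measurable_of_past h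
    -- Earlier symbols involve only earlier beliefs, which the induction covers. The belief at time
    -- `t` then follows because it is measurable for the information.
    have hle : pol.info X.x X.r X.b t ≤ m := by
      refine @Measurable.comap_le _ _ m _ _ (@measurable_pi_lambda Ω _ _ m _ _ fun s => ?_)
      have hs : Measurable[m] (X.past s) := X.measurable_past_of h0
        (fun i hi => hw i (hi.trans s.2)) fun i hi => hr i (hi.trans s.2)
      exact ((pol.measurable_enc s).comp (((ih s s.2 hs).2.prodMk (hr s s.2)).prodMk
        (X.measurable_x_of_past hs))).prodMk (hr s s.2)
    exact ⟨hle, (X.measurable_b_info t).mono hle le_rfl⟩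

/-- The state space of the histories. -/
abbrev History (d M t : ℕ) : Type :=
  ((Fin t → Fin M × unitInterval) × ProbabilityMeasure (E d)) × unitInterval

/-- The information available to the encoder at time `t`. -/
def history (t : ℕ) (ω : Ω) : History d M t :=
  ((fun s => (pol.symbol X.x X.r X.b s ω, X.r s ω), X.b t ω), X.r t ω)

theorem measurable_history_of {t : ℕ} (hi : pol.info X.x X.r X.b t ≤ m)
    (hr : Measurable[m] (X.r t)) : Measurable[m] (X.history t) :=
  (((comap_measurable _).mono hi le_rfl).prodMk ((X.measurable_b_info t).mono hi le_rfl)).prodMk hr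

theorem info_le (t : ℕ) : pol.info X.x X.r X.b t ≤ ‹MeasurableSpace Ω› :=
  Measurable.comap_le (measurable_pi_lambda _ fun s =>
    (X.measurable_symbol s).prodMk (X.measurable_r s))

theorem measurable_history (t : ℕ) : Measurable (X.history t) :=
  X.measurable_history_of (X.info_le t) (X.measurable_r t)

variable [IsProbabilityMeasure μ]

/-- The block contains the whole randomization sequence, because the quantizer at time `t` already
uses `r t`. -/
theorem indepFun_w (t : ℕ) :
    IndepFun (fun ω => ((fun s => X.r s ω), (X.x 0 ω, fun i : Finset.range t => X.w i ω)))
      (X.w t) μ := by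
  have hwt : Measurable fun ω (i : Finset.range t) => X.w i ω :=
    measurable_pi_lambda _ fun i => X.measurable_w i
  have h1 : IndepFun (fun ω => (X.x 0 ω, fun i : Finset.range t => X.w i ω)) (X.w t) μ := by
    refine indepFun_prodMk_of_indepFun X.measurable_x_zero hwt (X.measurable_w t) ?_
      (iIndepFun.indepFun_range_self X.iIndepFun_w X.measurable_w t)
    exact X.indepFun_x_zero_w.comp (φ := id)
      (ψ := fun v => ((fun i : Finset.range t => v i), v t)) measurable_id (by fun_prop)
  refine indepFun_prodMk_of_indepFun (measurable_pi_lambda _ X.measurable_r)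
    (X.measurable_x_zero.prodMk hwt) (X.measurable_w t) ?_ h1
  exact X.indepFun_source_r.symm.comp (φ := id)
    (ψ := fun v : E d × (ℕ → E d) => ((v.1, fun i : Finset.range t => v.2 i), v.2 t))
    measurable_id (by fun_prop)

/-- The block contains the whole source and the earlier randomization, so it determines both the
current state and the past information. -/
theorem indepFun_r (t : ℕ) :
    IndepFun (fun ω => ((X.x 0 ω, fun s => X.w s ω), fun i : Finset.range t => X.r i ω))
      (X.r t) μ := by
  refine indepFun_prodMk_of_indepFun
    (X.measurable_x_zero.prodMk (measurable_pi_lambda _ X.measurable_w))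
    (measurable_pi_lambda _ fun i => X.measurable_r i) (X.measurable_r t) ?_
    (iIndepFun.indepFun_range_self X.iIndepFun_r X.measurable_r t)
  exact X.indepFun_source_r.comp (φ := id)
    (ψ := fun v => ((fun i : Finset.range t => v i), v t)) measurable_id (by fun_prop)

theorem indepFun_history_r (t : ℕ) :
    IndepFun (fun ω => ((X.history t ω).1, X.x t ω)) (X.r t) μ := by
  refine indep_of_indep_of_le_left (X.indepFun_r t) (measurable_iff_comap_le.1 ?_)
  let F : Ω → (E d × (ℕ → E d)) × (Finset.range t → unitInterval) :=
    fun ω => ((X.x 0 ω, fun s => X.w s ω), fun i : Finset.range t => X.r i ω)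
  have hF : Measurable[MeasurableSpace.comap F inferInstance] F := comap_measurable F
  have hp : Measurable[MeasurableSpace.comap F inferInstance] (X.past t) :=
    (by fun_prop : Measurable fun v : (E d × (ℕ → E d)) × (Finset.range t → unitInterval) =>
      (v.1.1, (fun i : Finset.range t => v.1.2 i), v.2)).comp hF
  obtain ⟨hi, hb⟩ := X.measurable_b_of_past hp
  exact (((comap_measurable _).mono hi le_rfl).prodMk hb).prodMk (X.measurable_x_of_past hp)

theorem indepFun_history_w {t : ℕ} {β : Type*} [MeasurableSpace β]
    {g : History d M t × E d → β} (hg : Measurable g) :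
    IndepFun (fun ω => g (X.history t ω, X.x t ω)) (X.w t) μ := by
  refine indep_of_indep_of_le_left (X.indepFun_w t) (measurable_iff_comap_le.1 ?_)
  let F : Ω → (ℕ → unitInterval) × (E d × (Finset.range t → E d)) :=
    fun ω => ((fun s => X.r s ω), (X.x 0 ω, fun i : Finset.range t => X.w i ω))
  have hF : Measurable[MeasurableSpace.comap F inferInstance] F := comap_measurable F
  have hp : Measurable[MeasurableSpace.comap F inferInstance] (X.past t) :=
    (by fun_prop : Measurable fun v : (ℕ → unitInterval) × (E d × (Finset.range t → E d)) =>
      (v.2.1, v.2.2, fun i : Finset.range t => v.1 i)).comp hF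
  have hr : Measurable[MeasurableSpace.comap F inferInstance] (X.r t) :=
    (measurable_pi_apply t).comp hF.fst
  exact hg.comp ((X.measurable_history_of (X.measurable_b_of_past hp).1 hr).prodMk
    (X.measurable_x_of_past hp))

/-- The belief integrates to the law of the state over the events of the available information. -/
theorem setLIntegral_b (t : ℕ) {A : Set (E d)} (hA : MeasurableSet A) {B : Set Ω}
    (hB : MeasurableSet[pol.info X.x X.r X.b t] B) :
    ∫⁻ ω in B, (X.b t ω : Measure (E d)) A ∂μ = μ (B ∩ X.x t ⁻¹' A) := by
  have hxA : MeasurableSet (X.x t ⁻¹' A) := X.measurable_x t hA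
  have hint : Integrable ((X.x t ⁻¹' A).indicator fun _ => (1 : ℝ)) μ :=
    (integrable_const _).indicator hxA
  have hbm : Measurable fun ω => (X.b t ω : Measure (E d)) A :=
    (Measure.measurable_coe hA).comp (measurable_subtype_coe.comp (X.measurable_b t))
  have h1 : ∫ ω in B, (X.b t ω : Measure (E d)).real A ∂μ = μ.real (B ∩ X.x t ⁻¹' A) := by
    rw [setIntegral_congr_ae (X.info_le t _ hB)
      ((X.b_eq_condExp t A hA).mono fun ω h _ => h), setIntegral_condExp (X.info_le t) hint hB,
      integral_indicator hxA, setIntegral_const, measureReal_restrict_apply hxA, inter_comm]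
    simp
  have h2 : ∫ ω in B, (X.b t ω : Measure (E d)).real A ∂μ =
      (∫⁻ ω in B, (X.b t ω : Measure (E d)) A ∂μ).toReal :=
    integral_toReal hbm.aemeasurable (ae_of_all _ fun ω => measure_lt_top _ _)
  rw [h2, measureReal_def] at h1
  refine (ENNReal.toReal_eq_toReal_iff' ?_ (measure_ne_top _ _)).1 h1
  refine ((lintegral_mono fun ω => prob_le_one (μ := (X.b t ω : Measure (E d)))).trans_lt ?_).ne
  simp

/-- The belief as a kernel on the histories. -/
def historyKernel (d M t : ℕ) : Kernel (History d M t) (E d) where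
  toFun v := v.1.2
  measurable' := measurable_subtype_coe.comp measurable_fst.snd

instance (t : ℕ) : IsMarkovKernel (historyKernel d M t) := ⟨fun v => v.1.2.2⟩

/-- Given the history, the state is distributed according to the belief. -/
theorem map_history_x (t : ℕ) : μ.map (fun ω => (X.history t ω, X.x t ω)) =
    (μ.map (X.history t)) ⊗ₘ (historyKernel d M t) := by
  have hH := X.measurable_history t
  have hx := X.measurable_x t
  have : IsProbabilityMeasure (μ.map fun ω => (X.history t ω, X.x t ω)) :=
    Measure.isProbabilityMeasure_map (hH.prodMk hx).aemeasurable
  rw [Measure.ext_prod₃_iff']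
  intro B R A hB hR hA
  have hb1 : Measurable[pol.info X.x X.r X.b t] fun ω => (X.history t ω).1 :=
    (comap_measurable _).prodMk (X.measurable_b_info t)
  have hpre : MeasurableSet[pol.info X.x X.r X.b t] ((fun ω => (X.history t ω).1) ⁻¹' B) :=
    hb1 hB
  -- Since `r t` is independent of the past information jointly with the state, adjoining it to the
  -- conditioning leaves the conditional law of the state equal to the belief.
  have hind := X.indepFun_history_r t
  have hbA : Measurable fun ω => (X.b t ω : Measure (E d)) A :=
    (Measure.measurable_coe hA).comp (measurable_subtype_coe.comp (X.measurable_b t))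
  rw [Measure.map_apply (hH.prodMk hx) ((hB.prod hR).prod hA),
    Measure.compProd_apply_prod (hB.prod hR) hA,
    setLIntegral_map (hB.prod hR) ((historyKernel d M t).measurable_coe hA) hH]
  have e1 : (fun ω => (X.history t ω, X.x t ω)) ⁻¹' ((B ×ˢ R) ×ˢ A) =
      (fun ω => ((X.history t ω).1, X.x t ω)) ⁻¹' (B ×ˢ A) ∩ X.r t ⁻¹' R := by
    ext ω
    simp only [history, mem_preimage, mem_prod, mem_inter_iff]
    tauto
  have e2 : (fun ω => ((X.history t ω).1, X.x t ω)) ⁻¹' (B ×ˢ A) =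
      (fun ω => (X.history t ω).1) ⁻¹' B ∩ X.x t ⁻¹' A := rfl
  have e3 : X.history t ⁻¹' (B ×ˢ R) = (fun ω => (X.history t ω).1) ⁻¹' B ∩ X.r t ⁻¹' R := rfl
  rw [e1, hind.measure_inter_preimage_eq_mul _ _ (hB.prod hA) hR, e2, ← X.setLIntegral_b t hA hpre,
    e3]
  let g : (Fin t → Fin M × unitInterval) × ProbabilityMeasure (E d) → ℝ≥0∞ :=
    B.indicator fun v => (v.2 : Measure (E d)) A
  have hg : Measurable g := ((Measure.measurable_coe hA).comp
    (measurable_subtype_coe.comp measurable_snd)).indicator hB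
  let k : unitInterval → ℝ≥0∞ := R.indicator 1
  have hk : Measurable k := measurable_one.indicator hR
  have hgk : IndepFun (fun ω => g (X.history t ω).1) (fun ω => k (X.r t ω)) μ :=
    hind.comp (φ := fun p : ((Fin t → Fin M × unitInterval) × ProbabilityMeasure (E d)) × E d =>
      g p.1) (ψ := k) (hg.comp measurable_fst) hk
  have h1 := lintegral_mul_eq_lintegral_mul_lintegral_of_indepFun (hg.comp hH.fst)
    (hk.comp (X.measurable_r t)) hgk
  have h2 : ∫⁻ ω, g (X.history t ω).1 ∂μ = ∫⁻ ω in (fun ω => (X.history t ω).1) ⁻¹' B,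
      (X.b t ω : Measure (E d)) A ∂μ := by
    rw [← lintegral_indicator (hH.fst hB)]; rfl
  have h3 : ∫⁻ ω, k (X.r t ω) ∂μ = μ (X.r t ⁻¹' R) := by
    rw [← lintegral_indicator_one (X.measurable_r t hR)]; rfl
  have h4 : ∫⁻ ω, ((fun ω => g (X.history t ω).1) * fun ω => k (X.r t ω)) ω ∂μ =
      ∫⁻ ω in (fun ω => (X.history t ω).1) ⁻¹' B ∩ X.r t ⁻¹' R,
        historyKernel d M t (X.history t ω) A ∂μ := by
    rw [← lintegral_indicator ((hH.fst hB).inter (X.measurable_r t hR))]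
    refine lintegral_congr fun ω => ?_
    by_cases hω : (X.history t ω).1 ∈ B <;> by_cases hω' : X.r t ω ∈ R
    · rw [indicator_of_mem (show ω ∈ _ ∩ _ from ⟨hω, hω'⟩)]
      simp only [g, k, Pi.mul_apply, indicator_of_mem hω, indicator_of_mem hω', Pi.one_apply,
        mul_one]
      rfl
    all_goals
      rw [indicator_of_notMem (fun h : ω ∈ _ ∩ _ => by
        first | exact hω h.1 | exact hω' h.2)]
      simp [g, k, hω, hω']
  rw [← h4, ← h2, ← h3]
  exact h1.symm

theorem lintegral_history_x (t : ℕ) {Φ : History d M t × E d → ℝ≥0∞} (hΦ : Measurable Φ) :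
    ∫⁻ ω, Φ (X.history t ω, X.x t ω) ∂μ =
      ∫⁻ ω, ∫⁻ y, Φ (X.history t ω, y) ∂(X.b t ω : Measure (E d)) ∂μ := by
  rw [← lintegral_map hΦ ((X.measurable_history t).prodMk (X.measurable_x t)), X.map_history_x,
    Measure.lintegral_compProd hΦ, lintegral_map ?_ (X.measurable_history t)]
  · rfl
  · exact hΦ.lintegral_kernel_prod_right'

theorem integral_history_x (t : ℕ) {Φ : History d M t × E d → ℝ} (hΦ : Measurable Φ) {K : ℝ}
    (hK : ∀ p, |Φ p| ≤ K) : ∫ ω, Φ (X.history t ω, X.x t ω) ∂μ =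
      ∫ ω, ∫ y, Φ (X.history t ω, y) ∂(X.b t ω : Measure (E d)) ∂μ := by
  have hm := ((X.measurable_history t).prodMk (X.measurable_x t)).aemeasurable (μ := μ)
  have : IsProbabilityMeasure (μ.map (X.history t)) :=
    Measure.isProbabilityMeasure_map (X.measurable_history t).aemeasurable
  rw [← integral_map (f := Φ) hm hΦ.aestronglyMeasurable, X.map_history_x,
    Measure.integral_compProd (Integrable.of_bound hΦ.aestronglyMeasurable K (ae_of_all _ hK)),
    integral_map (X.measurable_history t).aemeasurable]
  · rfl
  · exact (hΦ.stronglyMeasurable.integral_kernel_prod_right'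
      (κ := historyKernel d M t)).aestronglyMeasurable

/-- The next state is distributed according to the transition kernel of the source, given the
present state and the history. -/
theorem lintegral_next (t : ℕ) {g : History d M t × E d → ℝ≥0∞} (hg : Measurable g)
    {A : Set (E d)} (hA : MeasurableSet A) :
    ∫⁻ ω, g (X.history t ω, X.x t ω) * A.indicator 1 (X.x (t + 1) ω) ∂μ =
      ∫⁻ ω, g (X.history t ω, X.x t ω) * S.kernel (X.x t ω) A ∂μ := by
  have hm := (X.measurable_history t).prodMk (X.measurable_x t)
  have hgx : Measurable fun p : History d M t × E d => (g p, p.2) := hg.prodMk measurable_snd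
  have hY : Measurable fun ω => (g (X.history t ω, X.x t ω), X.x t ω) := hgx.comp hm
  -- The noise is independent of the weight and the state, so it can be integrated with both frozen.
  have hind : IndepFun (fun ω => (g (X.history t ω, X.x t ω), X.x t ω)) (X.w t) μ :=
    X.indepFun_history_w hgx
  have hmap := (indepFun_iff_map_prod_eq_prod_map_map hY.aemeasurable
    (X.measurable_w t).aemeasurable).1 hind
  let F : (ℝ≥0∞ × E d) × E d → ℝ≥0∞ := fun p => p.1.1 * A.indicator 1 (S.f p.1.2 p.2)
  have hF : Measurable F := measurable_fst.fst.mul ((measurable_one.indicator hA).comp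
    (S.measurable_f.comp (measurable_fst.snd.prodMk measurable_snd)))
  have h1 : ∫⁻ ω, g (X.history t ω, X.x t ω) * A.indicator 1 (X.x (t + 1) ω) ∂μ =
      ∫⁻ p, F p ∂(μ.map fun ω => ((g (X.history t ω, X.x t ω), X.x t ω), X.w t ω)) := by
    rw [lintegral_map hF (hY.prodMk (X.measurable_w t))]
    refine lintegral_congr fun ω => ?_
    rw [X.dynamics]
  rw [h1, hmap, lintegral_prod _ hF.aemeasurable,
    lintegral_map hF.lintegral_prod_right' hY, X.law_w]
  refine lintegral_congr fun ω => ?_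
  have hI : Measurable fun y => A.indicator (1 : E d → ℝ≥0∞) (S.f (X.x t ω) y) :=
    (measurable_one.indicator hA).comp (S.measurable_f_right _)
  simp only [F]
  rw [lintegral_const_mul _ hI,
    MarkovSource.kernel_apply, Measure.map_apply (S.measurable_f_right _) hA,
    ← lintegral_indicator_one (S.measurable_f_right _ hA)]
  rfl

end CodingProcess

/-- Setwise almost sure equality would have null sets depending on the set. Comparing the products
of `μ` with the two kernels yields a single null set. -/
theorem ae_eq_of_forall_setLIntegral_eq {Ω : Type*} [MeasurableSpace Ω] {μ : Measure Ω}
    [IsFiniteMeasure μ] {d : ℕ} {b c : Ω → ProbabilityMeasure (E d)} (hb : Measurable b)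
    (hc : Measurable c) (h : ∀ A, MeasurableSet A → ∀ B, MeasurableSet B →
      ∫⁻ ω in B, (b ω : Measure (E d)) A ∂μ = ∫⁻ ω in B, (c ω : Measure (E d)) A ∂μ) :
    b =ᵐ[μ] c := by
  let κ : Kernel Ω (E d) := ⟨fun ω => b ω, measurable_subtype_coe.comp hb⟩
  let η : Kernel Ω (E d) := ⟨fun ω => c ω, measurable_subtype_coe.comp hc⟩
  have : IsMarkovKernel κ := ⟨fun ω => (b ω).2⟩
  have : IsMarkovKernel η := ⟨fun ω => (c ω).2⟩
  have hκη : μ ⊗ₘ κ = μ ⊗ₘ η := by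
    rw [Measure.ext_prod_iff]
    intro B A hB hA
    rw [Measure.compProd_apply_prod hB hA, Measure.compProd_apply_prod hB hA]
    exact h A hA B hB
  filter_upwards [Kernel.ae_eq_of_compProd_eq hκη] with ω hω
  exact Subtype.ext hω

/-- Bayes' rule: on each cell the weight is constant, and the kernel integrates to the mass of the
cell times the posterior. The product form also covers null cells. -/
theorem lintegral_cell_kernel {d M : ℕ} {P : ProbabilityMeasure (E d)} (S : MarkovSource d)
    (z : BeliefAction P M) (h : Fin M → ℝ≥0∞) {A : Set (E d)} (hA : MeasurableSet A) :
    ∫⁻ y, h (z.2.toFun y) * S.kernel y A ∂(z.1 : Measure (E d)) =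
      ∫⁻ y, h (z.2.toFun y) * (S.posterior z (z.2.toFun y) : Measure (E d)) A
        ∂(z.1 : Measure (E d)) := by
  rw [lintegral_eq_sum_cell z.2, lintegral_eq_sum_cell z.2]
  refine Finset.sum_congr rfl fun m _ => ?_
  have e1 : ∫⁻ y in z.2.cell m, h (z.2.toFun y) * S.kernel y A ∂(z.1 : Measure (E d)) =
      ∫⁻ y in z.2.cell m, h m * S.kernel y A ∂(z.1 : Measure (E d)) :=
    setLIntegral_congr_fun (z.2.measurableSet_cell m) fun y (hy : z.2.toFun y = m) => by
      simp only [hy]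
  have e2 : ∫⁻ y in z.2.cell m, h (z.2.toFun y) *
        (S.posterior z (z.2.toFun y) : Measure (E d)) A ∂(z.1 : Measure (E d)) =
      ∫⁻ _ in z.2.cell m, h m * (S.posterior z m : Measure (E d)) A ∂(z.1 : Measure (E d)) :=
    setLIntegral_congr_fun (z.2.measurableSet_cell m) fun y (hy : z.2.toFun y = m) => by
      simp only [hy]
  have e3 := congrArg (fun ν : Measure (E d) => ν A) (S.measure_cell_smul_posterior z m)
  simp only [Measure.smul_apply, smul_eq_mul] at e3
  rw [Measure.bind_apply hA S.kernel.aemeasurable] at e3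
  rw [e1, e2, lintegral_const_mul _ (S.kernel.measurable_coe hA), ← e3, setLIntegral_const]
  ring

namespace CodingProcess

variable {d : ℕ} {P : ProbabilityMeasure (E d)} {M : ℕ} {S : MarkovSource d}
  {pol : RandomizedPolicy P M} {π₀ : ProbabilityMeasure (E d)} {Ω : Type*} [MeasurableSpace Ω]
  {μ : Measure Ω} (X : CodingProcess S pol π₀ μ)

/-- The pair (belief, quantizer) that a history determines. -/
def historyPair (pol : RandomizedPolicy P M) {t : ℕ} (v : History d M t) : BeliefAction P M :=
  (v.1.2, pol.enc t v.1.2 v.2)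

theorem measurable_historyPair {t : ℕ} :
    Measurable (historyPair pol : History d M t → BeliefAction P M) :=
  measurable_beliefAction measurable_fst.snd <| (pol.measurable_enc t).comp
    ((measurable_fst.fst.snd.prodMk measurable_fst.snd).prodMk measurable_snd)

theorem measurable_historyPair_toFun {t : ℕ} :
    Measurable fun p : History d M t × E d => (historyPair pol p.1).2.toFun p.2 :=
  (pol.measurable_enc t).comp
    ((measurable_fst.fst.snd.prodMk measurable_fst.snd).prodMk measurable_snd)

theorem measurable_posterior_historyPair {t : ℕ} :
    Measurable fun p : History d M t × Fin M => S.posterior (historyPair pol p.1) p.2 :=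
  measurable_from_prod_countable_left fun m =>
    (S.measurable_posterior m).comp measurable_historyPair

variable [IsProbabilityMeasure μ]

/-- The next state is averaged given the current one, which is then averaged given the history, and
Bayes' rule replaces the kernel by the posterior. Undoing the second average restores the actual
symbol. -/
theorem lintegral_next_posterior (t : ℕ) {h : History d M t × Fin M → ℝ≥0∞} (hh : Measurable h)
    {A : Set (E d)} (hA : MeasurableSet A) :
    ∫⁻ ω, h (X.history t ω, pol.symbol X.x X.r X.b t ω) * A.indicator 1 (X.x (t + 1) ω) ∂μ =
      ∫⁻ ω, h (X.history t ω, pol.symbol X.x X.r X.b t ω) *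
        (S.posterior (X.pair t ω) (pol.symbol X.x X.r X.b t ω) : Measure (E d)) A ∂μ := by
  have hs : Measurable fun p : History d M t × E d =>
      (p.1, (historyPair pol p.1).2.toFun p.2) :=
    measurable_fst.prodMk measurable_historyPair_toFun
  have hg := hh.comp hs
  have hp : Measurable fun p : History d M t × E d =>
      (S.posterior (historyPair pol p.1) ((historyPair pol p.1).2.toFun p.2) : Measure (E d)) A :=
    (Measure.measurable_coe hA).comp
      (measurable_subtype_coe.comp (measurable_posterior_historyPair.comp hs))
  refine (X.lintegral_next t hg hA).trans ?_
  refine (X.lintegral_history_x t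
    (hg.mul ((S.kernel.measurable_coe hA).comp measurable_snd))).trans ?_
  refine Eq.trans ?_ (X.lintegral_history_x t (hg.mul hp)).symm
  exact lintegral_congr fun ω =>
    lintegral_cell_kernel S (X.pair t ω) (fun m => h (X.history t ω, m)) hA

/-- The filtering equation. -/
theorem b_succ (t : ℕ) : ∀ᵐ ω ∂μ,
    X.b (t + 1) ω = S.posterior (X.pair t ω) (pol.symbol X.x X.r X.b t ω) := by
  set J : Ω → Fin (t + 1) → Fin M × unitInterval :=
    fun ω s => (pol.symbol X.x X.r X.b s ω, X.r s ω) with hJ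
  have hle := X.info_le (t + 1)
  have hc : Measurable[pol.info X.x X.r X.b (t + 1)] fun ω =>
      S.posterior (X.pair t ω) (pol.symbol X.x X.r X.b t ω) := by
    have hJm : Measurable[pol.info X.x X.r X.b (t + 1)] J := comap_measurable J
    have hq := (measurable_pi_apply (Fin.last t)).comp hJm
    have hi : pol.info X.x X.r X.b t ≤ pol.info X.x X.r X.b (t + 1) :=
      @Measurable.comap_le _ _ (pol.info X.x X.r X.b (t + 1)) _ _
        ((by fun_prop : Measurable fun (v : Fin (t + 1) → Fin M × unitInterval) (s : Fin t) =>
          v s.castSucc).comp hJm)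
    have hH : Measurable[pol.info X.x X.r X.b (t + 1)] (X.history t) :=
      X.measurable_history_of hi hq.snd
    exact (measurable_posterior_historyPair (S := S) (pol := pol)).comp (hH.prodMk hq.fst)
  -- Both sides are measurable for the information at time t + 1, so it is enough to compare their
  -- integrals over its events.
  refine ae_eq_of_ae_eq_trim (hm := hle) ?_
  refine @ae_eq_of_forall_setLIntegral_eq Ω (pol.info X.x X.r X.b (t + 1)) (μ.trim hle)
    (isFiniteMeasure_trim hle) d _ _ (X.measurable_b_info (t + 1)) hc fun A hA B hB => ?_
  have hbA : Measurable[pol.info X.x X.r X.b (t + 1)] fun ω => (X.b (t + 1) ω : Measure (E d)) A :=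
    (Measure.measurable_coe hA).comp (measurable_subtype_coe.comp (X.measurable_b_info (t + 1)))
  have hcA : Measurable[pol.info X.x X.r X.b (t + 1)] fun ω =>
      (S.posterior (X.pair t ω) (pol.symbol X.x X.r X.b t ω) : Measure (E d)) A :=
    (Measure.measurable_coe hA).comp (measurable_subtype_coe.comp hc)
  rw [restrict_trim hle μ hB, lintegral_trim hle hbA, lintegral_trim hle hcA,
    X.setLIntegral_b (t + 1) hA hB]
  obtain ⟨B', hB', rfl⟩ := hB
  -- The information at time t + 1 is recovered by appending the newest symbol and `r t` to the
  -- earlier pairs.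
  let s : History d M t × Fin M → Fin (t + 1) → Fin M × unitInterval := fun p =>
    Fin.snoc (α := fun _ => Fin M × unitInterval) p.1.1.1 (p.2, p.1.2)
  have hs : Measurable s := by
    refine measurable_pi_lambda _ fun i => ?_
    induction i using Fin.lastCases with
    | last => simpa [s] using measurable_snd.prodMk measurable_fst.snd
    | cast i =>
      simp only [s, Fin.snoc_castSucc]
      exact (measurable_pi_apply i).comp measurable_fst.fst.fst
  have hsJ : ∀ ω, s (X.history t ω, pol.symbol X.x X.r X.b t ω) = J ω := fun ω => by
    funext i
    induction i using Fin.lastCases with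
    | last => simp [s, hJ, history]
    | cast i => simp [s, hJ, history]
  have hh : Measurable fun p =>
      B'.indicator (1 : (Fin (t + 1) → Fin M × unitInterval) → ℝ≥0∞) (s p) :=
    (measurable_one.indicator hB').comp hs
  have key := X.lintegral_next_posterior t hh hA
  simp only [hsJ] at key
  have hBm : MeasurableSet (J ⁻¹' B') := hle _ ⟨B', hB', rfl⟩
  have hxA := X.measurable_x (t + 1) hA
  rw [← lintegral_indicator hBm, ← lintegral_indicator_one (hBm.inter hxA)]
  refine Eq.trans (lintegral_congr fun ω => ?_) (key.trans (lintegral_congr fun ω => ?_))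
  · by_cases h1 : J ω ∈ B' <;> by_cases h2 : X.x (t + 1) ω ∈ A <;>
      simp [indicator, h1, h2]
  · by_cases h1 : J ω ∈ B' <;> simp [indicator, h1]

theorem lintegral_b (t : ℕ) {A : Set (E d)} (hA : MeasurableSet A) :
    ∫⁻ ω, (X.b t ω : Measure (E d)) A ∂μ = μ (X.x t ⁻¹' A) := by
  simpa using X.setLIntegral_b t hA MeasurableSet.univ

/-- The belief process is a Markov chain controlled by the quantizers. -/
theorem integral_b_succ (t : ℕ) (f : ProbabilityMeasure (E d) →ᵇ ℝ) :
    ∫ ω, f (X.b (t + 1) ω) ∂μ = ∫ ω, ∫ ρ, f ρ ∂(S.transition (X.pair t ω)) ∂μ := by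
  have hs : Measurable fun p : History d M t × E d =>
      (p.1, (historyPair pol p.1).2.toFun p.2) :=
    measurable_fst.prodMk measurable_historyPair_toFun
  let Φ : History d M t × E d → ℝ := fun p =>
    f (S.posterior (historyPair pol p.1) ((historyPair pol p.1).2.toFun p.2))
  have hΦ : Measurable Φ :=
    f.continuous.measurable.comp (measurable_posterior_historyPair.comp hs)
  calc ∫ ω, f (X.b (t + 1) ω) ∂μ = ∫ ω, Φ (X.history t ω, X.x t ω) ∂μ :=
        integral_congr_ae ((X.b_succ t).mono fun ω h => by simp only [h]; rfl)
    _ = ∫ ω, ∫ y, Φ (X.history t ω, y) ∂(X.b t ω : Measure (E d)) ∂μ :=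
        X.integral_history_x t hΦ fun p => f.norm_coe_le_norm _
    _ = _ := integral_congr_ae (ae_of_all _ fun ω => ?_)
  simp only
  have hm : Measurable fun y => Φ (X.history t ω, y) := hΦ.comp measurable_prodMk_left
  rw [MarkovSource.integral_transition, integral_eq_sum_cell (X.pair t ω).2
    (Integrable.of_bound hm.aestronglyMeasurable ‖f‖ (ae_of_all _ fun y => f.norm_coe_le_norm _))]
  refine Finset.sum_congr rfl fun m _ => ?_
  rw [setIntegral_congr_fun (g := fun _ => f (S.posterior (X.pair t ω) m))
    ((X.pair t ω).2.measurableSet_cell m)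
    fun y (hy : (X.pair t ω).2.toFun y = m) => by subst hy; rfl]
  rw [setIntegral_const, smul_eq_mul]
  rfl

end CodingProcess

/-! ### Tightness and asymptotic invariance of the occupation measures -/

theorem MarkovSource.measurable_orbit {d : ℕ} (S : MarkovSource d) (x : E d) (t : ℕ) :
    Measurable fun w => S.orbit x w t := by
  induction t with
  | zero => exact measurable_const
  | succ t ih => exact S.measurable_f.comp (ih.prodMk (measurable_pi_apply t))

namespace CodingProcess

variable {d : ℕ} {P : ProbabilityMeasure (E d)} {M : ℕ} {S : MarkovSource d}
  {pol : RandomizedPolicy P M} {π₀ : ProbabilityMeasure (E d)} {Ω : Type*} [MeasurableSpace Ω]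
  {μ : Measure Ω} (X : CodingProcess S pol π₀ μ)

theorem x_eq_orbit (t : ℕ) (ω : Ω) : X.x t ω = S.orbit (X.x 0 ω) (fun s => X.w s ω) t := by
  induction t with
  | zero => rfl
  | succ t ih => rw [X.dynamics, ih]; rfl

variable [IsProbabilityMeasure μ]

theorem map_w : μ.map (fun ω s => X.w s ω) = S.noiseSeq := by
  rw [(iIndepFun_iff_map_fun_eq_infinitePi_map X.measurable_w).1 X.iIndepFun_w,
    MarkovSource.noiseSeq]
  simp only [X.law_w]

/-- A deterministic start makes the state an orbit driven by noise of law `noiseSeq`; the second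
moment hypothesis is thereby transferred to the coded process. -/
theorem lintegral_x {x₀ : E d} (h0 : (π₀ : Measure (E d)) = Measure.dirac x₀) (t : ℕ)
    {g : E d → ℝ≥0∞} (hg : Measurable g) :
    ∫⁻ ω, g (X.x t ω) ∂μ = ∫⁻ w, g (S.orbit x₀ w t) ∂S.noiseSeq := by
  have hx : ∀ᵐ ω ∂μ, X.x 0 ω = x₀ := by
    refine ae_of_ae_map X.measurable_x_zero.aemeasurable (p := fun x => x = x₀) ?_
    rw [X.law_x_zero, h0, ae_dirac_eq]
    rfl
  have hgo : Measurable fun w => g (S.orbit x₀ w t) := hg.comp (S.measurable_orbit x₀ t)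
  rw [← X.map_w, lintegral_map hgo (measurable_pi_lambda _ X.measurable_w)]
  refine lintegral_congr_ae (hx.mono fun ω h => ?_)
  simp only [X.x_eq_orbit t ω, h]

/-- The laws of the states of the source are tight. -/
theorem exists_compact_x {πs : ProbabilityMeasure (E d)} (hπs : S.PositiveHarris πs) {x₀ : E d}
    (h0 : (π₀ : Measure (E d)) = Measure.dirac x₀) {ε : ℝ≥0∞} (hε : 0 < ε) :
    ∃ K : Set (E d), IsCompact K ∧ ∀ t, μ (X.x t ⁻¹' Kᶜ) ≤ ε := by
  set m := ∫⁻ y, ‖y‖ₑ ^ 2 ∂(πs : Measure (E d)) with hm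
  have hmt : m < ∞ := hπs.second_moment_lt_top
  have hsq : Measurable fun y : E d => ‖y‖ₑ ^ 2 := measurable_enorm.pow_const 2
  -- Second moments are at most m + 1 from some time on, and Chebyshev's inequality applies. Earlier
  -- moments may be infinite, but those finitely many laws are tight one by one.
  have hev : ∀ᶠ t in atTop, ∫⁻ ω, ‖X.x t ω‖ₑ ^ 2 ∂μ ≤ m + 1 := by
    have h1 : m < m + 1 := ENNReal.lt_add_right hmt.ne one_ne_zero
    filter_upwards [(hπs.tendsto_second_moment x₀).eventually (gt_mem_nhds h1)] with t ht
    rw [X.lintegral_x h0 t hsq]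
    exact ht.le
  obtain ⟨T, hT⟩ := eventually_atTop.1 hev
  have hfin : ∀ t, ∃ K : Set (E d), IsCompact K ∧ μ (X.x t ⁻¹' Kᶜ) ≤ ε := fun t => by
    have hp : IsProbabilityMeasure (μ.map (X.x t)) :=
      Measure.isProbabilityMeasure_map (X.measurable_x t).aemeasurable
    obtain ⟨K, hK, hKε⟩ := isTightMeasureSet_iff_exists_isCompact_measure_compl_le.1
      (isTightMeasureSet_singleton (μ := μ.map (X.x t))) ε hε
    refine ⟨K, hK, ?_⟩
    rw [← Measure.map_apply (X.measurable_x t) hK.measurableSet.compl]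
    exact hKε _ rfl
  choose K hK hKε using hfin
  obtain ⟨R, hR0, hR⟩ : ∃ R : ℝ≥0, 0 < R ∧ (m + 1) / (R : ℝ≥0∞) ^ 2 ≤ ε := by
    have hlim : Tendsto (fun n : ℕ => (m + 1) / ((n : ℝ≥0) : ℝ≥0∞) ^ 2) atTop (𝓝 0) := by
      have h2 : Tendsto (fun n : ℕ => ((n : ℝ≥0) : ℝ≥0∞) ^ 2) atTop (𝓝 ∞) := by
        simpa using ENNReal.Tendsto.pow (n := 2) ENNReal.tendsto_nat_nhds_top
      simpa using ENNReal.Tendsto.const_div h2 (Or.inr (by finiteness : m + 1 ≠ ∞))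
    obtain ⟨n, hn, hn0⟩ := ((hlim.eventually (gt_mem_nhds hε)).and (eventually_gt_atTop 0)).exists
    exact ⟨n, by exact_mod_cast hn0, hn.le⟩
  refine ⟨Metric.closedBall 0 R ∪ ⋃ t ∈ Finset.range T, K t,
    (isCompact_closedBall _ _).union ((Finset.range T).isCompact_biUnion fun t _ => hK t),
    fun t => ?_⟩
  rcases lt_or_ge t T with ht | ht
  · refine (measure_mono (preimage_mono (compl_subset_compl.2 ?_))).trans (hKε t)
    exact (subset_biUnion_of_mem (u := K) (Finset.mem_range.2 ht)).trans subset_union_right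
  · have hsub : X.x t ⁻¹' (Metric.closedBall 0 R ∪ ⋃ t ∈ Finset.range T, K t)ᶜ ⊆
        {ω | (R : ℝ≥0∞) ^ 2 ≤ ‖X.x t ω‖ₑ ^ 2} := fun ω hω => by
      have h1 : X.x t ω ∉ Metric.closedBall 0 (R : ℝ) := fun h => hω (Or.inl h)
      rw [mem_closedBall_zero_iff, not_le] at h1
      have h2 : (R : ℝ≥0∞) ≤ ‖X.x t ω‖ₑ := by
        rw [enorm_eq_nnnorm, ENNReal.coe_le_coe]
        exact h1.le
      exact pow_le_pow_left' h2 2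
    refine (measure_mono hsub).trans (le_trans ?_ hR)
    refine (meas_ge_le_lintegral_div (hsq.comp (X.measurable_x t)).aemeasurable
      (by simpa using hR0.ne') (by finiteness)).trans ?_
    exact ENNReal.div_le_div_right (hT t ht) _

theorem lintegral_occupation (t : ℕ+) {F : BeliefAction P M → ℝ≥0∞} (hF : Measurable F) :
    ∫⁻ z, F z ∂(X.occupation t : Measure (BeliefAction P M)) =
      ((t : ℕ) : ℝ≥0∞)⁻¹ * ∑ i ∈ Finset.range t, ∫⁻ ω, F (X.pair i ω) ∂μ := by
  change ∫⁻ z, F z ∂(((t : ℕ) : ℝ≥0∞)⁻¹ • ∑ i ∈ Finset.range t, μ.map (X.pair i)) = _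
  rw [lintegral_smul_measure, lintegral_finsetSum_measure, smul_eq_mul]
  simp only [lintegral_map hF (X.measurable_pair _)]

theorem integral_occupation (t : ℕ+) {F : BeliefAction P M → ℝ} (hF : Measurable F) {K : ℝ}
    (hK : ∀ z, |F z| ≤ K) :
    ∫ z, F z ∂(X.occupation t : Measure (BeliefAction P M)) =
      ((t : ℕ) : ℝ)⁻¹ * ∑ i ∈ Finset.range t, ∫ ω, F (X.pair i ω) ∂μ := by
  change ∫ z, F z ∂(((t : ℕ) : ℝ≥0∞)⁻¹ • ∑ i ∈ Finset.range t, μ.map (X.pair i)) = _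
  rw [integral_smul_measure, integral_finsetSum_measure, smul_eq_mul]
  · simp only [integral_map (X.measurable_pair _).aemeasurable hF.aestronglyMeasurable,
      ENNReal.toReal_inv, ENNReal.toReal_natCast]
  · intro i _
    have : IsProbabilityMeasure (μ.map (X.pair i)) :=
      Measure.isProbabilityMeasure_map (X.measurable_pair i).aemeasurable
    exact Integrable.of_bound hF.aestronglyMeasurable K (ae_of_all _ hK)

variable {C : ℝ} {L : ℝ≥0}

/-- Every belief after time 0 is almost surely a posterior, hence regular. Only the initial belief
may fail, and its weight is 1/t. -/
theorem occupation_compl_regularPairs_le (hS : ∀ ρ, S.nextLaw ρ ∈ regularLaws d C L) (t : ℕ+) :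
    (X.occupation t : Measure (BeliefAction P M)) (regularPairs P M C L)ᶜ ≤
      ((t : ℕ) : ℝ≥0∞)⁻¹ := by
  have hm : MeasurableSet (regularPairs P M C L)ᶜ := measurableSet_regularPairs.compl
  rw [← lintegral_indicator_one hm, X.lintegral_occupation t (measurable_one.indicator hm)]
  refine mul_le_of_le_one_right' ?_
  have h : ∀ i, ∫⁻ ω, (regularPairs P M C L)ᶜ.indicator 1 (X.pair i ω) ∂μ =
      μ {ω | X.b i ω ∉ regularLaws d C L} := fun i => by
    exact lintegral_indicator_one (X.measurable_pair i hm)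
  have hsucc : ∀ i, μ {ω | X.b (i + 1) ω ∉ regularLaws d C L} = 0 := fun i => by
    rw [← ae_iff (p := fun ω => X.b (i + 1) ω ∈ regularLaws d C L)]
    filter_upwards [X.b_succ i] with ω hω
    rw [hω]
    exact S.posterior_mem hS _ _
  obtain ⟨n, hn⟩ : ∃ n, (t : ℕ) = n + 1 := ⟨t - 1, (Nat.succ_pred_eq_of_pos t.2).symm⟩
  rw [hn, Finset.sum_range_succ', Finset.sum_eq_zero fun i _ => by rw [h, hsucc], zero_add, h]
  exact prob_le_one

theorem tendsto_occupation_compl_regularPairs (hS : ∀ ρ, S.nextLaw ρ ∈ regularLaws d C L)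
    {τ : ℕ → ℕ+} (hτ : Tendsto (fun n => (τ n : ℕ)) atTop atTop) :
    Tendsto (fun n => (X.occupation (τ n) : Measure (BeliefAction P M)) (regularPairs P M C L)ᶜ)
      atTop (𝓝 0) :=
  tendsto_of_tendsto_of_tendsto_of_le_of_le tendsto_const_nhds
    (ENNReal.tendsto_inv_nat_nhds_zero.comp hτ) (fun _ => zero_le)
    fun n => X.occupation_compl_regularPairs_le hS (τ n)

/-- The occupation measures are asymptotically invariant. -/
theorem abs_integral_occupation_sub_le (t : ℕ+) (f : ProbabilityMeasure (E d) →ᵇ ℝ) :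
    |∫ z, f z.1 ∂(X.occupation t : Measure (BeliefAction P M)) -
      ∫ z, ∫ ρ, f ρ ∂(S.transition z) ∂(X.occupation t : Measure (BeliefAction P M))| ≤
      ((t : ℕ) : ℝ)⁻¹ * (2 * ‖f‖) := by
  have hf : Measurable fun z : BeliefAction P M => f z.1 :=
    f.continuous.measurable.comp measurable_belief
  rw [X.integral_occupation t hf fun z => f.norm_coe_le_norm z.1,
    X.integral_occupation t (S.measurable_integral_transition f)
      fun z => S.abs_integral_transition_le z f]
  simp only [← X.integral_b_succ]
  have hb : ∀ i, |∫ ω, f (X.b i ω) ∂μ| ≤ ‖f‖ := fun i => by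
    refine (norm_integral_le_of_norm_le_const (ae_of_all _ fun ω => f.norm_coe_le_norm _)).trans ?_
    simp
  change |((t : ℕ) : ℝ)⁻¹ * ∑ i ∈ Finset.range t, ∫ ω, f (X.b i ω) ∂μ - _| ≤ _
  -- The Markov property turned the sum into a telescoping one; only the terms at times 0 and `t`
  -- remain, each bounded by `‖f‖`.
  rw [← mul_sub, ← Finset.sum_sub_distrib, Finset.sum_range_sub' fun i => ∫ ω, f (X.b i ω) ∂μ,
    abs_mul, abs_of_nonneg (by positivity)]
  refine mul_le_mul_of_nonneg_left ?_ (by positivity)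
  refine (abs_sub _ _).trans ?_
  linarith [hb 0, hb t]

theorem tendsto_integral_occupation_sub {τ : ℕ → ℕ+}
    (hτ : Tendsto (fun n => (τ n : ℕ)) atTop atTop) (f : ProbabilityMeasure (E d) →ᵇ ℝ) :
    Tendsto (fun n => ∫ z, f z.1 ∂(X.occupation (τ n) : Measure (BeliefAction P M)) -
      ∫ z, ∫ ρ, f ρ ∂(S.transition z) ∂(X.occupation (τ n) : Measure (BeliefAction P M)))
      atTop (𝓝 0) := by
  refine squeeze_zero_norm (fun n => X.abs_integral_occupation_sub_le (τ n) f) ?_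
  simpa using ((tendsto_inv_atTop_nhds_zero_nat (𝕜 := ℝ)).comp hτ).mul_const (2 * ‖f‖)

theorem exists_compact_occupation {πs : ProbabilityMeasure (E d)} (hπs : S.PositiveHarris πs)
    {x₀ : E d} (h0 : (π₀ : Measure (E d)) = Measure.dirac x₀) {ε : ℝ≥0∞} (hε : 0 < ε) :
    ∃ K : Set (E d), IsCompact K ∧ ∀ t,
      ∫⁻ z, (z.1 : Measure (E d)) Kᶜ ∂(X.occupation t : Measure (BeliefAction P M)) ≤ ε := by
  obtain ⟨K, hK, hKε⟩ := X.exists_compact_x hπs h0 hε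
  refine ⟨K, hK, fun t => ?_⟩
  have hKm := hK.measurableSet.compl
  rw [X.lintegral_occupation t (measurable_belief_apply hKm)]
  calc _ ≤ ((t : ℕ) : ℝ≥0∞)⁻¹ * ∑ i ∈ Finset.range t, ε := by
        gcongr with i
        exact (X.lintegral_b i hKm).trans_le (hKε i)
    _ = ε := by
        rw [Finset.sum_const, Finset.card_range, nsmul_eq_mul, ← mul_assoc,
          ENNReal.inv_mul_cancel (by simp) (by simp), one_mul]

/-- A sequence of times either takes one value infinitely often, which gives a constant subsequence,
or tends to infinity. In the second case the nonregular mass vanishes and extraction applies. -/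
theorem isCompact_closure_range_occupation (hP : HasPositiveDensity P) (hS : S.HasRegularDensity)
    {πs : ProbabilityMeasure (E d)} (hπs : S.PositiveHarris πs) {x₀ : E d}
    (h0 : (π₀ : Measure (E d)) = Measure.dirac x₀) : IsCompact (closure (range X.occupation)) := by
  obtain ⟨C, L, hCL⟩ := S.exists_nextLaw_mem_regularLaws hS
  refine isCompact_closure_of_forall_exists_subseq fun u hu => ?_
  choose τ hτ using hu
  by_cases h : ∃ k, ∃ᶠ n in atTop, τ n = k
  · obtain ⟨k, hk⟩ := h
    obtain ⟨φ, hφ, hφk⟩ := extraction_of_frequently_atTop hk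
    refine ⟨X.occupation k, φ, hφ, ?_⟩
    have : u ∘ φ = fun _ => X.occupation k := funext fun n => by
      rw [Function.comp_apply, ← hτ, hφk]
    rw [this]
    exact tendsto_const_nhds
  · simp only [not_exists, not_frequently] at h
    have hlim : Tendsto (fun n => (τ n : ℕ)) atTop atTop := by
      refine tendsto_atTop.2 fun k => ?_
      have h1 : ∀ᶠ n in atTop, ∀ j ∈ Finset.range k, (τ n : ℕ) ≠ j := by
        refine (Finset.eventually_all _).2 fun j _ => ?_
        rcases Nat.eq_zero_or_pos j with rfl | hj
        · exact Eventually.of_forall fun n => (τ n).ne_zero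
        · exact (h ⟨j, hj⟩).mono fun n hn he => hn (PNat.eq he)
      exact h1.mono fun n hn => not_lt.1 fun hlt => hn _ (Finset.mem_range.2 hlt) rfl
    obtain rfl : (fun n => X.occupation (τ n)) = u := funext hτ
    refine exists_subseq_tendsto hP (X.tendsto_occupation_compl_regularPairs hCL hlim)
      fun ε hε => ?_
    obtain ⟨K, hK, hKε⟩ := X.exists_compact_occupation hπs h0 hε
    exact ⟨K, hK, fun n => hKε (τ n)⟩

end CodingProcess

end ZeroDelay

end

theorem proposition1 {d M : ℕ} {U : Type*} [TopologicalSpace U] [CompactSpace U] [Nonempty U]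
    (P : ProbabilityMeasure (E d)) (hP : HasPositiveDensity P)
    (S : MarkovSource d) (hS : S.HasRegularDensity)
    (c₀ : E d × U → ℝ) (hc₀ : Continuous c₀) (hc₀_nonneg : ∀ p, 0 ≤ c₀ p)
    (hc₀_bdd : ∃ K, ∀ p, c₀ p ≤ K)
    (πs : ProbabilityMeasure (E d)) (hπs : S.PositiveHarris πs) :
    (∀ (π₀ : ProbabilityMeasure (E d)) (pol : RandomizedPolicy P M)
        (Ω : Type*) [MeasurableSpace Ω] (μ : Measure Ω) [IsProbabilityMeasure μ]
        (X : CodingProcess S pol π₀ μ) (τ : ℕ → ℕ+) (_ : StrictMono τ)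
        (v : ProbabilityMeasure (BeliefAction P M)),
        Tendsto (fun n => X.occupation (τ n)) atTop (𝓝 v) →
          v ∈ S.ergodicOccupationMeasures P M ∧
          (∀ t, Integrable (stageCost c₀) (X.occupation t : Measure (BeliefAction P M))) ∧
          Integrable (stageCost c₀) (v : Measure (BeliefAction P M)) ∧
          Tendsto (fun n => ∫ z, stageCost c₀ z ∂(X.occupation (τ n) : Measure (BeliefAction P M)))
            atTop (𝓝 (∫ z, stageCost c₀ z ∂(v : Measure (BeliefAction P M))))) ∧
    (∀ (x₀ : E d) (π₀ : ProbabilityMeasure (E d)), (π₀ : Measure (E d)) = Measure.dirac x₀ →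
      ∀ (pol : RandomizedPolicy P M)
        (Ω : Type*) [MeasurableSpace Ω] (μ : Measure Ω) [IsProbabilityMeasure μ]
        (X : CodingProcess S pol π₀ μ), IsCompact (closure (range X.occupation))) ∧
    (IsCompact (S.ergodicOccupationMeasures P M) ∧
      ∀ v ∈ S.ergodicOccupationMeasures P M, ∀ A : Set (E d), MeasurableSet A →
        ∫⁻ z, (z.1 : Measure (E d)) A ∂(v : Measure (BeliefAction P M)) =
          (πs : Measure (E d)) A) := by
  obtain ⟨K, hK⟩ := hc₀_bdd
  obtain ⟨C, L, hCL⟩ := S.exists_nextLaw_mem_regularLaws hS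
  have hc : IsRegularTest C L (stageCost c₀ : BeliefAction P M → ℝ) :=
    isRegularTest_stageCost hP hc₀ hc₀_nonneg hK
  refine ⟨fun π₀ pol Ω _ μ _ X τ hτ v hv => ?_,
    fun x₀ π₀ h0 pol Ω _ μ _ X => X.isCompact_closure_range_occupation hP hS hπs h0,
    MarkovSource.isCompact_ergodicOccupationMeasures hP hS hπs.unique,
    fun v hv A hA => MarkovSource.lintegral_belief_of_mem hπs.unique hv hA⟩
  have hlim : Tendsto (fun n => (τ n : ℕ)) atTop atTop :=
    StrictMono.tendsto_atTop fun i j hij => hτ hij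
  have hreg := X.tendsto_occupation_compl_regularPairs hCL hlim
  exact ⟨MarkovSource.mem_ergodicOccupationMeasures_of_tendsto hP hv hreg
      (X.tendsto_integral_occupation_sub hlim),
    fun t => hc.integrable _, hc.integrable _, hc.tendsto_integral hv hreg⟩
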